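/- Let $M$ be an oriented smooth $4$-manifold and let $\pi:N\to M$ be the bundle whose sections are the Lorentzian metrics (signature $(-,+,+,+)$) on $M$. Let $J^k(M,N)$ be its bundle of $k$-jets of local sections. Positively oriented local coordinates $(x^\mu)$ on $M$ induce coordinates $(x^\mu,y_{\mu\nu},z_{\mu\nu\alpha},z_{\mu\nu\alpha\beta},\dots)$ on $J^k(M,N)$, where $y_{\mu\nu}=g_{\mu\nu}$, $z_{\mu\nu\alpha}=\partial_\alpha g_{\mu\nu}$, $z_{\mu\nu\alpha\beta}=\partial_\alpha\partial_\beta g_{\mu\nu}$, and so on, along the jet of a metric $g$. Write $d_4x$ for the exterior product of the four $dx^\mu$, and $\pi^3_2:J^3(M,N)\to J^2(M,N)$ for the forgetful map. Let $\Lambda$ be a smooth semi-basic $4$-form on $J^2(M,N)$ (a second-order Lagrange form), so that locally $\Lambda=L\,d_4x$ with $L=L(x,y,z)$. Assume that $\Lambda$ is invariant under the action on $J^2(M,N)$ of the orientation preserving diffeomorphisms of $M$. For each system of positively oriented coordinates $(x^\mu)$ let $$\Theta_{(x)}=(\pi^3_2)^*L\,d_4x+p^{\mu\nu\alpha\beta}\,(dz_{\mu\nu\alpha}-z_{\mu\nu\alpha\gamma}\,dx^\gamma)\wedge(\partial_\beta\lrcorner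 d_4x)+p^{\mu\nu\alpha}\,(dy_{\mu\nu}-z_{\mu\nu\gamma}\,dx^\gamma)\wedge(\partial_\alpha\lrcorner d_4x)$$ on the induced coordinate domain of $J^3(M,N)$ (summation over all values of repeated indices), where $p^{\mu\nu\alpha\beta}$ and $p^{\mu\nu\alpha}$ are the functions on $J^3(M,N)$ such that for every local section $\sigma$ $$(j^3\sigma)^*p^{\mu\nu\alpha\beta}=(j^2\sigma)^*\frac{\partial L}{\partial z_{\mu\nu\alpha\beta}},\qquad (j^3\sigma)^*p^{\mu\nu\alpha}=(j^2\sigma)^*\frac{\partial L}{\partial z_{\mu\nu\alpha}}-\frac{\partial}{\partial x^\beta}\Big((j^2\sigma)^*\frac{\partial L}{\partial z_{\mu\nu\alpha\beta}}\Big).$$ Here $\partial L/\partial z_{\mu\nu\alpha}$ and $\partial L/\partial z_{\mu\nu\alpha\beta}$ are the partial derivatives that are symmetric in $\mu\nu$ and in $\alpha\beta$ and are normalised so that the differential of $L$ along the fibres of $J^2(M,N)\to M$ is $\frac{\partial L}{\partial y_{\mu\nu}}dy_{\mu\nu}+\frac{\partial L}{\partial z_{\mu\nu\alpha}}dz_{\mu\nu\alpha}+\frac{\partial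 L}{\partial z_{\mu\nu\alpha\beta}}dz_{\mu\nu\alpha\beta}$, summed over all index values. Then: 1. The local forms $\Theta_{(x)}$ exist, and they do not depend on the coordinates: for any two systems of positively oriented coordinates the corresponding forms agree on the common part of their domains. Hence there is exactly one smooth $4$-form $\Theta$ on $J^3(M,N)$ (the De Donder form of $\Lambda$) that equals $\Theta_{(x)}$ in all positively oriented coordinates. 2. $\Theta$ is obtained from $\Lambda$ by a natural differential operator. That is: - $\Theta$ depends linearly on $\Lambda$; - the value of $\Theta$ at $j\in J^3(M,N)$ depends only on the derivatives of order at most $2$ of the components of $\Lambda$ at $\pi^3_2(j)$; - if $M'$ is a second oriented smooth $4$-manifold with an invariant Lagrange form $\Lambda'$ and De Donder form $\Theta'$, and $f$ is an orientation preserving diffeomorphism of an open subset $U\subseteq M$ onto an open subset of $M'$ such that $\Lambda=(J^2f)^*\Lambda'$ over $U$, then $\Theta=(J^3f)^*\Theta'$ over $U$, where $J^kf(j^k_x\sigma)=j^k_{f(x)}\big((f^{-1})^*\sigma\big)$. -/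

import Mathlib

open scoped Manifold ContDiff Topology

noncomputable section

namespace DeDonder

/-- The model space `ℝ⁴`. -/
abbrev Coord : Type := EuclideanSpace ℝ (Fin 4)

/-- The standard basis vector `e_μ` of `ℝ⁴`. -/
def unitVec (μ : Fin 4) : Coord := EuclideanSpace.single μ 1

/-- The iterated partial derivative `∂^m f / ∂x^{α₁} … ∂x^{α_m}` at `ξ`. -/
def pd {m : ℕ} (α : Fin m → Fin 4) (f : Coord → ℝ) (ξ : Coord) : ℝ :=
  iteratedFDeriv ℝ m f ξ (fun i => unitVec (α i))

section Calculus

theorem infty_add_le (i : ℕ) : (∞ : WithTop ℕ∞) + (i : WithTop ℕ∞) ≤ ∞ := by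
  exact_mod_cast le_top (a := (⊤ : ℕ∞) + (i : ℕ∞))

theorem natCast_le_infty (i : ℕ) : (i : WithTop ℕ∞) ≤ ∞ := by
  exact_mod_cast le_top (a := (i : ℕ∞))

theorem iteratedFDeriv_perm {f : Coord → ℝ} {U : Set Coord} (hU : IsOpen U)
    (hf : ContDiffOn ℝ ∞ f U) (m : ℕ) :
    ∀ (ξ : Coord), ξ ∈ U → ∀ (v : Fin m → Coord) (s : Equiv.Perm (Fin m)),
      iteratedFDeriv ℝ m f ξ (v ∘ s) = iteratedFDeriv ℝ m f ξ v := by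
  have key : ∀ (m : ℕ) (ξ : Coord), ξ ∈ U → ContDiffAt ℝ ∞ (iteratedFDeriv ℝ m f) ξ := by
    intro m ξ hξ
    have := (hf.contDiffAt (hU.mem_nhds hξ))
    exact this.iteratedFDeriv_right (m := ∞) (i := m) (infty_add_le m)
  induction m with
  | zero =>
    intro ξ _ v s
    congr 1
    exact Subsingleton.elim _ _
  | succ m ih =>
    intro ξ hξ
    have hev : ∀ (v : Fin m → Coord) (s : Equiv.Perm (Fin m)) (w : Coord),
        fderiv ℝ (iteratedFDeriv ℝ m f) ξ w (v ∘ s) = fderiv ℝ (iteratedFDeriv ℝ m f) ξ w v := by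
      intro v s w
      have hd : DifferentiableAt ℝ (iteratedFDeriv ℝ m f) ξ :=
        (key m ξ hξ).differentiableAt (by simp)
      have h1 : ∀ u : Fin m → Coord, fderiv ℝ (iteratedFDeriv ℝ m f) ξ w u
          = fderiv ℝ (fun y => iteratedFDeriv ℝ m f y u) ξ w := by
        intro u
        rw [fderiv_continuousMultilinear_apply_const_apply hd]
      rw [h1, h1]
      congr 1
      apply Filter.EventuallyEq.fderiv_eq
      filter_upwards [hU.mem_nhds hξ] with y hy
      exact ih y hy v s
    -- permutations fixing `0`
    have hfix : ∀ (v : Fin (m+1) → Coord) (s : Equiv.Perm (Fin (m+1))), s 0 = 0 →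
        iteratedFDeriv ℝ (m+1) f ξ (v ∘ s) = iteratedFDeriv ℝ (m+1) f ξ v := by
      intro v s hs
      rw [iteratedFDeriv_succ_apply_left, iteratedFDeriv_succ_apply_left]
      have hne : ∀ i : Fin m, s i.succ ≠ 0 := fun i h =>
        (Fin.succ_ne_zero i) (s.injective (h.trans hs.symm))
      let t : Fin m → Fin m := fun i => (s i.succ).pred (hne i)
      have ht : Function.Injective t := by
        intro i j hij
        have := Fin.pred_inj.1 hij
        exact Fin.succ_injective _ (s.injective this)
      let t' : Equiv.Perm (Fin m) := Equiv.ofBijective t ((Fintype.bijective_iff_injective_and_card t).2 ⟨ht, rfl⟩)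
      have : Fin.tail (v ∘ s) = Fin.tail v ∘ t' := by
        funext i
        simp [Fin.tail, t', t]
      rw [this, Function.comp_apply, hs, hev]
    rcases m with _ | m
    · intro v s
      congr 1
      have : s = 1 := Equiv.ext fun i => by have := (s i).2; have := i.2; apply Fin.ext; simp
      subst this; rfl
    have hsw : ∀ (v : Fin (m+2) → Coord),
        iteratedFDeriv ℝ (m+2) f ξ (v ∘ Equiv.swap 0 1) = iteratedFDeriv ℝ (m+2) f ξ v := by
      intro v
      have h2 : ∀ u : Fin (m+2) → Coord, iteratedFDeriv ℝ (m+2) f ξ u =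
          fderiv ℝ (fderiv ℝ (fun y => iteratedFDeriv ℝ m f y (Fin.tail (Fin.tail u)))) ξ (u 0) (u 1) := by
        intro u
        rw [iteratedFDeriv_succ_apply_left]
        have hd : DifferentiableAt ℝ (iteratedFDeriv ℝ (m+1) f) ξ :=
          (key _ ξ hξ).differentiableAt (by simp)
        rw [← fderiv_continuousMultilinear_apply_const_apply hd]
        have e1 : (fun y => iteratedFDeriv ℝ (m+1) f y (Fin.tail u)) =ᶠ[𝓝 ξ]
            (fun y => fderiv ℝ (fun y => iteratedFDeriv ℝ m f y (Fin.tail (Fin.tail u))) y (u 1)) := by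
          filter_upwards [hU.mem_nhds hξ] with y hy
          rw [iteratedFDeriv_succ_apply_left,
            ← fderiv_continuousMultilinear_apply_const_apply ((key _ y hy).differentiableAt (by simp))]
          rfl
        rw [e1.fderiv_eq]
        have hc : ContDiffAt ℝ ∞ (fun y => iteratedFDeriv ℝ m f y (Fin.tail (Fin.tail u))) ξ := by
          have := key m ξ hξ
          exact (ContinuousMultilinearMap.apply ℝ (fun _ : Fin m => Coord) ℝ
            (Fin.tail (Fin.tail u))).contDiff.contDiffAt.comp ξ this
        have hd2 : DifferentiableAt ℝ (fderiv ℝ (fun y => iteratedFDeriv ℝ m f y (Fin.tail (Fin.tail u)))) ξ :=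
          (hc.fderiv_right (m := 1) (by simpa [one_add_one_eq_two] using natCast_le_infty 2)).differentiableAt one_ne_zero
        rw [fderiv_clm_apply hd2 (differentiableAt_const _)]
        simp
      have hc : ContDiffAt ℝ ∞ (fun y => iteratedFDeriv ℝ m f y (Fin.tail (Fin.tail v))) ξ := by
        have := key m ξ hξ
        exact (ContinuousMultilinearMap.apply ℝ (fun _ : Fin m => Coord) ℝ
          (Fin.tail (Fin.tail v))).contDiff.contDiffAt.comp ξ this
      have hs := hc.isSymmSndFDerivAt (by simpa using natCast_le_infty 2)
      have ht : Fin.tail (Fin.tail (v ∘ Equiv.swap 0 1)) = Fin.tail (Fin.tail v) := by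
        funext i
        simp only [Fin.tail, Function.comp]
        rw [Equiv.swap_apply_of_ne_of_ne]
        · exact Fin.succ_ne_zero _
        · intro h
          have := congrArg Fin.val h
          simp at this
      rw [h2, h2, ht]
      simpa using hs.eq (v 1) (v 0)
    have hsw' : ∀ (p : Fin (m+2)) (v : Fin (m+2) → Coord),
        iteratedFDeriv ℝ (m+2) f ξ (v ∘ Equiv.swap 0 p) = iteratedFDeriv ℝ (m+2) f ξ v := by
      intro p v
      by_cases h0 : p = 0
      · subst h0; simp
      by_cases h1 : p = 1
      · subst h1; exact hsw v
      have e : (Equiv.swap 0 p : Equiv.Perm (Fin (m+2))) =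
          Equiv.swap 1 p * Equiv.swap 0 1 * Equiv.swap 1 p := by
        rw [Equiv.swap_mul_swap_mul_swap (by simp) (Ne.symm h0), Equiv.swap_comm]
      have hz : (Equiv.swap 1 p : Equiv.Perm (Fin (m+2))) 0 = 0 :=
        Equiv.swap_apply_of_ne_of_ne (by simp) (Ne.symm h0)
      rw [e]
      have : v ∘ ⇑(Equiv.swap 1 p * Equiv.swap 0 1 * Equiv.swap 1 p : Equiv.Perm (Fin (m+2))) =
        ((v ∘ Equiv.swap 1 p) ∘ Equiv.swap 0 1) ∘ Equiv.swap 1 p := rfl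
      rw [this, hfix _ _ hz, hsw, hfix _ _ hz]
    intro v s
    have e : s = Equiv.swap 0 (s 0) * (Equiv.swap 0 (s 0) * s) := by
      rw [← mul_assoc, Equiv.swap_mul_self, one_mul]
    have : v ∘ s = (v ∘ Equiv.swap 0 (s 0)) ∘ ⇑(Equiv.swap 0 (s 0) * s) := by
      conv_lhs => rw [e]
      rfl
    rw [this, hfix _ _ (by simp), hsw']

theorem pd_perm {f : Coord → ℝ} {U : Set Coord} (hU : IsOpen U)
    (hf : ContDiffOn ℝ ∞ f U) {ξ : Coord} (hξ : ξ ∈ U) {m : ℕ} (α : Fin m → Fin 4)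
    (s : Equiv.Perm (Fin m)) : pd (α ∘ s) f ξ = pd α f ξ :=
  iteratedFDeriv_perm hU hf m ξ hξ (fun i => unitVec (α i)) s

theorem iteratedFDeriv_eq_zero_of_pd {f : Coord → ℝ} {ξ : Coord} {m : ℕ}
    (h : ∀ α : Fin m → Fin 4, pd α f ξ = 0) : iteratedFDeriv ℝ m f ξ = 0 := by
  apply ContinuousMultilinearMap.toMultilinearMap_injective
  apply Module.Basis.ext_multilinear (fun _ => (EuclideanSpace.basisFun (Fin 4) ℝ).toBasis)
  intro α
  have := h α
  simpa [pd, unitVec] using this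

/-- Smoothness of partial derivatives depending on parameters. -/
theorem contDiffOn_pd_param {W : Type*} [NormedAddCommGroup W] [NormedSpace ℝ W]
    {U : Set (W × Coord)} (hU : IsOpen U) {F : W → Coord → ℝ}
    (hF : ContDiffOn ℝ ∞ (fun p : W × Coord => F p.1 p.2) U) (m : ℕ) (v : Fin m → Coord) :
    ContDiffOn ℝ ∞ (fun p : W × Coord => iteratedFDeriv ℝ m (F p.1) p.2 v) U := by
  induction m with
  | zero => simpa using hF
  | succ m ih =>
    have h := ih (Fin.tail v)
    have h' : ContDiffOn ℝ ∞ (fun p : W × Coord =>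
        fderiv ℝ (fun p : W × Coord => iteratedFDeriv ℝ m (F p.1) p.2 (Fin.tail v)) p (0, v 0)) U :=
      (h.fderiv_of_isOpen hU (m := ∞) (infty_add_le 1)).clm_apply contDiffOn_const
    refine h'.congr ?_
    rintro ⟨w, ξ⟩ hp
    have hs : ∀ᶠ η in 𝓝 ξ, (w, η) ∈ U :=
      (Continuous.prodMk_right w).continuousAt.preimage_mem_nhds (hU.mem_nhds hp)
    have hw : ContDiffAt ℝ ∞ (F w) ξ := by
      have h1 : ContDiffAt ℝ ∞ (fun p : W × Coord => F p.1 p.2) (w, ξ) :=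
        hF.contDiffAt (hU.mem_nhds hp)
      exact h1.comp ξ (contDiffAt_const.prodMk contDiffAt_id)
    have hd : DifferentiableAt ℝ (iteratedFDeriv ℝ m (F w)) ξ :=
      (hw.iteratedFDeriv_right (m := ∞) (i := m) (infty_add_le m)).differentiableAt (by simp)
    simp only
    rw [iteratedFDeriv_succ_apply_left, ← fderiv_continuousMultilinear_apply_const_apply hd]
    have hd' : DifferentiableAt ℝ
        (fun p : W × Coord => iteratedFDeriv ℝ m (F p.1) p.2 (Fin.tail v)) (w, ξ) :=
      (h.contDiffAt (hU.mem_nhds hp)).differentiableAt (by simp)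
    have hc : HasFDerivAt (fun η : Coord => (w, η)) (ContinuousLinearMap.inr ℝ W Coord) ξ :=
      hasFDerivAt_prodMk_right w ξ
    have := (hd'.hasFDerivAt.comp ξ hc).fderiv
    rw [show (fun y => iteratedFDeriv ℝ m (F w) y (Fin.tail v)) =
      (fun p : W × Coord => iteratedFDeriv ℝ m (F p.1) p.2 (Fin.tail v)) ∘ (fun η => (w, η)) from rfl,
      this]
    simp

/-- Products and compositions of functions whose jet vanishes. -/
theorem jet_zero_mul_comp {U T : Set Coord} (hU : IsOpen U) (hT : IsOpen T) {τ : Coord → Coord}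
    {a : Coord → ℝ} {d : Coord → ℝ} (hτ : ContDiffOn ℝ ∞ τ U) (ha : ContDiffOn ℝ ∞ a U)
    (hd : ContDiffOn ℝ ∞ d T) (hst : Set.MapsTo τ U T) {ξ : Coord} (hξ : ξ ∈ U) {k : ℕ}
    (h : ∀ m ≤ k, iteratedFDeriv ℝ m d (τ ξ) = 0) :
    ∀ m ≤ k, iteratedFDeriv ℝ m (fun η => a η * d (τ η)) ξ = 0 := by
  have hcomp : ∀ m ≤ k, iteratedFDerivWithin ℝ m (d ∘ τ) U ξ = 0 := by
    intro m hm
    obtain ⟨D, hD1, hD⟩ : ∃ D : ℝ, 1 ≤ D ∧ ∀ i ≤ m, ‖iteratedFDerivWithin ℝ i τ U ξ‖ ≤ D := by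
      refine ⟨1 + ∑ i ∈ Finset.range (m+1), ‖iteratedFDerivWithin ℝ i τ U ξ‖, ?_, ?_⟩
      · have : 0 ≤ ∑ i ∈ Finset.range (m+1), ‖iteratedFDerivWithin ℝ i τ U ξ‖ := by positivity
        linarith
      · intro i hi
        have := Finset.single_le_sum (f := fun i => ‖iteratedFDerivWithin ℝ i τ U ξ‖)
          (fun _ _ => norm_nonneg _) (Finset.mem_range.2 (Nat.lt_succ_of_le hi))
        linarith
    have := norm_iteratedFDerivWithin_comp_le (n := m) (N := ∞) (C := 0) (D := D) hd hτ
      (natCast_le_infty m)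
      hT.uniqueDiffOn hU.uniqueDiffOn hst hξ ?_ ?_
    · simpa using this
    · intro i hi
      rw [iteratedFDerivWithin_of_isOpen i hT (hst hξ), h i (hi.trans hm), norm_zero]
    · intro i hi him
      calc _ ≤ D := hD i him
        _ = D ^ 1 := (pow_one _).symm
        _ ≤ D ^ i := pow_le_pow_right₀ hD1 hi
  intro m hm
  have := norm_iteratedFDerivWithin_mul_le (N := ∞) (n := m) ha (hd.comp hτ hst) hU.uniqueDiffOn hξ
    (natCast_le_infty m)
  rw [iteratedFDerivWithin_of_isOpen m hU hξ] at this
  rw [← norm_le_zero_iff]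
  refine this.trans (le_of_eq (Finset.sum_eq_zero ?_))
  intro i hi
  rw [hcomp (m - i) (by omega)]
  simp

end Calculus

section Lorentz

/-- A bilinear form on a real (four-dimensional) vector space is Lorentzian if it is symmetric of
signature `(-,+,+,+)`. -/
def IsLorentzian {T : Type*} [AddCommGroup T] [Module ℝ T] (b : LinearMap.BilinForm ℝ T) : Prop :=
  b.IsSymm ∧ sigPos b.toQuadraticMap = 3 ∧ sigNeg b.toQuadraticMap = 1

/-- The bilinear form on `ℝ⁴` with components `y μ ν`. -/
def bilinOf (y : Fin 4 → Fin 4 → ℝ) : LinearMap.BilinForm ℝ (Fin 4 → ℝ) :=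
  Matrix.toBilin' (Matrix.of y)

theorem bilinOf_apply (y : Fin 4 → Fin 4 → ℝ) (v w : Fin 4 → ℝ) :
    bilinOf y v w = ∑ i, ∑ j, v i * y i j * w j := by
  simp [bilinOf, Matrix.toBilin'_apply]

theorem bilinOf_isSymm {y : Fin 4 → Fin 4 → ℝ} :
    (bilinOf y).IsSymm ↔ ∀ μ ν, y μ ν = y ν μ := by
  constructor
  · intro h μ ν
    have := h.eq (Pi.single μ 1) (Pi.single ν 1)
    simpa [bilinOf, Matrix.toBilin'_single] using this
  · intro h
    refine ⟨fun v w => ?_⟩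
    simp only [bilinOf_apply]
    rw [Finset.sum_comm]
    refine Finset.sum_congr rfl fun i _ => Finset.sum_congr rfl fun j _ => ?_
    rw [h j i]; ring

theorem IsLorentzian.comp {T T' : Type*} [AddCommGroup T] [Module ℝ T] [AddCommGroup T']
    [Module ℝ T'] {b : LinearMap.BilinForm ℝ T} (hb : IsLorentzian b) (A : T' ≃ₗ[ℝ] T) :
    IsLorentzian (b.comp A.toLinearMap A.toLinearMap) := by
  have he : QuadraticMap.Equivalent
      (LinearMap.BilinMap.toQuadraticMap (b.comp A.toLinearMap A.toLinearMap))
      (LinearMap.BilinMap.toQuadraticMap b) := ⟨⟨A, fun v => by simp⟩⟩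
  refine ⟨⟨fun v w => ?_⟩, ?_, ?_⟩
  · simpa using hb.1.eq (A v) (A w)
  · rw [he.sigPos_eq]; exact hb.2.1
  · rw [he.sigNeg_eq]; exact hb.2.2

/-- The set of components with at least three positive and one negative directions. -/
def lorentzSet : Set (Fin 4 → Fin 4 → ℝ) :=
  {y | 3 ≤ sigPos (bilinOf y).toQuadraticMap ∧ 1 ≤ sigNeg (bilinOf y).toQuadraticMap}

theorem isLorentzian_bilinOf {y : Fin 4 → Fin 4 → ℝ} (h : ∀ μ ν, y μ ν = y ν μ) :
    IsLorentzian (bilinOf y) ↔ y ∈ lorentzSet := by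
  have hs := QuadraticForm.sigPos_add_sigNeg_add_radical (Q := (bilinOf y).toQuadraticMap)
  simp only [Module.finrank_fintype_fun_eq_card, Fintype.card_fin] at hs
  simp only [IsLorentzian, lorentzSet, Set.mem_ofPred_eq, bilinOf_isSymm]
  constructor
  · rintro ⟨-, h1, h2⟩; omega
  · rintro ⟨h1, h2⟩; exact ⟨h, by omega, by omega⟩

theorem isOpen_le_sigPos (c : ℝ) (n : ℕ) :
    IsOpen {y : Fin 4 → Fin 4 → ℝ | n ≤ sigPos (c • (bilinOf y).toQuadraticMap)} := by
  rw [isOpen_iff_mem_nhds]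
  intro y hy
  obtain ⟨W, hW, hpos⟩ := exists_finrank_eq_sigPos_and_posDef (c • (bilinOf y).toQuadraticMap)
  have hq : Continuous (fun p : (Fin 4 → Fin 4 → ℝ) × (Fin 4 → ℝ) =>
      (c • (bilinOf p.1).toQuadraticMap) p.2) := by
    simp only [smul_apply, LinearMap.BilinMap.toQuadraticMap_apply, bilinOf_apply]
    fun_prop
  let S : Set (Fin 4 → ℝ) := (W : Set (Fin 4 → ℝ)) ∩ Metric.sphere 0 1
  have hS : IsCompact S := (isCompact_sphere 0 1).inter_left W.closed_of_finiteDimensional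
  have hev : ∀ᶠ y' in 𝓝 y, ∀ v ∈ S, 0 < (c • (bilinOf y').toQuadraticMap) v := by
    apply hS.eventually_forall_of_forall_eventually
    intro v hv
    have hv0 : v ≠ 0 := by
      rintro rfl
      simpa [S] using hv.2
    have h0 : 0 < (c • (bilinOf y).toQuadraticMap) v := by
      have := hpos ⟨v, hv.1⟩ (by simpa using hv0)
      simpa using this
    exact hq.continuousAt.eventually (lt_mem_nhds h0)
  filter_upwards [hev] with y' hy'
  refine le_trans (hy.trans hW.ge) (le_sigPos_of_posDef _ (V := W) ?_)
  rintro ⟨w, hw⟩ hw0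
  have hw0' : w ≠ 0 := by simpa using hw0
  have hn : 0 < ‖w‖ := norm_pos_iff.2 hw0'
  have h1 := hy' (‖w‖⁻¹ • w) ⟨W.smul_mem _ hw, by simp [norm_smul, hn.ne']⟩
  rw [QuadraticMap.map_smul] at h1
  have : 0 < ‖w‖⁻¹ * ‖w‖⁻¹ := by positivity
  have h2 := (mul_pos_iff_of_pos_left this).1 h1
  simpa using h2

theorem isOpen_lorentzSet : IsOpen lorentzSet := by
  have h1 := isOpen_le_sigPos 1 3
  have h2 := isOpen_le_sigPos (-1) 1
  have e : ∀ Q : QuadraticForm ℝ (Fin 4 → ℝ), (-1 : ℝ) • Q = -Q := fun Q => by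
    ext v; simp
  simp only [one_smul, e, sigPos_neg] at h1 h2
  exact h1.inter h2

end Lorentz

section Model

/-- Arrays `(y_{μν}, z_{μνλ₁}, …, z_{μνλ₁…λ_k})`, symmetric in `μν` and symmetric in the `λ`'s. -/
def JetFib (k : ℕ) :
    Submodule ℝ (∀ m : Fin (k + 1), Fin 4 → Fin 4 → (Fin m → Fin 4) → ℝ) where
  carrier := {z | ∀ m μ ν α, z m μ ν α = z m ν μ α ∧
    ∀ s : Equiv.Perm (Fin m), z m μ ν (α ∘ s) = z m μ ν α}
  zero_mem' := by intro m μ ν α; simp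
  add_mem' := by
    intro a b ha hb m μ ν α
    refine ⟨?_, fun s => ?_⟩
    · simp only [Pi.add_apply, (ha m μ ν α).1, (hb m μ ν α).1]
    · simp only [Pi.add_apply, (ha m μ ν α).2 s, (hb m μ ν α).2 s]
  smul_mem' := by
    intro c a ha m μ ν α
    refine ⟨?_, fun s => ?_⟩
    · simp only [Pi.smul_apply, (ha m μ ν α).1]
    · simp only [Pi.smul_apply, (ha m μ ν α).2 s]

/-- The coordinate space `(x^μ, y_{μν}, z_{μνλ₁}, …, z_{μνλ₁…λ_k})`. -/
abbrev JetModel (k : ℕ) : Type := Coord × JetFib k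

/-- The degree-zero part `y_{μν}`. -/
def JetFib.y {k : ℕ} (z : JetFib k) (μ ν : Fin 4) : ℝ := z.1 0 μ ν Fin.elim0

/-- The Taylor polynomial at `ξ` with derivatives `z`, evaluated at `η`. -/
def taylor {k : ℕ} (w : JetModel k) (μ ν : Fin 4) (η : Coord) : ℝ :=
  ∑ m : Fin (k + 1), ((m : ℕ).factorial : ℝ)⁻¹ *
    ∑ α : Fin m → Fin 4, w.2.1 m μ ν α * ∏ i, (η (α i) - w.1 (α i))

theorem contDiff_taylor {k : ℕ} (μ ν : Fin 4) :
    ContDiff ℝ ∞ (fun p : JetModel k × Coord => taylor p.1 μ ν p.2) := by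
  unfold taylor
  have hz : ∀ (m : Fin (k+1)) (α : Fin m → Fin 4),
      ContDiff ℝ ∞ (fun p : JetModel k × Coord => p.1.2.1 m μ ν α) := by
    intro m α
    let L : (∀ m : Fin (k + 1), Fin 4 → Fin 4 → (Fin m → Fin 4) → ℝ) →ₗ[ℝ] ℝ :=
      { toFun := fun z => z m μ ν α, map_add' := fun _ _ => rfl, map_smul' := fun _ _ => rfl }
    have h1 : ContDiff ℝ ∞ (fun z => L z) := L.toContinuousLinearMap.contDiff
    have h2 : ContDiff ℝ ∞ (fun p : JetModel k × Coord => (JetFib k).subtypeL p.1.2) :=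
      (JetFib k).subtypeL.contDiff.comp (contDiff_snd.comp contDiff_fst)
    exact h1.comp h2
  have hx : ∀ (a : Fin 4), ContDiff ℝ ∞ (fun p : JetModel k × Coord => p.2 a - p.1.1 a) := by
    intro a
    have hp : ContDiff ℝ ∞ (fun x : Coord => x a) := by fun_prop
    exact (hp.comp contDiff_snd).sub (hp.comp (contDiff_fst.comp contDiff_fst))
  refine ContDiff.sum fun m _ => contDiff_const.mul (ContDiff.sum fun α _ => (hz m α).mul ?_)
  exact contDiff_prod fun i _ => hx (α i)

theorem contDiff_taylor_right {k : ℕ} (w : JetModel k) (μ ν : Fin 4) :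
    ContDiff ℝ ∞ (taylor w μ ν) :=
  (contDiff_taylor (k := k) μ ν).comp (contDiff_const.prodMk contDiff_id)

theorem taylor_symm {k : ℕ} (w : JetModel k) (μ ν : Fin 4) (η : Coord) :
    taylor w μ ν η = taylor w ν μ η := by
  unfold taylor
  refine Finset.sum_congr rfl fun m _ => ?_
  congr 1
  exact Finset.sum_congr rfl fun α _ => by rw [(w.2.2 m μ ν α).1]

/-- The multilinear form with coefficients `c α`. -/
def multi {m : ℕ} (c : (Fin m → Fin 4) → ℝ) : Coord [×m]→L[ℝ] ℝ :=
  ∑ α : Fin m → Fin 4, c α • (ContinuousMultilinearMap.mkPiAlgebra ℝ (Fin m) ℝ).compContinuousLinearMap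
    (fun i => (EuclideanSpace.proj (α i) : Coord →L[ℝ] ℝ))

theorem multi_apply {m : ℕ} (c : (Fin m → Fin 4) → ℝ) (v : Fin m → Coord) :
    multi c v = ∑ α : Fin m → Fin 4, c α * ∏ i, v i (α i) := by
  simp [multi]

theorem pd_taylor {k : ℕ} (w : JetModel k) (μ ν : Fin 4) (m : Fin (k + 1)) (γ : Fin m → Fin 4) :
    pd γ (taylor w μ ν) w.1 = w.2.1 m μ ν γ := by
  let p : FormalMultilinearSeries ℝ Coord ℝ := fun n =>
    if h : n < k + 1 then ((n.factorial : ℝ)⁻¹) • multi (fun α => w.2.1 ⟨n, h⟩ μ ν α) else 0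
  have hp : HasFiniteFPowerSeriesOnBall (taylor w μ ν) p w.1 (k + 1) ⊤ := by
    refine HasFiniteFPowerSeriesOnBall.mk' (fun n hn => ?_) (by simp) ?_
    · simp only [p]
      rw [dif_neg (by omega)]
    · intro y _
      rw [Finset.sum_range]
      simp only [taylor, add_sub_cancel_left, PiLp.add_apply]
      refine Finset.sum_congr rfl fun x _ => ?_
      simp only [p]
      rw [dif_pos x.2]
      simp [multi_apply]
  have hA : AnalyticOn ℝ (taylor w μ ν) Set.univ := by
    have := hp.toHasFPowerSeriesOnBall.analyticOnNhd
    simpa using this.analyticOn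
  unfold pd
  rw [hp.toHasFPowerSeriesOnBall.iteratedFDeriv_eq_sum hA]
  have : ∀ s : Equiv.Perm (Fin m), p m (fun i => unitVec (γ (s i))) =
      ((m : ℕ).factorial : ℝ)⁻¹ * w.2.1 m μ ν γ := by
    intro s
    simp only [p]
    rw [dif_pos m.2]
    simp only [smul_apply, multi_apply, smul_eq_mul]
    congr 1
    rw [Finset.sum_eq_single (γ ∘ s)]
    · simp [unitVec, (w.2.2 m μ ν γ).2 s]
    · intro α _ hα
      obtain ⟨i, hi⟩ := Function.ne_iff.1 hα
      rw [Finset.prod_eq_zero (Finset.mem_univ i), mul_zero]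
      simp only [unitVec]
      simpa using hi
    · simp
  rw [Finset.sum_congr rfl fun s _ => this s]
  simp only [Finset.sum_const, Finset.card_univ, Fintype.card_perm, Fintype.card_fin, nsmul_eq_mul]
  have : ((m : ℕ).factorial : ℝ) ≠ 0 := by positivity
  field_simp

theorem taylor_self {k : ℕ} (w : JetModel k) (μ ν : Fin 4) : taylor w μ ν w.1 = JetFib.y w.2 μ ν := by
  have := pd_taylor w μ ν 0 Fin.elim0
  have h2 : pd (Fin.elim0 : Fin ((0 : Fin (k+1)) : ℕ) → Fin 4) (taylor w μ ν) w.1 = taylor w μ ν w.1 := by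
    simp only [pd]
    exact iteratedFDeriv_zero_apply _
  exact h2.symm.trans this

end Model

section Manifold

variable {M : Type*} [TopologicalSpace M] [ChartedSpace Coord M]

/-- Components `g_{μν}` of a field of bilinear forms in the chart `φ`, as functions of the
coordinates. -/
def metricComp (φ : OpenPartialHomeomorph M Coord)
    (g : ∀ x : M, LinearMap.BilinForm ℝ (TangentSpace (𝓡 4) x)) (μ ν : Fin 4) (ξ : Coord) : ℝ :=
  g (φ.symm ξ) (mfderiv (𝓡 4) (𝓡 4) φ.symm ξ (unitVec μ))
    (mfderiv (𝓡 4) (𝓡 4) φ.symm ξ (unitVec ν))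

/-- The charts of the maximal smooth atlas: local coordinate systems `(x^μ)` on `M`. -/
abbrev SmoothChart (M : Type*) [TopologicalSpace M] [ChartedSpace Coord M] : Type _ :=
  ↥(IsManifold.maximalAtlas (𝓡 4) ∞ M)

variable (M) in
/-- A local section of the bundle of Lorentzian metrics: a smooth Lorentzian metric on an open
subset (values outside `dom` carry no information). -/
structure LocalMetric where
  dom : Set M
  isOpen_dom : IsOpen dom
  g : ∀ x : M, LinearMap.BilinForm ℝ (TangentSpace (𝓡 4) x)
  lorentzian : ∀ x ∈ dom, IsLorentzian (g x)
  smooth : ∀ (φ : SmoothChart M) (μ ν : Fin 4),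
    ContDiffOn ℝ ∞ (metricComp φ.1 g μ ν) (φ.1.target ∩ φ.1.symm ⁻¹' dom)

theorem one_le_infty : (1 : WithTop ℕ∞) ≤ ∞ := by simp

theorem SmoothChart.mdifferentiable (φ : SmoothChart M) : φ.1.MDifferentiable (𝓡 4) (𝓡 4) := by
  have h : φ.1 ∈ IsManifold.maximalAtlas (𝓡 4) 1 M :=
    IsManifold.maximalAtlas_subset_of_le one_le_infty φ.2
  exact ⟨fun x hx => (mdifferentiableAt_of_mem_maximalAtlas h hx).mdifferentiableWithinAt,
    fun x hx => (mdifferentiableAt_symm_of_mem_maximalAtlas h hx).mdifferentiableWithinAt⟩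

theorem SmoothChart.contDiffOn_trans (φ ψ : SmoothChart M) :
    ContDiffOn ℝ ∞ (φ.1 ∘ ψ.1.symm) (ψ.1.symm ≫ₕ φ.1).source := by
  have h1 := contMDiffOn_of_mem_maximalAtlas φ.2
  have h2 := contMDiffOn_symm_of_mem_maximalAtlas ψ.2
  rw [← contMDiffOn_iff_contDiffOn]
  exact h1.comp (h2.mono fun x hx => by simp at hx; exact hx.1) fun x hx => by
    simp at hx; exact hx.2

theorem SmoothChart.mfderiv_symm_trans (φ ψ : SmoothChart M) {η : Coord}
    (hη : η ∈ (ψ.1.symm ≫ₕ φ.1).source) (v : Coord) :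
    (mfderiv (𝓡 4) (𝓡 4) ψ.1.symm η v : Coord) =
      mfderiv (𝓡 4) (𝓡 4) φ.1.symm (φ.1 (ψ.1.symm η)) (fderiv ℝ (φ.1 ∘ ψ.1.symm) η v) := by
  have hη' : η ∈ ψ.1.target ∧ ψ.1.symm η ∈ φ.1.source := by simpa using hη
  have hτ : DifferentiableAt ℝ (φ.1 ∘ ψ.1.symm) η :=
    ((φ.contDiffOn_trans ψ).contDiffAt ((ψ.1.symm ≫ₕ φ.1).open_source.mem_nhds hη)).differentiableAt
      (by simp)
  have hφ : MDifferentiableAt (𝓡 4) (𝓡 4) φ.1.symm ((φ.1 ∘ ψ.1.symm) η) :=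
    φ.mdifferentiable.mdifferentiableAt_symm (φ.1.map_source hη'.2)
  have hev : ψ.1.symm =ᶠ[𝓝 η] φ.1.symm ∘ (φ.1 ∘ ψ.1.symm) := by
    filter_upwards [(ψ.1.symm ≫ₕ φ.1).open_source.mem_nhds hη] with x hx
    have hx' : x ∈ ψ.1.target ∧ ψ.1.symm x ∈ φ.1.source := by simpa using hx
    simp [φ.1.left_inv hx'.2]
  rw [hev.mfderiv_eq, mfderiv_comp η hφ hτ.mdifferentiableAt, mfderiv_eq_fderiv]
  rfl

theorem form_congr (g : ∀ x : M, LinearMap.BilinForm ℝ (TangentSpace (𝓡 4) x)) {x x' : M}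
    (h : x = x') (v w : Coord) :
    g x (v : TangentSpace (𝓡 4) x) (w : TangentSpace (𝓡 4) x) =
      g x' (v : TangentSpace (𝓡 4) x') (w : TangentSpace (𝓡 4) x') := by
  subst h; rfl

theorem coord_eq_sum (v : Coord) : v = ∑ a, v a • unitVec a := by
  have := (EuclideanSpace.basisFun (Fin 4) ℝ).sum_repr v
  simpa [unitVec] using this.symm

theorem metricComp_apply (φ : OpenPartialHomeomorph M Coord)
    (g : ∀ x : M, LinearMap.BilinForm ℝ (TangentSpace (𝓡 4) x)) (ξ : Coord) (v w : Coord) :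
    g (φ.symm ξ) (mfderiv (𝓡 4) (𝓡 4) φ.symm ξ v) (mfderiv (𝓡 4) (𝓡 4) φ.symm ξ w) =
      ∑ a, ∑ b, (v a * w b) * metricComp φ g a b ξ := by
  have h : ∀ v : Coord, mfderiv (𝓡 4) (𝓡 4) φ.symm ξ v =
      ∑ a, v a • mfderiv (𝓡 4) (𝓡 4) φ.symm ξ (unitVec a) := by
    intro v
    conv_lhs => rw [coord_eq_sum v]
    exact (map_sum (mfderiv (𝓡 4) (𝓡 4) φ.symm ξ) _ _).trans
      (Finset.sum_congr rfl fun a _ => map_smul (mfderiv (𝓡 4) (𝓡 4) φ.symm ξ) _ _)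
  rw [h v, h w]
  simp only [map_sum, LinearMap.sum_apply, map_smul, LinearMap.smul_apply, smul_eq_mul,
    metricComp, Finset.mul_sum]
  rw [Finset.sum_comm]
  refine Finset.sum_congr rfl fun a _ => Finset.sum_congr rfl fun b _ => ?_
  ring

/-- Transformation law of the metric components. -/
theorem metricComp_trans (φ ψ : SmoothChart M)
    (g : ∀ x : M, LinearMap.BilinForm ℝ (TangentSpace (𝓡 4) x)) (μ ν : Fin 4) {η : Coord}
    (hη : η ∈ (ψ.1.symm ≫ₕ φ.1).source) :
    metricComp ψ.1 g μ ν η = ∑ a, ∑ b, (fderiv ℝ (φ.1 ∘ ψ.1.symm) η (unitVec μ) a *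
      fderiv ℝ (φ.1 ∘ ψ.1.symm) η (unitVec ν) b) * metricComp φ.1 g a b (φ.1 (ψ.1.symm η)) := by
  have hη' : η ∈ ψ.1.target ∧ ψ.1.symm η ∈ φ.1.source := by simpa using hη
  rw [← metricComp_apply]
  unfold metricComp
  refine (form_congr g (φ.1.left_inv hη'.2).symm _ _).trans ?_
  congr 1
  · congr 1
    exact φ.mfderiv_symm_trans ψ hη _
  · exact φ.mfderiv_symm_trans ψ hη _

/-- The frame of coordinate vectors at a point of the chart domain. -/
def SmoothChart.frame (φ : SmoothChart M) {ξ : Coord} (hξ : ξ ∈ φ.1.target) :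
    (Fin 4 → ℝ) ≃ₗ[ℝ] TangentSpace (𝓡 4) (φ.1.symm ξ) :=
  (EuclideanSpace.equiv (Fin 4) ℝ).symm.toLinearEquiv.trans
    (φ.mdifferentiable.symm.mfderiv (x := ξ) hξ).toLinearEquiv

theorem bilinOf_metricComp (φ : SmoothChart M)
    (g : ∀ x : M, LinearMap.BilinForm ℝ (TangentSpace (𝓡 4) x)) {ξ : Coord} (hξ : ξ ∈ φ.1.target) :
    bilinOf (fun μ ν => metricComp φ.1 g μ ν ξ) =
      (g (φ.1.symm ξ)).comp (φ.frame hξ).toLinearMap (φ.frame hξ).toLinearMap := by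
  have hA : ∀ v : Fin 4 → ℝ, φ.frame hξ v =
      mfderiv (𝓡 4) (𝓡 4) φ.1.symm ξ ((EuclideanSpace.equiv (Fin 4) ℝ).symm v) := fun v => rfl
  refine LinearMap.ext fun v => LinearMap.ext fun w => ?_
  rw [bilinOf_apply, LinearMap.BilinForm.comp_apply, LinearEquiv.coe_coe, hA, hA]
  refine Eq.trans ?_ (metricComp_apply φ.1 g ξ _ _).symm
  refine Finset.sum_congr rfl fun a _ => Finset.sum_congr rfl fun b _ => ?_
  simp
  ring

theorem isLorentzian_metricComp (φ : SmoothChart M)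
    (g : ∀ x : M, LinearMap.BilinForm ℝ (TangentSpace (𝓡 4) x)) {ξ : Coord} (hξ : ξ ∈ φ.1.target) :
    IsLorentzian (bilinOf (fun μ ν => metricComp φ.1 g μ ν ξ)) ↔ IsLorentzian (g (φ.1.symm ξ)) := by
  rw [bilinOf_metricComp φ g hξ]
  refine ⟨fun h => ?_, fun h => h.comp _⟩
  have := h.comp (φ.frame hξ).symm
  convert this using 1
  ext v w
  simp

theorem isOpen_trans_inter (φ ψ : SmoothChart M) {D : Set M} (hD : IsOpen D) :
    IsOpen ((ψ.1.symm ≫ₕ φ.1).source ∩ ψ.1.symm ⁻¹' D) := by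
  have : (ψ.1.symm ≫ₕ φ.1).source ∩ ψ.1.symm ⁻¹' D =
      ψ.1.target ∩ ψ.1.symm ⁻¹' (φ.1.source ∩ D) := by
    ext η; simp [and_assoc]
  rw [this]
  exact ψ.1.isOpen_inter_preimage_symm (φ.1.open_source.inter hD)

theorem contDiffOn_jac (φ ψ : SmoothChart M) (μ a : Fin 4) :
    ContDiffOn ℝ ∞ (fun η => fderiv ℝ (φ.1 ∘ ψ.1.symm) η (unitVec μ) a)
      (ψ.1.symm ≫ₕ φ.1).source := by
  have h1 := (φ.contDiffOn_trans ψ).fderiv_of_isOpen (ψ.1.symm ≫ₕ φ.1).open_source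
    (m := ∞) (infty_add_le 1)
  have h2 := h1.clm_apply (contDiffOn_const (c := unitVec μ))
  have hp : ContDiff ℝ ∞ (fun x : Coord => x a) := by fun_prop
  exact hp.comp_contDiffOn h2

/-- Equality of the `k`-jets of two local metrics does not depend on the chart. -/
theorem pd_metricComp_eq (φ ψ : SmoothChart M) (σ σ' : LocalMetric M) {x : M} (hx : x ∈ σ.dom)
    (hx' : x ∈ σ'.dom) (hφ : x ∈ φ.1.source) (hψ : x ∈ ψ.1.source) {k : ℕ}
    (h : ∀ m ≤ k, ∀ (α : Fin m → Fin 4) (μ ν : Fin 4),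
      pd α (metricComp φ.1 σ.g μ ν) (φ.1 x) = pd α (metricComp φ.1 σ'.g μ ν) (φ.1 x)) :
    ∀ m ≤ k, ∀ (α : Fin m → Fin 4) (μ ν : Fin 4),
      pd α (metricComp ψ.1 σ.g μ ν) (ψ.1 x) = pd α (metricComp ψ.1 σ'.g μ ν) (ψ.1 x) := by
  let D : Set M := σ.dom ∩ σ'.dom
  have hD : IsOpen D := σ.isOpen_dom.inter σ'.isOpen_dom
  let U : Set Coord := (ψ.1.symm ≫ₕ φ.1).source ∩ ψ.1.symm ⁻¹' D
  have hU : IsOpen U := isOpen_trans_inter φ ψ hD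
  have hT : ∀ χ : SmoothChart M, IsOpen (χ.1.target ∩ χ.1.symm ⁻¹' D) := fun χ =>
    χ.1.isOpen_inter_preimage_symm hD
  have hsm : ∀ (χ : SmoothChart M) (a b : Fin 4),
      ContDiffOn ℝ ∞ (metricComp χ.1 σ.g a b) (χ.1.target ∩ χ.1.symm ⁻¹' D) ∧
      ContDiffOn ℝ ∞ (metricComp χ.1 σ'.g a b) (χ.1.target ∩ χ.1.symm ⁻¹' D) := fun χ a b =>
    ⟨(σ.smooth χ a b).mono fun y hy => ⟨hy.1, hy.2.1⟩,
      (σ'.smooth χ a b).mono fun y hy => ⟨hy.1, hy.2.2⟩⟩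
  have hmem : ∀ χ : SmoothChart M, x ∈ χ.1.source → χ.1 x ∈ χ.1.target ∩ χ.1.symm ⁻¹' D :=
    fun χ hχ => ⟨χ.1.map_source hχ, by
      simp only [Set.mem_preimage, χ.1.left_inv hχ]; exact ⟨hx, hx'⟩⟩
  have hξU : ψ.1 x ∈ U := by
    refine ⟨?_, (hmem ψ hψ).2⟩
    simp [ψ.1.map_source hψ, ψ.1.left_inv hψ, hφ]
  have hτx : (φ.1 ∘ ψ.1.symm) (ψ.1 x) = φ.1 x := by simp [ψ.1.left_inv hψ]
  -- the difference of components
  have hsub : ∀ (χ : SmoothChart M), x ∈ χ.1.source → ∀ (a b : Fin 4) (m : ℕ),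
      iteratedFDeriv ℝ m (fun ξ => metricComp χ.1 σ.g a b ξ - metricComp χ.1 σ'.g a b ξ) (χ.1 x) =
      iteratedFDeriv ℝ m (metricComp χ.1 σ.g a b) (χ.1 x) -
        iteratedFDeriv ℝ m (metricComp χ.1 σ'.g a b) (χ.1 x) := by
    intro χ hχ a b m
    have hn := (hT χ).mem_nhds (hmem χ hχ)
    exact fun_iteratedFDeriv_sub_apply
      (((hsm χ a b).1.contDiffAt hn).of_le (natCast_le_infty m))
      (((hsm χ a b).2.contDiffAt hn).of_le (natCast_le_infty m))
  have hzero : ∀ (a b : Fin 4), ∀ m ≤ k, iteratedFDeriv ℝ m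
      (fun ξ => metricComp φ.1 σ.g a b ξ - metricComp φ.1 σ'.g a b ξ) (φ.1 x) = 0 := by
    intro a b m hm
    apply iteratedFDeriv_eq_zero_of_pd
    intro α
    have := h m hm α a b
    unfold pd at this ⊢
    rw [hsub φ hφ]
    simp [this]
  intro m hm α μ ν
  have hψ0 : iteratedFDeriv ℝ m
      (fun ξ => metricComp ψ.1 σ.g μ ν ξ - metricComp ψ.1 σ'.g μ ν ξ) (ψ.1 x) = 0 := by
    have hev : (fun η => metricComp ψ.1 σ.g μ ν η - metricComp ψ.1 σ'.g μ ν η) =ᶠ[𝓝 (ψ.1 x)]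
        fun η => ∑ p : Fin 4 × Fin 4, (fderiv ℝ (φ.1 ∘ ψ.1.symm) η (unitVec μ) p.1 *
          fderiv ℝ (φ.1 ∘ ψ.1.symm) η (unitVec ν) p.2) *
          (metricComp φ.1 σ.g p.1 p.2 ((φ.1 ∘ ψ.1.symm) η) -
            metricComp φ.1 σ'.g p.1 p.2 ((φ.1 ∘ ψ.1.symm) η)) := by
      filter_upwards [hU.mem_nhds hξU] with η hη
      rw [metricComp_trans φ ψ σ.g μ ν hη.1, metricComp_trans φ ψ σ'.g μ ν hη.1,
        Fintype.sum_prod_type]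
      simp only [mul_sub, Finset.sum_sub_distrib, Function.comp]
    have hτU : Set.MapsTo (φ.1 ∘ ψ.1.symm) U (φ.1.target ∩ φ.1.symm ⁻¹' D) := by
      rintro η ⟨h1, h2⟩
      have h1' : η ∈ ψ.1.target ∧ ψ.1.symm η ∈ φ.1.source := by simpa using h1
      refine ⟨φ.1.map_source h1'.2, ?_⟩
      simpa [φ.1.left_inv h1'.2] using h2
    have hτ : ContDiffOn ℝ ∞ (φ.1 ∘ ψ.1.symm) U := (φ.contDiffOn_trans ψ).mono fun y hy => hy.1
    have ha : ∀ p : Fin 4 × Fin 4, ContDiffOn ℝ ∞ (fun η =>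
        fderiv ℝ (φ.1 ∘ ψ.1.symm) η (unitVec μ) p.1 *
          fderiv ℝ (φ.1 ∘ ψ.1.symm) η (unitVec ν) p.2) U := fun p =>
      ((contDiffOn_jac φ ψ μ p.1).mul (contDiffOn_jac φ ψ ν p.2)).mono fun y hy => hy.1
    have hd : ∀ p : Fin 4 × Fin 4, ContDiffOn ℝ ∞
        (fun ξ => metricComp φ.1 σ.g p.1 p.2 ξ - metricComp φ.1 σ'.g p.1 p.2 ξ)
        (φ.1.target ∩ φ.1.symm ⁻¹' D) := fun p => (hsm φ _ _).1.sub (hsm φ _ _).2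
    rw [(hev.iteratedFDeriv ℝ m).self_of_nhds, iteratedFDeriv_fun_sum_apply]
    · refine Finset.sum_eq_zero fun p _ => ?_
      refine jet_zero_mul_comp hU (hT φ) hτ (ha p) (hd p) hτU hξU (k := k) ?_ m hm
      intro i hi
      rw [hτx]
      exact hzero p.1 p.2 i hi
    · intro p _
      exact (((ha p).mul ((hd p).comp hτ hτU)).contDiffAt (hU.mem_nhds hξU)).of_le
        (natCast_le_infty m)
  have := congrArg (fun L => L (fun i => unitVec (α i))) (hsub ψ hψ μ ν m)
  rw [hψ0] at this
  exact sub_eq_zero.1 this.symm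

/-- The components of a local metric have symmetric derivatives. -/
theorem pd_metricComp_symm (σ : LocalMetric M) (φ : SmoothChart M) {x : M} (hx : x ∈ σ.dom)
    (hφ : x ∈ φ.1.source) (m : ℕ) (μ ν : Fin 4) (α : Fin m → Fin 4) :
    pd α (metricComp φ.1 σ.g μ ν) (φ.1 x) = pd α (metricComp φ.1 σ.g ν μ) (φ.1 x) ∧
    ∀ s : Equiv.Perm (Fin m),
      pd (α ∘ s) (metricComp φ.1 σ.g μ ν) (φ.1 x) = pd α (metricComp φ.1 σ.g μ ν) (φ.1 x) := by
  have hT : IsOpen (φ.1.target ∩ φ.1.symm ⁻¹' σ.dom) :=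
    φ.1.isOpen_inter_preimage_symm σ.isOpen_dom
  have hmem : φ.1 x ∈ φ.1.target ∩ φ.1.symm ⁻¹' σ.dom :=
    ⟨φ.1.map_source hφ, by simpa [φ.1.left_inv hφ] using hx⟩
  refine ⟨?_, fun s => pd_perm hT (σ.smooth φ μ ν) hmem α s⟩
  have hev : metricComp φ.1 σ.g μ ν =ᶠ[𝓝 (φ.1 x)] metricComp φ.1 σ.g ν μ := by
    filter_upwards [hT.mem_nhds hmem] with ξ hξ
    exact (σ.lorentzian _ hξ.2).1.eq _ _
  unfold pd
  rw [(hev.iteratedFDeriv ℝ m).self_of_nhds]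

/-- The field of bilinear forms on the chart domain whose components in the chart `φ` are the Taylor
polynomials of `w`. -/
def taylorForm {k : ℕ} (φ : SmoothChart M) (w : JetModel k) (x : M) :
    LinearMap.BilinForm ℝ (TangentSpace (𝓡 4) x) :=
  (bilinOf (fun μ ν => taylor w μ ν (φ.1 x))).comp
    ((EuclideanSpace.equiv (Fin 4) ℝ).toLinearEquiv.toLinearMap ∘ₗ
      (mfderiv (𝓡 4) (𝓡 4) φ.1 x).toLinearMap)
    ((EuclideanSpace.equiv (Fin 4) ℝ).toLinearEquiv.toLinearMap ∘ₗ
      (mfderiv (𝓡 4) (𝓡 4) φ.1 x).toLinearMap)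

theorem metricComp_taylorForm {k : ℕ} (φ : SmoothChart M) (w : JetModel k) (μ ν : Fin 4)
    {ξ : Coord} (hξ : ξ ∈ φ.1.target) :
    metricComp φ.1 (taylorForm φ w) μ ν ξ = taylor w μ ν ξ := by
  have h : ∀ v : Coord, (mfderiv (𝓡 4) (𝓡 4) φ.1 (φ.1.symm ξ)
      (mfderiv (𝓡 4) (𝓡 4) φ.1.symm ξ v) : Coord) = v := by
    intro v
    have := φ.mdifferentiable.comp_symm_deriv hξ
    exact congrArg (fun L => L v) this
  have h2 : metricComp φ.1 (taylorForm φ w) μ ν ξ =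
      bilinOf (fun μ ν => taylor w μ ν (φ.1 (φ.1.symm ξ)))
        (EuclideanSpace.equiv (Fin 4) ℝ (mfderiv (𝓡 4) (𝓡 4) φ.1 (φ.1.symm ξ)
          (mfderiv (𝓡 4) (𝓡 4) φ.1.symm ξ (unitVec μ))))
        (EuclideanSpace.equiv (Fin 4) ℝ (mfderiv (𝓡 4) (𝓡 4) φ.1 (φ.1.symm ξ)
          (mfderiv (𝓡 4) (𝓡 4) φ.1.symm ξ (unitVec ν)))) := rfl
  rw [h2]
  have e : ∀ a, EuclideanSpace.equiv (Fin 4) ℝ (unitVec a) = Pi.single a 1 := by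
    intro a
    funext i
    simp [unitVec, EuclideanSpace.equiv, Pi.single_apply]
  rw [φ.1.right_inv hξ]
  refine (congrArg₂ (fun a b => bilinOf (fun μ ν => taylor w μ ν ξ)
    (EuclideanSpace.equiv (Fin 4) ℝ a) (EuclideanSpace.equiv (Fin 4) ℝ b))
    (h (unitVec μ)) (h (unitVec ν))).trans ?_
  rw [e, e]
  simp [bilinOf, Matrix.toBilin'_single]

/-- The local metric whose components in the chart `φ` are the Taylor polynomials of `w`. -/
def taylorMetric {k : ℕ} (φ : SmoothChart M) (w : JetModel k) : LocalMetric M where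
  dom := φ.1.source ∩ φ.1 ⁻¹' {η | (fun μ ν => taylor w μ ν η) ∈ lorentzSet}
  isOpen_dom := by
    refine φ.1.isOpen_inter_preimage (isOpen_lorentzSet.preimage ?_)
    exact continuous_pi fun μ => continuous_pi fun ν => (contDiff_taylor_right w μ ν).continuous
  g := taylorForm φ w
  lorentzian := by
    rintro x ⟨hx, hl⟩
    have h1 := (isLorentzian_bilinOf (fun μ ν => taylor_symm w μ ν (φ.1 x))).2 hl
    exact h1.comp ((φ.mdifferentiable.mfderiv hx).toLinearEquiv.trans
      (EuclideanSpace.equiv (Fin 4) ℝ).toLinearEquiv)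
  smooth := by
    intro ψ μ ν
    have hsub : ∀ η ∈ ψ.1.target ∩ ψ.1.symm ⁻¹' (φ.1.source ∩ φ.1 ⁻¹'
        {η | (fun μ ν => taylor w μ ν η) ∈ lorentzSet}), η ∈ (ψ.1.symm ≫ₕ φ.1).source := by
      rintro η ⟨h1, h2, -⟩
      simpa using And.intro h1 h2
    have hs : ContDiffOn ℝ ∞ (fun η => ∑ a, ∑ b,
        (fderiv ℝ (φ.1 ∘ ψ.1.symm) η (unitVec μ) a * fderiv ℝ (φ.1 ∘ ψ.1.symm) η (unitVec ν) b) *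
          taylor w a b ((φ.1 ∘ ψ.1.symm) η)) (ψ.1.symm ≫ₕ φ.1).source :=
      ContDiffOn.sum fun a _ => ContDiffOn.sum fun b _ =>
        ((contDiffOn_jac φ ψ μ a).mul (contDiffOn_jac φ ψ ν b)).mul
          ((contDiff_taylor_right w a b).comp_contDiffOn (φ.contDiffOn_trans ψ))
    refine (hs.mono hsub).congr fun η hη => ?_
    have hη' := hsub η hη
    have h2 : η ∈ ψ.1.target ∧ ψ.1.symm η ∈ φ.1.source := by simpa using hη'
    rw [metricComp_trans φ ψ _ μ ν hη']
    refine Finset.sum_congr rfl fun a _ => Finset.sum_congr rfl fun b _ => ?_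
    rw [metricComp_taylorForm φ w a b (φ.1.map_source h2.2)]
    rfl

/-! ### Jets -/

variable (M) in
/-- A local section together with a point of its domain. -/
structure MetricAt where
  σ : LocalMetric M
  pt : M
  mem : pt ∈ σ.dom

/-- Two local metrics have the same `k`-jet at a point if all partial derivatives up to order `k` of
their components, in all coordinate systems, agree there. -/
def jetSetoid (k : ℕ) (M : Type*) [TopologicalSpace M] [ChartedSpace Coord M] :
    Setoid (MetricAt M) where
  r p q := p.pt = q.pt ∧ ∀ φ : SmoothChart M, p.pt ∈ φ.1.source →
    ∀ m ≤ k, ∀ (α : Fin m → Fin 4) (μ ν : Fin 4),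
      pd α (metricComp φ.1 p.σ.g μ ν) (φ.1 p.pt) = pd α (metricComp φ.1 q.σ.g μ ν) (φ.1 p.pt)
  iseqv := by
    refine ⟨fun p => ⟨rfl, fun _ _ _ _ _ _ _ => rfl⟩, ?_, ?_⟩
    · rintro p q ⟨h, h'⟩
      refine ⟨h.symm, fun φ hφ m hm α μ ν => ?_⟩
      rw [← h] at hφ ⊢
      exact (h' φ hφ m hm α μ ν).symm
    · rintro p q r ⟨h, h'⟩ ⟨h₂, h₂'⟩
      refine ⟨h.trans h₂, fun φ hφ m hm α μ ν => ?_⟩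
      have := h₂' φ (h ▸ hφ) m hm α μ ν
      rw [← h] at this
      exact (h' φ hφ m hm α μ ν).trans this

/-- The `k`-jet bundle `J^k(M, N)` of the bundle `N` of Lorentzian metrics on `M`. -/
def Jet (k : ℕ) (M : Type*) [TopologicalSpace M] [ChartedSpace Coord M] : Type _ :=
  Quotient (jetSetoid k M)

namespace Jet

variable {k : ℕ}

/-- The jet of a local metric at a point of its domain. -/
def mk (k : ℕ) (p : MetricAt M) : Jet k M := Quotient.mk (jetSetoid k M) p

/-- The source projection `π^k : J^k(M, N) → M`. -/
def base (j : Jet k M) : M :=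
  Quotient.lift (s := jetSetoid k M) (fun p : MetricAt M => p.pt) (fun _ _ h => h.1) j

/-- The forgetful map `J^k(M, N) → J^l(M, N)`, `l ≤ k`. -/
def forget {k l : ℕ} (h : l ≤ k) : Jet k M → Jet l M :=
  Quotient.lift (fun p => mk l p) fun _ _ hpq =>
    Quotient.sound ⟨hpq.1, fun φ hφ _ hm => hpq.2 φ hφ _ (hm.trans h)⟩

/-- The fibre coordinates `(g_{μν}, ∂_{λ₁} g_{μν}, …)` at a point of the chart domain. -/
def fibCoord (k : ℕ) (φ : SmoothChart M) (p : MetricAt M) (h : p.pt ∈ φ.1.source) : JetFib k :=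
  ⟨fun _ μ ν α => pd α (metricComp φ.1 p.σ.g μ ν) (φ.1 p.pt), fun m μ ν α =>
    pd_metricComp_symm p.σ φ p.mem h m μ ν α⟩

open Classical in
/-- The coordinates `(x^μ, y_{μν}, z_{μνλ₁}, …)` of a jet induced by the chart `φ` (with value `0`
outside the chart domain). -/
def coord (φ : SmoothChart M) (j : Jet k M) : JetModel k :=
  Quotient.lift (fun p : MetricAt M =>
    if h : p.pt ∈ φ.1.source then ((φ.1 p.pt, fibCoord k φ p h) : JetModel k) else 0) (by
    rintro p q ⟨h, h'⟩
    by_cases hp : p.pt ∈ φ.1.source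
    · have hq : q.pt ∈ φ.1.source := h ▸ hp
      simp only [dif_pos hp, dif_pos hq]
      refine Prod.ext (by rw [h]) (Subtype.ext ?_)
      funext m μ ν α
      have := h' φ hp m (Nat.lt_succ_iff.1 m.2) α μ ν
      simp only [fibCoord]
      rw [this, h]
    · have hq : q.pt ∉ φ.1.source := h ▸ hp
      simp only [dif_neg hp, dif_neg hq]) j

theorem coord_mk (φ : SmoothChart M) (p : MetricAt M) (h : p.pt ∈ φ.1.source) :
    coord φ (mk k p) = (φ.1 p.pt, fibCoord k φ p h) := by
  simp [coord, mk, h]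

/-- The range of the coordinates: the metric components have to be Lorentzian. -/
def coordTarget (k : ℕ) (φ : SmoothChart M) : Set (JetModel k) :=
  {w | w.1 ∈ φ.1.target ∧ IsLorentzian (bilinOf (JetFib.y w.2))}

theorem JetFib.y_symm {k : ℕ} (z : JetFib k) (μ ν : Fin 4) : JetFib.y z μ ν = JetFib.y z ν μ :=
  (z.2 0 μ ν Fin.elim0).1

theorem mem_coordTarget {φ : SmoothChart M} {w : JetModel k} :
    w ∈ coordTarget k φ ↔ w.1 ∈ φ.1.target ∧ JetFib.y w.2 ∈ lorentzSet :=
  and_congr_right fun _ => isLorentzian_bilinOf (JetFib.y_symm w.2)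

theorem isOpen_coordTarget (φ : SmoothChart M) : IsOpen (coordTarget k φ) := by
  have : coordTarget k φ = Prod.fst ⁻¹' φ.1.target ∩ (fun w : JetModel k => JetFib.y w.2) ⁻¹'
      lorentzSet := by
    ext w; exact mem_coordTarget
  rw [this]
  refine (φ.1.open_target.preimage continuous_fst).inter (isOpen_lorentzSet.preimage ?_)
  refine continuous_pi fun μ => continuous_pi fun ν => ?_
  have h : Continuous (fun w : JetModel k => w.2.1) := continuous_subtype_val.comp continuous_snd
  exact (continuous_apply _).comp ((continuous_apply ν).comp ((continuous_apply μ).comp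
    ((continuous_apply (0 : Fin (k+1))).comp h)))

theorem taylorMetric_mem {φ : SmoothChart M} {w : JetModel k} (hw : w ∈ coordTarget k φ) :
    φ.1.symm w.1 ∈ (taylorMetric φ w).dom := by
  have h := mem_coordTarget.1 hw
  refine ⟨φ.1.map_target h.1, ?_⟩
  simp only [Set.mem_preimage, φ.1.right_inv h.1]
  show (fun μ ν => taylor w μ ν w.1) ∈ lorentzSet
  simp only [taylor_self]
  exact h.2

/-- The jet of the Minkowski metric. -/
def minkFib (k : ℕ) : JetFib k := ⟨fun m μ ν _ =>
    if (m : ℕ) = 0 ∧ μ = ν then (if μ = 0 then -1 else 1) else 0, by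
  intro m μ ν α
  refine ⟨?_, fun _ => rfl⟩
  by_cases h : μ = ν
  · subst h; rfl
  · simp [h, Ne.symm h]⟩

theorem minkFib_mem (k : ℕ) : JetFib.y (minkFib k) ∈ lorentzSet := by
  let y : Fin 4 → Fin 4 → ℝ := fun μ ν => if μ = ν then (if μ = 0 then -1 else 1) else 0
  have hq : (bilinOf y).toQuadraticMap =
      QuadraticMap.weightedSumSquares ℝ (fun μ : Fin 4 => if μ = 0 then (-1 : ℝ) else 1) := by
    ext v
    simp [bilinOf_apply, y, Fin.sum_univ_four, QuadraticMap.weightedSumSquares_apply]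
  have : y ∈ lorentzSet := by
    refine ⟨?_, ?_⟩
    · rw [hq, QuadraticForm.sigPos_weightedSumSquares]
      have : {i : Fin 4 | (0 : ℝ) < if i = 0 then -1 else 1} = ({1, 2, 3} : Finset (Fin 4)) := by
        ext i; fin_cases i <;> simp
      rw [this, Set.ncard_coe_finset]; rfl
    · rw [hq, QuadraticForm.sigNeg_weightedSumSquares]
      have : {i : Fin 4 | (if i = 0 then (-1 : ℝ) else 1) < 0} = ({0} : Finset (Fin 4)) := by
        ext i; fin_cases i <;> simp
      rw [this, Set.ncard_coe_finset]; rfl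
  convert this using 1
  funext μ ν
  simp [JetFib.y, y, minkFib]

variable [IsManifold (𝓡 4) ∞ M]

/-- The preferred chart at a point, as an element of the maximal atlas. -/
def chartAt' (x : M) : SmoothChart M := ⟨chartAt Coord x, IsManifold.chart_mem_maximalAtlas x⟩

theorem nonempty_at (k : ℕ) (x : M) : ∃ j : Jet k M, j.base = x := by
  have hx : x ∈ (chartAt' x).1.source := mem_chart_source Coord x
  let w : JetModel k := ((chartAt' x).1 x, minkFib k)
  have hw' : w ∈ coordTarget k (chartAt' x) :=
    mem_coordTarget.2 ⟨(chartAt' x).1.map_source hx, minkFib_mem k⟩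
  exact ⟨mk k ⟨taylorMetric (chartAt' x) w, _, taylorMetric_mem hw'⟩,
    (chartAt' x).1.left_inv hx⟩

/-- Some jet at a given point, used as a junk value. -/
def default (k : ℕ) (x : M) : Jet k M := (nonempty_at k x).choose

theorem base_default (k : ℕ) (x : M) : (default k x).base = x := (nonempty_at k x).choose_spec

open Classical in
/-- The jet with given coordinates in the chart `φ`. -/
def ofCoord (φ : SmoothChart M) (w : JetModel k) : Jet k M :=
  if h : w ∈ coordTarget k φ then mk k ⟨taylorMetric φ w, _, taylorMetric_mem h⟩
  else default k (φ.1.symm w.1)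

theorem base_ofCoord (φ : SmoothChart M) (w : JetModel k) : (ofCoord φ w).base = φ.1.symm w.1 := by
  unfold ofCoord
  split_ifs with h
  · rfl
  · exact base_default _ _

theorem coord_mem (φ : SmoothChart M) {j : Jet k M} (hj : j.base ∈ φ.1.source) :
    coord φ j ∈ coordTarget k φ := by
  induction j using Quotient.inductionOn with
  | h p =>
    change p.pt ∈ φ.1.source at hj
    have h1 := φ.1.map_source hj
    rw [show (⟦p⟧ : Quotient (jetSetoid k M)) = mk k p from rfl, coord_mk φ p hj]
    refine ⟨h1, ?_⟩
    have hl : IsLorentzian (p.σ.g (φ.1.symm (φ.1 p.pt))) := by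
      rw [φ.1.left_inv hj]; exact p.σ.lorentzian _ p.mem
    have := (isLorentzian_metricComp φ p.σ.g h1).2 hl
    convert this using 2
    funext μ ν
    exact iteratedFDeriv_zero_apply _

theorem coord_ofCoord (φ : SmoothChart M) {w : JetModel k} (hw : w ∈ coordTarget k φ) :
    coord φ (ofCoord φ w) = w := by
  have hs : φ.1.symm w.1 ∈ φ.1.source := φ.1.map_target hw.1
  unfold ofCoord
  rw [dif_pos hw, coord_mk φ _ hs]
  refine Prod.ext (φ.1.right_inv hw.1) (Subtype.ext ?_)
  funext m μ ν α
  simp only [fibCoord, φ.1.right_inv hw.1]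
  rw [← pd_taylor w μ ν m α]
  have hev : metricComp φ.1 (taylorMetric φ w).g μ ν =ᶠ[𝓝 w.1] taylor w μ ν := by
    filter_upwards [φ.1.open_target.mem_nhds hw.1] with ξ hξ
    exact metricComp_taylorForm φ w μ ν hξ
  unfold pd
  rw [(hev.iteratedFDeriv ℝ m).self_of_nhds]

theorem coord_injOn (φ : SmoothChart M) {j j' : Jet k M} (hj : j.base ∈ φ.1.source)
    (hj' : j'.base ∈ φ.1.source) (h : coord φ j = coord φ j') : j = j' := by
  induction j using Quotient.inductionOn with
  | h p =>
  induction j' using Quotient.inductionOn with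
  | h q =>
    change p.pt ∈ φ.1.source at hj
    change q.pt ∈ φ.1.source at hj'
    change coord φ (mk k p) = coord φ (mk k q) at h
    rw [coord_mk φ p hj, coord_mk φ q hj'] at h
    have hpt : p.pt = q.pt := φ.1.injOn hj hj' (congrArg Prod.fst h)
    refine Quotient.sound ⟨hpt, fun ψ hψ => ?_⟩
    refine pd_metricComp_eq φ ψ p.σ q.σ p.mem (hpt ▸ q.mem) hj hψ ?_
    intro m hm α μ ν
    have h2 := congrArg Subtype.val (congrArg Prod.snd h)
    have h3 := congrFun (congrFun (congrFun (congrFun h2 ⟨m, Nat.lt_succ_of_le hm⟩) μ) ν) α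
    simp only [fibCoord] at h3
    rw [h3, hpt]

/-- The chart of `J^k(M, N)` induced by a chart of `M`, as a bare bijection. -/
def coordEquiv (k : ℕ) (φ : SmoothChart M) : PartialEquiv (Jet k M) (JetModel k) where
  toFun := coord φ
  invFun := ofCoord φ
  source := {j | j.base ∈ φ.1.source}
  target := coordTarget k φ
  map_source' _ hj := coord_mem φ hj
  map_target' w hw := by
    show (ofCoord φ w).base ∈ φ.1.source
    rw [base_ofCoord]; exact φ.1.map_target hw.1
  left_inv' j hj := by
    have h1 := coord_mem φ hj
    refine coord_injOn φ ?_ hj (coord_ofCoord φ h1)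
    rw [base_ofCoord]; exact φ.1.map_target h1.1
  right_inv' w hw := coord_ofCoord φ hw

theorem coordEquiv_trans_source (φ ψ : SmoothChart M) :
    ((coordEquiv k φ).symm.trans (coordEquiv k ψ)).source =
      coordTarget k φ ∩ Prod.fst ⁻¹' (φ.1.symm ≫ₕ ψ.1).source := by
  ext w
  simp only [PartialEquiv.trans_source, PartialEquiv.symm_source, Set.mem_inter_iff,
    Set.mem_preimage]
  constructor
  · rintro ⟨h1, h2⟩
    refine ⟨h1, ?_⟩
    have h2' : (ofCoord φ w).base ∈ ψ.1.source := h2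
    rw [base_ofCoord] at h2'
    simpa using And.intro h1.1 h2'
  · rintro ⟨h1, h2⟩
    refine ⟨h1, ?_⟩
    show (ofCoord φ w).base ∈ ψ.1.source
    rw [base_ofCoord]
    simpa using (show w.1 ∈ φ.1.target ∧ φ.1.symm w.1 ∈ ψ.1.source by simpa using h2).2

theorem isOpen_trans_source (φ ψ : SmoothChart M) :
    IsOpen ((coordEquiv k φ).symm.trans (coordEquiv k ψ)).source := by
  rw [coordEquiv_trans_source]
  exact (isOpen_coordTarget φ).inter ((φ.1.symm ≫ₕ ψ.1).open_source.preimage continuous_fst)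

theorem base_trans_contDiffOn (φ ψ : SmoothChart M) :
    ContDiffOn ℝ ∞ (fun w : JetModel k => ψ.1 (φ.1.symm w.1))
      ((coordEquiv k φ).symm.trans (coordEquiv k ψ)).source :=
  (ψ.contDiffOn_trans φ).comp contDiff_fst.contDiffOn fun w hw => by
    rw [coordEquiv_trans_source] at hw; exact hw.2

theorem pd_family_contDiffOn {W : Type*} [NormedAddCommGroup W] [NormedSpace ℝ W]
    {T : W → Fin 4 → Fin 4 → Coord → ℝ}
    (hT : ∀ a b, ContDiff ℝ ∞ (fun p : W × Coord => T p.1 a b p.2))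
    {V : Set Coord} (hV : IsOpen V) {A : Fin 4 → Fin 4 → Coord → ℝ}
    {τ : Coord → Coord} (hA : ∀ a b, ContDiffOn ℝ ∞ (A a b) V) (hτ : ContDiffOn ℝ ∞ τ V)
    {χ : W → Coord} {S : Set W} (hχ : ContDiffOn ℝ ∞ χ S)
    (hS : Set.MapsTo χ S V) {m : ℕ} (α : Fin m → Fin 4) :
    ContDiffOn ℝ ∞ (fun w : W =>
      pd α (fun η => ∑ a, ∑ b, A a b η * T w a b (τ η)) (χ w)) S := by
  have hU : IsOpen (Prod.snd ⁻¹' V : Set (W × Coord)) := hV.preimage continuous_snd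
  have hsnd : ContDiffOn ℝ ∞ (Prod.snd : W × Coord → Coord)
      (Prod.snd ⁻¹' V : Set (W × Coord)) := contDiff_snd.contDiffOn
  have hF : ContDiffOn ℝ ∞ (fun p : W × Coord => ∑ a, ∑ b, A a b p.2 * T p.1 a b (τ p.2))
      (Prod.snd ⁻¹' V) := by
    refine ContDiffOn.sum fun a _ => ContDiffOn.sum fun b _ => ContDiffOn.mul ?_ ?_
    · have h := (hA a b).comp hsnd fun p hp => hp
      exact h
    · have h1 : ContDiffOn ℝ ∞ (fun p : W × Coord => τ p.2) (Prod.snd ⁻¹' V) :=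
        hτ.comp hsnd fun p hp => hp
      have h2 : ContDiffOn ℝ ∞ (fun p : W × Coord => p.1) (Prod.snd ⁻¹' V) :=
        contDiff_fst.contDiffOn
      have h3 := (hT a b).comp_contDiffOn (h2.prodMk h1)
      exact h3
  have h4 := contDiffOn_pd_param (F := fun w η => ∑ a, ∑ b, A a b η * T w a b (τ η)) hU hF m
    (fun i => unitVec (α i))
  have h5 := h4.comp (contDiffOn_id.prodMk hχ) fun w hw => hS hw
  exact h5

theorem pd_taylorForm_contDiffOn (φ ψ : SmoothChart M) {m : ℕ} (μ ν : Fin 4) (α : Fin m → Fin 4) :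
    ContDiffOn ℝ ∞ (fun w : JetModel k =>
        pd α (metricComp ψ.1 (taylorForm φ w) μ ν) (ψ.1 (φ.1.symm w.1)))
      ((coordEquiv k φ).symm.trans (coordEquiv k ψ)).source := by
  have hmaps : Set.MapsTo (fun w : JetModel k => ψ.1 (φ.1.symm w.1))
      ((coordEquiv k φ).symm.trans (coordEquiv k ψ)).source (ψ.1.symm ≫ₕ φ.1).source := by
    intro w hw
    rw [coordEquiv_trans_source] at hw
    have h2 : w.1 ∈ φ.1.target ∧ φ.1.symm w.1 ∈ ψ.1.source := by simpa using hw.2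
    simp [ψ.1.map_source h2.2, ψ.1.left_inv h2.2, φ.1.map_target h2.1]
  refine (pd_family_contDiffOn (T := fun w : JetModel k => taylor w)
    (fun a b => contDiff_taylor a b) (ψ.1.symm ≫ₕ φ.1).open_source
    (A := fun a b η => fderiv ℝ (φ.1 ∘ ψ.1.symm) η (unitVec μ) a *
      fderiv ℝ (φ.1 ∘ ψ.1.symm) η (unitVec ν) b)
    (fun a b => (contDiffOn_jac φ ψ μ a).mul (contDiffOn_jac φ ψ ν b)) (φ.contDiffOn_trans ψ)
    (base_trans_contDiffOn (k := k) φ ψ) hmaps α).congr fun w hw => ?_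
  unfold pd
  refine congrArg (fun L : Coord [×m]→L[ℝ] ℝ => L fun i => unitVec (α i))
    (Filter.EventuallyEq.iteratedFDeriv ℝ ?_ m).self_of_nhds
  filter_upwards [(ψ.1.symm ≫ₕ φ.1).open_source.mem_nhds (hmaps hw)] with η hη
  have h2 : η ∈ ψ.1.target ∧ ψ.1.symm η ∈ φ.1.source := by simpa using hη
  rw [metricComp_trans φ ψ _ μ ν hη]
  refine Finset.sum_congr rfl fun a _ => Finset.sum_congr rfl fun b _ => ?_
  rw [metricComp_taylorForm φ w a b (φ.1.map_source h2.2)]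
  rfl

theorem contDiffOn_subtype_iff {W : Type*} [NormedAddCommGroup W] [NormedSpace ℝ W]
    {V : Type*} [NormedAddCommGroup V] [NormedSpace ℝ V] [FiniteDimensional ℝ V]
    (P : Submodule ℝ V) {f : W → P} {S : Set W} :
    ContDiffOn ℝ ∞ f S ↔ ContDiffOn ℝ ∞ (fun w => (f w : V)) S := by
  refine ⟨fun h => P.subtypeL.contDiff.comp_contDiffOn h, fun h => ?_⟩
  obtain ⟨Q, hQ⟩ := LinearMap.exists_leftInverse_of_injective P.subtype P.ker_subtype
  refine (Q.toContinuousLinearMap.contDiff.comp_contDiffOn h).congr fun w _ => ?_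
  exact (LinearMap.congr_fun hQ (f w)).symm

/-- The coordinate changes on `J^k(M, N)` are smooth. -/
theorem contDiffOn_coord_trans (φ ψ : SmoothChart M) :
    ContDiffOn ℝ ∞ ((coordEquiv k φ).symm.trans (coordEquiv k ψ))
      ((coordEquiv k φ).symm.trans (coordEquiv k ψ)).source := by
  have hval : ∀ w ∈ ((coordEquiv k φ).symm.trans (coordEquiv k ψ)).source,
      ∃ h : (φ.1.symm w.1) ∈ ψ.1.source, ∃ hw : w ∈ coordTarget k φ,
      ((coordEquiv k φ).symm.trans (coordEquiv k ψ)) w =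
       (ψ.1 (φ.1.symm w.1), fibCoord k ψ ⟨taylorMetric φ w, _, taylorMetric_mem hw⟩ h) := by
    intro w hw
    rw [coordEquiv_trans_source] at hw
    have h2 : w.1 ∈ φ.1.target ∧ φ.1.symm w.1 ∈ ψ.1.source := by simpa using hw.2
    refine ⟨h2.2, hw.1, ?_⟩
    show coord ψ (ofCoord φ w) = _
    unfold ofCoord
    rw [dif_pos hw.1, coord_mk ψ _ h2.2]
  refine (contDiffOn_prod_iff _).2 ⟨?_, (contDiffOn_subtype_iff (JetFib k)).2 ?_⟩
  · refine (base_trans_contDiffOn (k := k) φ ψ).congr fun w hw => ?_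
    obtain ⟨h, hw', hv⟩ := hval w hw
    exact congrArg Prod.fst hv
  · refine contDiffOn_pi.2 fun m => contDiffOn_pi.2 fun μ => contDiffOn_pi.2 fun ν =>
      contDiffOn_pi.2 fun α => ?_
    refine (pd_taylorForm_contDiffOn (k := k) φ ψ μ ν α).congr fun w hw => ?_
    obtain ⟨h, hw', hv⟩ := hval w hw
    exact congrArg (fun p : JetModel k => p.2.1 m μ ν α) hv

/-- The charts of `J^k(M, N)` induced by all charts of `M`. -/
def core (k : ℕ) (M : Type*) [TopologicalSpace M] [ChartedSpace Coord M]
    [IsManifold (𝓡 4) ∞ M] : ChartedSpaceCore (JetModel k) (Jet k M) where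
  atlas := Set.range (coordEquiv k)
  chartAt j := coordEquiv k (chartAt' j.base)
  mem_chart_source j := mem_chart_source Coord j.base
  chart_mem_atlas j := ⟨_, rfl⟩
  open_source := by
    rintro _ _ ⟨φ, rfl⟩ ⟨ψ, rfl⟩
    exact isOpen_trans_source φ ψ
  continuousOn_toFun := by
    rintro _ _ ⟨φ, rfl⟩ ⟨ψ, rfl⟩
    exact (contDiffOn_coord_trans φ ψ).continuousOn

instance : TopologicalSpace (Jet k M) := (core k M).toTopologicalSpace

instance : ChartedSpace (JetModel k) (Jet k M) := (core k M).toChartedSpace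

/-- The chart of `J^k(M, N)` with coordinates `(x^μ, y_{μν}, z_{μνλ₁}, …)` induced by a chart `φ` of
`M`. -/
def chart (k : ℕ) (φ : SmoothChart M) : OpenPartialHomeomorph (Jet k M) (JetModel k) :=
  (core k M).openPartialHomeomorph (coordEquiv k φ) ⟨φ, rfl⟩

theorem mem_atlas_iff {e : OpenPartialHomeomorph (Jet k M) (JetModel k)} :
    e ∈ atlas (JetModel k) (Jet k M) ↔ ∃ φ : SmoothChart M, e = chart k φ := by
  change e ∈ (⋃ (e : PartialEquiv (Jet k M) (JetModel k)) (he : e ∈ (core k M).atlas),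
    {(core k M).openPartialHomeomorph e he}) ↔ _
  simp only [Set.mem_iUnion, Set.mem_singleton_iff]
  constructor
  · rintro ⟨_, ⟨φ, rfl⟩, rfl⟩; exact ⟨φ, rfl⟩
  · rintro ⟨φ, rfl⟩; exact ⟨_, ⟨φ, rfl⟩, rfl⟩

instance : IsManifold 𝓘(ℝ, JetModel k) ∞ (Jet k M) := by
  apply isManifold_of_contDiffOn
  intro e e' he he'
  obtain ⟨φ, rfl⟩ := mem_atlas_iff.1 he
  obtain ⟨ψ, rfl⟩ := mem_atlas_iff.1 he'
  have h := contDiffOn_coord_trans (k := k) φ ψ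
  have hS : ∀ w, w ∈ 𝓘(ℝ, JetModel k).symm ⁻¹' ((chart k φ).symm.trans (chart k ψ)).source ∩
      Set.range 𝓘(ℝ, JetModel k) →
      w ∈ ((coordEquiv k φ).symm.trans (coordEquiv k ψ)).source := fun w hw => hw.1
  exact h.mono hS

end Jet
end Manifold

section LocalDiffeomorphisms

variable {M : Type*} [TopologicalSpace M] [ChartedSpace Coord M] [IsManifold (𝓡 4) ∞ M]
variable {M' : Type*} [TopologicalSpace M'] [ChartedSpace Coord M'] [IsManifold (𝓡 4) ∞ M']

variable (M) in
/-- An orientation of `M`, given as a maximal atlas of coordinate systems whose coordinate changes have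
positive Jacobian determinant. -/
structure OrientedAtlas where
  charts : Set (SmoothChart M)
  covers : ∀ x : M, ∃ φ ∈ charts, x ∈ φ.1.source
  pos : ∀ φ ∈ charts, ∀ ψ ∈ charts, ∀ ξ ∈ (φ.1.symm ≫ₕ ψ.1).source,
    0 < (fderiv ℝ (ψ.1 ∘ φ.1.symm) ξ).det
  maximal : ∀ ψ : SmoothChart M, (∀ φ ∈ charts, ∀ ξ ∈ (φ.1.symm ≫ₕ ψ.1).source,
    0 < (fderiv ℝ (ψ.1 ∘ φ.1.symm) ξ).det) → ψ ∈ charts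

variable (M M') in
/-- A diffeomorphism of an open subset of `M` onto an open subset of `M'`. -/
structure LocalDiffeo where
  e : OpenPartialHomeomorph M M'
  smooth_to : ContMDiffOn (𝓡 4) (𝓡 4) ∞ e e.source
  smooth_inv : ContMDiffOn (𝓡 4) (𝓡 4) ∞ e.symm e.target

namespace LocalDiffeo

variable (f : LocalDiffeo M M')

/-- `f` maps the orientation `𝒪` of `M` to the orientation `𝒪'` of `M'`. -/
def PreservesOrientation (𝒪 : OrientedAtlas M) (𝒪' : OrientedAtlas M') : Prop :=
  ∀ φ ∈ 𝒪.charts, ∀ ψ ∈ 𝒪'.charts, ∀ ξ ∈ (φ.1.symm ≫ₕ f.e ≫ₕ ψ.1).source,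
    0 < (fderiv ℝ (ψ.1 ∘ f.e ∘ φ.1.symm) ξ).det

theorem mdifferentiable : f.e.MDifferentiable (𝓡 4) (𝓡 4) :=
  ⟨f.smooth_to.mdifferentiableOn (by simp), f.smooth_inv.mdifferentiableOn (by simp)⟩

/-- The coordinate system `ψ ∘ f` on `M`. -/
def chart (ψ : SmoothChart M') : SmoothChart M :=
  ⟨f.e ≫ₕ ψ.1, (IsManifold.mem_maximalAtlas_iff_contMDiffOn _).2 ⟨
    (contMDiffOn_of_mem_maximalAtlas ψ.2).comp (f.smooth_to.mono fun x hx => by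
      simp at hx; exact hx.1) fun x hx => by simp at hx; exact hx.2,
    f.smooth_inv.comp ((contMDiffOn_symm_of_mem_maximalAtlas ψ.2).mono fun x hx => by
      simp at hx; exact hx.1) fun x hx => by simp at hx; exact hx.2⟩⟩

/-- The transported field of bilinear forms `(f⁻¹)^* g`. -/
def pushForm (g : ∀ x : M, LinearMap.BilinForm ℝ (TangentSpace (𝓡 4) x)) (x' : M') :
    LinearMap.BilinForm ℝ (TangentSpace (𝓡 4) x') :=
  (g (f.e.symm x')).comp (mfderiv (𝓡 4) (𝓡 4) f.e.symm x').toLinearMap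
    (mfderiv (𝓡 4) (𝓡 4) f.e.symm x').toLinearMap

theorem metricComp_pushForm (g : ∀ x : M, LinearMap.BilinForm ℝ (TangentSpace (𝓡 4) x))
    (ψ : SmoothChart M') (μ ν : Fin 4) {η : Coord} (hη : η ∈ ψ.1.target)
    (hη' : ψ.1.symm η ∈ f.e.target) :
    metricComp ψ.1 (f.pushForm g) μ ν η = metricComp (f.chart ψ).1 g μ ν η := by
  have h : ∀ v : Coord, (mfderiv (𝓡 4) (𝓡 4) f.e.symm (ψ.1.symm η)
      (mfderiv (𝓡 4) (𝓡 4) ψ.1.symm η v) : Coord) =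
      mfderiv (𝓡 4) (𝓡 4) (f.chart ψ).1.symm η v := by
    intro v
    have hc := mfderiv_comp η (f.mdifferentiable.mdifferentiableAt_symm hη')
      (ψ.mdifferentiable.mdifferentiableAt_symm hη)
    exact (congrArg (fun L => L v) hc).symm
  exact congrArg₂ (fun v w : Coord => g (f.e.symm (ψ.1.symm η)) v w) (h (unitVec μ)) (h (unitVec ν))

/-- The local metric `f_* σ = (f⁻¹)^* σ` on `M'`. -/
def push (σ : LocalMetric M) : LocalMetric M' where
  dom := f.e.target ∩ f.e.symm ⁻¹' σ.dom
  isOpen_dom := f.e.isOpen_inter_preimage_symm σ.isOpen_dom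
  g := f.pushForm σ.g
  lorentzian := by
    rintro x' ⟨h, h'⟩
    exact (σ.lorentzian _ h').comp (f.mdifferentiable.symm.mfderiv (x := x') h).toLinearEquiv
  smooth := by
    intro ψ μ ν
    refine ((σ.smooth (f.chart ψ) μ ν).mono ?_).congr ?_
    · rintro η ⟨h1, h2, h3⟩
      refine ⟨?_, h3⟩
      show η ∈ (f.e ≫ₕ ψ.1).target
      simpa using And.intro h1 h2
    · rintro η ⟨h1, h2, -⟩
      exact f.metricComp_pushForm σ.g ψ μ ν h1 h2

theorem mem_push {σ : LocalMetric M} {x : M} (hx : x ∈ σ.dom) (hf : x ∈ f.e.source) :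
    f.e x ∈ (f.push σ).dom :=
  ⟨f.e.map_source hf, by simpa [f.e.left_inv hf] using hx⟩

theorem pd_push (σ : LocalMetric M) (ψ : SmoothChart M') {x : M}
    (hf : x ∈ f.e.source) (hψ : f.e x ∈ ψ.1.source) {m : ℕ} (α : Fin m → Fin 4) (μ ν : Fin 4) :
    pd α (metricComp ψ.1 (f.push σ).g μ ν) (ψ.1 (f.e x)) =
      pd α (metricComp (f.chart ψ).1 σ.g μ ν) ((f.chart ψ).1 x) := by
  refine congrArg (fun L : Coord [×m]→L[ℝ] ℝ => L fun i => unitVec (α i))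
    (Filter.EventuallyEq.iteratedFDeriv ℝ ?_ m).self_of_nhds
  have hU : IsOpen (ψ.1.target ∩ ψ.1.symm ⁻¹' f.e.target) :=
    ψ.1.isOpen_inter_preimage_symm f.e.open_target
  have hm : ψ.1 (f.e x) ∈ ψ.1.target ∩ ψ.1.symm ⁻¹' f.e.target :=
    ⟨ψ.1.map_source hψ, by simpa [ψ.1.left_inv hψ] using f.e.map_source hf⟩
  filter_upwards [hU.mem_nhds hm] with η hη
  exact f.metricComp_pushForm σ.g ψ μ ν hη.1 hη.2

open Classical in
/-- The prolongation `J^k f : J^k(M, N) → J^k(M', N')`, `j^k_x σ ↦ j^k_{f(x)} (f_* σ)` (with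
unspecified values over the complement of the domain of `f`). -/
def jet (k : ℕ) (j : Jet k M) : Jet k M' :=
  Quotient.lift (s := jetSetoid k M) (fun p : MetricAt M =>
    if h : p.pt ∈ f.e.source then Jet.mk k ⟨f.push p.σ, f.e p.pt, f.mem_push p.mem h⟩
    else Jet.default k (f.e p.pt)) (by
    rintro p q ⟨h, h'⟩
    by_cases hp : p.pt ∈ f.e.source
    · have hq : q.pt ∈ f.e.source := h ▸ hp
      simp only [dif_pos hp, dif_pos hq]
      refine Quotient.sound ⟨congrArg f.e h, fun ψ hψ m hm α μ ν => ?_⟩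
      have hψ' : f.e p.pt ∈ ψ.1.source := hψ
      have hψ'' : f.e q.pt ∈ ψ.1.source := h ▸ hψ'
      have h1 := h' (f.chart ψ) (by
        show p.pt ∈ (f.e ≫ₕ ψ.1).source
        simpa using And.intro hp hψ') m hm α μ ν
      refine (f.pd_push p.σ ψ hp hψ' α μ ν).trans (h1.trans ?_)
      have h2 := f.pd_push q.σ ψ hq hψ'' α μ ν
      rw [← h] at h2
      exact h2.symm
    · have hq : q.pt ∉ f.e.source := h ▸ hp
      simp only [dif_neg hq, h]) j

end LocalDiffeo

open Classical in
/-- The `k`-jet extension `j^k σ` of a local section (with unspecified values outside the domain of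
`σ`). -/
def LocalMetric.jet (k : ℕ) (σ : LocalMetric M) (x : M) : Jet k M :=
  if h : x ∈ σ.dom then Jet.mk k ⟨σ, x, h⟩ else Jet.default k x

end LocalDiffeomorphisms

section Forms

variable {M : Type*} [TopologicalSpace M] [ChartedSpace Coord M] [IsManifold (𝓡 4) ∞ M]
variable {M' : Type*} [TopologicalSpace M'] [ChartedSpace Coord M'] [IsManifold (𝓡 4) ∞ M']
variable {k : ℕ}

/-- The tangent space of `J^k(M, N)` at `j`. -/
abbrev JetTangent (k : ℕ) (M : Type*) [TopologicalSpace M] [ChartedSpace Coord M]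
    [IsManifold (𝓡 4) ∞ M] (j : Jet k M) : Type :=
  TangentSpace 𝓘(ℝ, JetModel k) j

/-- Differential `4`-forms on `J^k(M, N)`. -/
abbrev JetForm (k : ℕ) (M : Type*) [TopologicalSpace M] [ChartedSpace Coord M]
    [IsManifold (𝓡 4) ∞ M] : Type _ :=
  ∀ j : Jet k M, JetTangent k M j [⋀^Fin 4]→ₗ[ℝ] ℝ

namespace JetForm

/-- The components of a form, as functions of the coordinates induced by `φ`. -/
def comp (φ : SmoothChart M) (κ : JetForm k M) (v : Fin 4 → JetModel k) (w : JetModel k) : ℝ :=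
  κ ((Jet.chart k φ).symm w)
    fun i => mfderiv 𝓘(ℝ, JetModel k) 𝓘(ℝ, JetModel k) (Jet.chart k φ).symm w (v i)

/-- Smoothness of a form. -/
def IsSmooth (κ : JetForm k M) : Prop :=
  ∀ (φ : SmoothChart M) (v : Fin 4 → JetModel k),
    ContDiffOn ℝ ∞ (κ.comp φ v) (Jet.chart k φ).target

/-- All derivatives of order at most `r` of the components of `κ₁` and of `κ₂` agree at `j`. -/
def EqToOrder (r : ℕ) (κ₁ κ₂ : JetForm k M) (j : Jet k M) : Prop :=
  ∀ φ : SmoothChart M, j.base ∈ φ.1.source → ∀ (v : Fin 4 → JetModel k), ∀ m ≤ r,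
    iteratedFDeriv ℝ m (κ₁.comp φ v) (Jet.coord φ j) =
      iteratedFDeriv ℝ m (κ₂.comp φ v) (Jet.coord φ j)

/-- The pull-back of a form on `J^k(M', N')` by the prolongation of a local diffeomorphism (only
meaningful over the domain of `f`). -/
def pullback (f : LocalDiffeo M M') (κ : JetForm k M') : JetForm k M := fun j =>
  (κ (f.jet k j)).compLinearMap
    (mfderiv 𝓘(ℝ, JetModel k) 𝓘(ℝ, JetModel k) (f.jet k) j).toLinearMap

end JetForm

/-- A Lagrange form of second order: a smooth `4`-form on `J²(M, N)` that is semi-basic, i.e. vanishes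
as soon as one argument is tangent to the fibres of the source projection. -/
structure IsLagrangeForm (Λ : JetForm 2 M) : Prop where
  smooth : Λ.IsSmooth
  semibasic : ∀ (j : Jet 2 M) (v : Fin 4 → JetTangent 2 M j),
    (∃ i, mfderiv 𝓘(ℝ, JetModel 2) (𝓡 4) Jet.base j (v i) = 0) → Λ j v = 0

/-- Invariance under the orientation preserving diffeomorphisms of `M`. -/
def IsInvariant (𝒪 : OrientedAtlas M) (Λ : JetForm 2 M) : Prop :=
  ∀ f : LocalDiffeo M M, f.e.source = Set.univ → f.e.target = Set.univ →
    f.PreservesOrientation 𝒪 𝒪 → Λ.pullback f = Λ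

/-- The coordinate function `z_{μνα₁…α_m}` on `J^k(M, N)`, `m ≤ k` (it is `y_{μν}` for `m = 0`). -/
def zCoord (φ : SmoothChart M) {m : ℕ} (hm : m ≤ k) (μ ν : Fin 4) (α : Fin m → Fin 4)
    (j : Jet k M) : ℝ :=
  (Jet.coord φ j).2.1 ⟨m, Nat.lt_succ_of_le hm⟩ μ ν α

/-- The differential `df` of a function on `J^k(M, N)`. -/
def diff (f : Jet k M → ℝ) (j : Jet k M) : JetTangent k M j →ₗ[ℝ] ℝ :=
  (mfderiv 𝓘(ℝ, JetModel k) 𝓘(ℝ, ℝ) f j).toLinearMap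

/-- The `1`-form `dx^μ` on `J^k(M, N)`. -/
def dx (φ : SmoothChart M) (μ : Fin 4) (j : Jet k M) : JetTangent k M j →ₗ[ℝ] ℝ :=
  diff (fun j => (Jet.coord φ j).1 μ) j

/-- The `4`-form `d₄x = dx^0 ∧ dx^1 ∧ dx^2 ∧ dx^3` on `J^k(M, N)`. -/
def d4x (φ : SmoothChart M) (j : Jet k M) : JetTangent k M j [⋀^Fin 4]→ₗ[ℝ] ℝ :=
  (Matrix.detRowAlternating (R := ℝ) (n := Fin 4)).compLinearMap (LinearMap.pi fun μ => dx φ μ j)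

/-- The `3`-form `∂_β ⌟ d₄x` on `J^k(M, N)`. -/
def intd4x (φ : SmoothChart M) (β : Fin 4) (j : Jet k M) :
    JetTangent k M j [⋀^Fin 3]→ₗ[ℝ] ℝ :=
  ((Matrix.detRowAlternating (R := ℝ) (n := Fin 4)).curryLeft (Pi.single β 1)).compLinearMap
    (LinearMap.pi fun μ => dx φ μ j)

/-- The exterior product `θ ∧ κ` of a `1`-form and a `3`-form:
`(θ ∧ κ)(v₀, …, v₃) = ∑ i, (-1)^i θ(v_i) κ(v₀, …, v̂_i, …, v₃)`. -/
def wedge {T : Type*} [AddCommGroup T] [Module ℝ T] (θ : T →ₗ[ℝ] ℝ) (κ : T [⋀^Fin 3]→ₗ[ℝ] ℝ) :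
    T [⋀^Fin 4]→ₗ[ℝ] ℝ :=
  AlternatingMap.alternatizeUncurryFin (θ.smulRight κ)

/-- The contact form `dz_{μνα₁…α_m} - z_{μνα₁…α_mγ} dx^γ` on `J^k(M, N)`, `m < k`. -/
def contact (φ : SmoothChart M) {m : ℕ} (hm : m + 1 ≤ k) (μ ν : Fin 4) (α : Fin m → Fin 4)
    (j : Jet k M) : JetTangent k M j →ₗ[ℝ] ℝ :=
  diff (zCoord φ (Nat.le_of_succ_le hm) μ ν α) j -
    ∑ γ, zCoord φ hm μ ν (Fin.snoc α γ) j • dx φ γ j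

/-- The array with entry `1` at `z_{μνα₁…α_m}` and `0` elsewhere, symmetrised in `μν` and in the `α`'s. -/
def symUnit (k : ℕ) {m : ℕ} (μ ν : Fin 4) (α : Fin m → Fin 4) : JetFib k :=
  ⟨fun m' μ' ν' α' =>
    ((if μ' = μ ∧ ν' = ν then 1 else 0) + (if μ' = ν ∧ ν' = μ then 1 else 0)) / 2 *
      ((Nat.card {s : Fin m' ≃ Fin m // α ∘ s = α'} : ℝ) / (m.factorial : ℝ)), by
    intro m' μ' ν' α'
    refine ⟨?_, fun s => ?_⟩
    · simp only [and_comm, add_comm]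
    · have h : Nat.card {t : Fin m' ≃ Fin m // α ∘ t = α' ∘ s} =
          Nat.card {t : Fin m' ≃ Fin m // α ∘ t = α'} :=
        Nat.card_congr
          { toFun := fun t => ⟨s.symm.trans t.1, by
              funext i; simpa using congrFun t.2 (s.symm i)⟩
            invFun := fun t => ⟨s.trans t.1, by
              funext i; simpa using congrFun t.2 (s i)⟩
            left_inv := fun t => by ext; simp
            right_inv := fun t => by ext; simp }
      simp only [h]⟩

/-- The partial derivative `∂L/∂z_{μνα₁…α_m}` of a function on `J^k(M, N)`, `m ≤ k`, normalised to be
symmetric in `μν` and in the `α`'s: the fibre derivative of `L` in the direction `δz` is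
`∑ m, ∑ μ ν α₁ … α_m, ∂L/∂z_{μνα₁…α_m} δz_{μνα₁…α_m}`, summed over all values of the indices. -/
def partialZ (φ : SmoothChart M) (L : Jet k M → ℝ) {m : ℕ} (μ ν : Fin 4) (α : Fin m → Fin 4)
    (j : Jet k M) : ℝ :=
  fderiv ℝ (fun w => L ((Jet.chart k φ).symm w)) (Jet.coord φ j) (0, symUnit k μ ν α)

/-- The partial derivative `∂F/∂x^β` of a function on `M` in the coordinates `φ`. -/
def partialX (φ : SmoothChart M) (F : M → ℝ) (β : Fin 4) (x : M) : ℝ :=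
  fderiv ℝ (fun ξ => F (φ.1.symm ξ)) (φ.1 x) (unitVec β)

/-- On the domain of the coordinates induced by the chart `φ`, `Θ` is the De Donder form of `Λ`:
`Λ = L d₄x` and
`Θ = L d₄x + p^{μναβ} (dz_{μνα} - z_{μναγ} dx^γ) ∧ (∂_β ⌟ d₄x)
  + p^{μνα} (dy_{μν} - z_{μνγ} dx^γ) ∧ (∂_α ⌟ d₄x)`
where `p^{μναβ}` and `p^{μνα}` are functions on `J³(M, N)` such that for every local section `σ`
`(j³σ)^* p^{μναβ} = (j²σ)^* ∂L/∂z_{μναβ}` and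
`(j³σ)^* p^{μνα} = (j²σ)^* ∂L/∂z_{μνα} - ∂/∂x^β ((j²σ)^* ∂L/∂z_{μναβ})`. -/
def IsDeDonderIn (φ : SmoothChart M) (Λ : JetForm 2 M) (Θ : JetForm 3 M) : Prop :=
  ∃ (L : Jet 2 M → ℝ) (p₂ : Fin 4 → Fin 4 → Fin 4 → Fin 4 → Jet 3 M → ℝ)
    (p₁ : Fin 4 → Fin 4 → Fin 4 → Jet 3 M → ℝ),
    (∀ j : Jet 2 M, j.base ∈ φ.1.source → Λ j = L j • d4x φ j) ∧
    (∀ (σ : LocalMetric M), ∀ x ∈ σ.dom ∩ φ.1.source, ∀ μ ν α β : Fin 4,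
      p₂ μ ν α β (σ.jet 3 x) = partialZ φ L μ ν ![α, β] (σ.jet 2 x)) ∧
    (∀ (σ : LocalMetric M), ∀ x ∈ σ.dom ∩ φ.1.source, ∀ μ ν α : Fin 4,
      p₁ μ ν α (σ.jet 3 x) = partialZ φ L μ ν ![α] (σ.jet 2 x) -
        ∑ β, partialX φ (fun x' => partialZ φ L μ ν ![α, β] (σ.jet 2 x')) β x) ∧
    ∀ j : Jet 3 M, j.base ∈ φ.1.source →
      Θ j = L (j.forget (by norm_num)) • d4x φ j +
        ∑ μ, ∑ ν, ∑ α, ∑ β, p₂ μ ν α β j •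
          wedge (contact φ (m := 1) (by norm_num) μ ν ![α] j) (intd4x φ β j) +
        ∑ μ, ∑ ν, ∑ α, p₁ μ ν α j •
          wedge (contact φ (m := 0) (by norm_num) μ ν ![] j) (intd4x φ α j)

/-- `Θ` is a global De Donder form of `Λ`: a smooth `4`-form on `J³(M, N)` which is the De Donder form
of `Λ` in all positively oriented coordinates. -/
structure IsDeDonder (𝒪 : OrientedAtlas M) (Λ : JetForm 2 M) (Θ : JetForm 3 M) : Prop where
  smooth : Θ.IsSmooth
  eq : ∀ φ ∈ 𝒪.charts, IsDeDonderIn φ Λ Θ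

end Forms

end DeDonder

end

/-!
# The De Donder form of a second-order Lagrange form on the bundle of Lorentzian metrics

In a chart, a Lagrange form is `L d₄x` (`IsLagrangeForm.eq_smul`), and the two defining equations of
the momenta `p^{μναβ}` and `p^{μνα}` determine them as functions of the coordinates of the `3`-jet,
because every `3`-jet is the jet of a section and the derivative of a function along a section is
its total derivative (`momentum_section`). So a De Donder form in a chart exists, is unique over the
chart domain, and is given by an explicit expression (`isDeDonderIn_iff`, `deDonderVal`) in the
partial derivatives of `L` of order at most two, linear in `L`.

The point is that this expression is independent of the chart. Modulo vectors tangent to a prolonged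
section, on which the contact forms vanish, every tangent vector of the jet bundle is vertical;
hence the values of the contact forms on a tangent vector are the derivatives `∂_α h_{μν}`, `h_{μν}`
of a symmetric tensor field `h` (`exists_contact_field`), and the contact part of the De Donder form
is `d₄x` with the *boundary current* `p^{μναβ} ∂_α h_{μν} + p^{μνβ} h_{μν}` inserted. It remains to
see that this current is a vector density (`current_transform`).

Fix a section and a field `h`. For a function `f` let `ℓ(f h)` be the derivative of `L` along the
fibres in the direction of the `2`-jet of `f h`. This is a scalar second-order operator
`a f + b^α ∂_α f + c^{αβ} ∂_α ∂_β f` with symmetric `c` (`fibOp_mul`), with values in densities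
(`fibOp_transform`). Since the partial derivatives of `L` are symmetric in `αβ`, the current is
`b^β - ∂_α c^{αβ}` (`current_eq`). Under a change of coordinates `c` is a tensor density, and `b`
transforms with a correction by second derivatives of the coordinate change; by the Piola identity
(`piola`) that correction cancels the one arising from `∂_α c^{αβ}` (`boundary_transform`).

Linearity and the bound on the order can be read off the local expression. Naturality follows by
computing both sides in the charts `ψ ∘ f` and `ψ`, between which the prolongation of `f` is the
identity (`LocalDiffeo.coord_jet`, `LocalDiffeo.tangentCoord_jet`).
-/

noncomputable section

namespace DeDonder

set_option linter.unusedSectionVars false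

/-! ### Partial derivatives and the Piola identity -/

/-- The partial derivative `∂f/∂x^α` of a function of the coordinates. -/
def dir (α : Fin 4) (f : Coord → ℝ) (ξ : Coord) : ℝ := fderiv ℝ f ξ (unitVec α)

theorem dir_congr {f g : Coord → ℝ} {ξ : Coord} (h : f =ᶠ[𝓝 ξ] g) (α : Fin 4) :
    dir α f ξ = dir α g ξ := by
  unfold dir; rw [h.fderiv_eq]

theorem dir_sum {ι : Type*} {s : Finset ι} {f : ι → Coord → ℝ} {ξ : Coord} (α : Fin 4)
    (h : ∀ i ∈ s, DifferentiableAt ℝ (f i) ξ) :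
    dir α (fun x => ∑ i ∈ s, f i x) ξ = ∑ i ∈ s, dir α (f i) ξ := by
  unfold dir
  rw [fderiv_fun_sum h]
  simp

theorem dir_mul {f g : Coord → ℝ} {ξ : Coord} (α : Fin 4) (hf : DifferentiableAt ℝ f ξ)
    (hg : DifferentiableAt ℝ g ξ) :
    dir α (fun x => f x * g x) ξ = dir α f ξ * g ξ + f ξ * dir α g ξ := by
  unfold dir
  rw [fderiv_fun_mul hf hg]
  simp
  ring

theorem dir_add {f g : Coord → ℝ} {ξ : Coord} (α : Fin 4) (hf : DifferentiableAt ℝ f ξ)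
    (hg : DifferentiableAt ℝ g ξ) :
    dir α (fun x => f x + g x) ξ = dir α f ξ + dir α g ξ := by
  unfold dir
  rw [fderiv_fun_add hf hg]
  simp

theorem fderiv_apply_eq_sum (f : Coord → ℝ) (ξ v : Coord) :
    fderiv ℝ f ξ v = ∑ α, v α * dir α f ξ := by
  conv_lhs => rw [coord_eq_sum v]
  simp [dir]

theorem contDiffAt_dir {f : Coord → ℝ} {ξ : Coord} (hf : ContDiffAt ℝ ∞ f ξ) (α : Fin 4) :
    ContDiffAt ℝ ∞ (dir α f) ξ :=
  (hf.fderiv_right (m := ∞) (infty_add_le 1)).clm_apply contDiffAt_const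

theorem dir_comm {f : Coord → ℝ} {ξ : Coord} (hf : ContDiffAt ℝ ∞ f ξ) (α β : Fin 4) :
    dir α (dir β f) ξ = dir β (dir α f) ξ := by
  have hd : DifferentiableAt ℝ (fderiv ℝ f) ξ :=
    (hf.fderiv_right (m := ∞) (infty_add_le 1)).differentiableAt (by simp)
  have hs := hf.isSymmSndFDerivAt (by simpa using natCast_le_infty 2)
  have h : ∀ α β : Fin 4, dir α (dir β f) ξ =
      fderiv ℝ (fderiv ℝ f) ξ (unitVec α) (unitVec β) := by
    intro α β
    unfold dir
    rw [fderiv_clm_apply hd (differentiableAt_const _)]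
    simp
  rw [h, h]
  exact hs.eq _ _

theorem pd_cons_of_le {f : Coord → ℝ} {ξ : Coord} {m : ℕ}
    (hf : ContDiffAt ℝ ((m + 1 : ℕ) : WithTop ℕ∞) f ξ) (β : Fin 4) (α : Fin m → Fin 4) :
    pd (Fin.cons β α : Fin (m + 1) → Fin 4) f ξ = dir β (pd α f) ξ := by
  have hd : DifferentiableAt ℝ (iteratedFDeriv ℝ m f) ξ :=
    (hf.iteratedFDeriv_right (m := 1) (i := m) (by
      push_cast; rw [add_comm])).differentiableAt one_ne_zero
  unfold pd dir
  rw [iteratedFDeriv_succ_apply_left, ← fderiv_continuousMultilinear_apply_const_apply hd]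
  simp [Fin.tail_def]

theorem pd_cons {f : Coord → ℝ} {ξ : Coord} (hf : ContDiffAt ℝ ∞ f ξ) {m : ℕ} (β : Fin 4)
    (α : Fin m → Fin 4) :
    pd (Fin.cons β α : Fin (m + 1) → Fin 4) f ξ = dir β (pd α f) ξ :=
  pd_cons_of_le (hf.of_le (natCast_le_infty _)) β α

theorem pd_zero (f : Coord → ℝ) (ξ : Coord) (α : Fin 0 → Fin 4) : pd α f ξ = f ξ :=
  iteratedFDeriv_zero_apply _

theorem pd_one_of_le {f : Coord → ℝ} {ξ : Coord} (hf : ContDiffAt ℝ 1 f ξ) (α : Fin 4) :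
    pd ![α] f ξ = dir α f ξ := by
  have h := pd_cons_of_le (m := 0) (by simpa using hf) α ![]
  have e : pd (![] : Fin 0 → Fin 4) f = f := funext fun x => pd_zero f x _
  rw [e] at h
  exact h

theorem pd_one {f : Coord → ℝ} {ξ : Coord} (hf : ContDiffAt ℝ ∞ f ξ) (α : Fin 4) :
    pd ![α] f ξ = dir α f ξ :=
  pd_one_of_le (hf.of_le one_le_infty) α

theorem pd_two {f : Coord → ℝ} {ξ : Coord} (hf : ContDiffAt ℝ ∞ f ξ) (α β : Fin 4) :
    pd ![α, β] f ξ = dir α (dir β f) ξ := by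
  refine (pd_cons hf α ![β]).trans (dir_congr ?_ α)
  filter_upwards [(hf.of_le one_le_infty).eventually (by simp)] with x hx using pd_one_of_le hx β

/-- The Jacobian matrix of `τ`; the row index belongs to the source coordinates, so that
`jac τ η a α = ∂τ^α/∂η^a`. -/
def jac (τ : Coord → Coord) (η : Coord) : Matrix (Fin 4) (Fin 4) ℝ :=
  Matrix.of fun a α => fderiv ℝ τ η (unitVec a) α

theorem jac_eq_dir {τ : Coord → Coord} {η : Coord} (hτ : DifferentiableAt ℝ τ η) (a α : Fin 4) :
    jac τ η a α = dir a (fun x => τ x α) η := by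
  have h : HasFDerivAt (fun x => τ x α)
      ((EuclideanSpace.proj α : Coord →L[ℝ] ℝ).comp (fderiv ℝ τ η)) η :=
    (EuclideanSpace.proj α : Coord →L[ℝ] ℝ).hasFDerivAt.comp η hτ.hasFDerivAt
  unfold dir
  rw [h.fderiv]
  rfl

theorem fderiv_apply_eq_sum_jac (τ : Coord → Coord) (η v : Coord) (α : Fin 4) :
    fderiv ℝ τ η v α = ∑ a, v a * jac τ η a α := by
  conv_lhs => rw [coord_eq_sum v]
  simp [jac]

theorem contDiffAt_coord {τ : Coord → Coord} {η : Coord} (hτ : ContDiffAt ℝ ∞ τ η) (α : Fin 4) :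
    ContDiffAt ℝ ∞ (fun x => τ x α) η :=
  (EuclideanSpace.proj α : Coord →L[ℝ] ℝ).contDiff.contDiffAt.comp η hτ

theorem jac_eventually_eq_dir {τ : Coord → Coord} {η : Coord} (hτ : ContDiffAt ℝ ∞ τ η)
    (a α : Fin 4) : (fun x => jac τ x a α) =ᶠ[𝓝 η] dir a (fun x => τ x α) := by
  filter_upwards [(hτ.of_le one_le_infty).eventually (by simp)] with x hx
  exact jac_eq_dir (hx.differentiableAt one_ne_zero) a α

theorem contDiffAt_jac {τ : Coord → Coord} {η : Coord} (hτ : ContDiffAt ℝ ∞ τ η) (a α : Fin 4) :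
    ContDiffAt ℝ ∞ (fun x => jac τ x a α) η :=
  (contDiffAt_dir (contDiffAt_coord hτ α) a).congr_of_eventuallyEq (jac_eventually_eq_dir hτ a α)

theorem contDiffAt_det_jac {τ : Coord → Coord} {η : Coord} (hτ : ContDiffAt ℝ ∞ τ η) :
    ContDiffAt ℝ ∞ (fun x => (jac τ x).det) η := by
  simp only [Matrix.det_apply']
  exact ContDiffAt.sum fun σ _ => contDiffAt_const.mul
    (contDiffAt_prod fun i _ => contDiffAt_jac hτ (σ i) i)

theorem dir_jac_comm {τ : Coord → Coord} {η : Coord} (hτ : ContDiffAt ℝ ∞ τ η) (a b α : Fin 4) :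
    dir b (fun x => jac τ x a α) η = dir a (fun x => jac τ x b α) η := by
  rw [dir_congr (jac_eventually_eq_dir hτ a α), dir_congr (jac_eventually_eq_dir hτ b α)]
  exact dir_comm (contDiffAt_coord hτ α) _ _

theorem dir_comp {τ : Coord → Coord} {η : Coord} {f : Coord → ℝ} (hτ : DifferentiableAt ℝ τ η)
    (hf : DifferentiableAt ℝ f (τ η)) (a : Fin 4) :
    dir a (fun x => f (τ x)) η = ∑ γ, jac τ η a γ * dir γ f (τ η) := by
  have h : HasFDerivAt (fun x => f (τ x)) ((fderiv ℝ f (τ η)).comp (fderiv ℝ τ η)) η :=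
    hf.hasFDerivAt.comp η hτ.hasFDerivAt
  unfold dir
  rw [h.fderiv, ContinuousLinearMap.comp_apply, fderiv_apply_eq_sum]
  rfl

/-- Jacobi's formula for the derivative of a determinant. -/
theorem dir_det {A : Coord → Matrix (Fin 4) (Fin 4) ℝ} {η : Coord}
    (hA : ∀ i j, DifferentiableAt ℝ (fun x => A x i j) η) (c : Fin 4) :
    dir c (fun x => (A x).det) η =
      ∑ i, ∑ j, (A η).adjugate j i * dir c (fun x => A x i j) η := by
  let D : ContinuousMultilinearMap ℝ (fun _ : Fin 4 => Fin 4 → ℝ) ℝ :=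
    ⟨(Matrix.detRowAlternating (R := ℝ) (n := Fin 4)).toMultilinearMap,
      Continuous.matrix_det (A := fun x : Fin 4 → Fin 4 → ℝ => Matrix.of x) continuous_id⟩
  have hA' : HasFDerivAt (fun x => (fun i j => A x i j : Fin 4 → Fin 4 → ℝ))
      (ContinuousLinearMap.pi fun i => ContinuousLinearMap.pi fun j =>
        fderiv ℝ (fun x => A x i j) η) η :=
    hasFDerivAt_pi.2 fun i => hasFDerivAt_pi.2 fun j => (hA i j).hasFDerivAt
  have h := (D.hasFDerivAt (fun i j => A η i j)).comp η hA'
  have h' : HasFDerivAt (fun x => (A x).det) _ η := h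
  unfold dir
  rw [h'.fderiv, ContinuousLinearMap.comp_apply, ContinuousMultilinearMap.linearDeriv_apply]
  refine Finset.sum_congr rfl fun i _ => ?_
  have e := Matrix.cramer_transpose_apply (A η)
    (fun j => fderiv ℝ (fun x => A x i j) η (unitVec c)) i
  rw [Matrix.cramer_eq_adjugate_mulVec, ← Matrix.adjugate_transpose] at e
  refine Eq.trans ?_ (e.symm.trans ?_)
  · rfl
  · simp [Matrix.mulVec, dotProduct, Matrix.transpose_apply]

/-- The Piola identity: the divergence of the pull-back `V` of a vector density `X` is the pull-back
of the divergence of `X`. -/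
theorem piola {τ : Coord → Coord} {η : Coord} (hτ : ContDiffAt ℝ ∞ τ η)
    (hJ : (jac τ η).det ≠ 0) {V X : Fin 4 → Coord → ℝ}
    (hV : ∀ b, DifferentiableAt ℝ (V b) η) (hX : ∀ α, DifferentiableAt ℝ (X α) (τ η))
    (h : ∀ α, ∀ᶠ x in 𝓝 η, ∑ b, V b x * jac τ x b α = (jac τ x).det * X α (τ x)) :
    ∑ b, dir b (V b) η = (jac τ η).det * ∑ α, dir α (X α) (τ η) := by
  have hjd : ∀ a α, DifferentiableAt ℝ (fun x => jac τ x a α) η := fun a α =>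
    (contDiffAt_jac hτ a α).differentiableAt (by simp)
  have hτd := hτ.differentiableAt (by simp)
  set S : Fin 4 → Fin 4 → Fin 4 → ℝ := fun c b α => dir c (fun x => jac τ x b α) η with hS
  set C := (jac τ η).adjugate with hC
  set J := (jac τ η).det with hJdef
  have hdet : DifferentiableAt ℝ (fun x => (jac τ x).det) η :=
    (contDiffAt_det_jac hτ).differentiableAt (by simp)
  have hdJ : ∀ c, dir c (fun x => (jac τ x).det) η = ∑ b, ∑ α, C α b * S c b α := fun c =>
    dir_det hjd c
  have hd : ∀ c α, ∑ b, (dir c (V b) η * jac τ η b α + V b η * S c b α) =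
      (∑ b, ∑ β, C β b * S c b β) * X α (τ η) +
        J * ∑ γ, jac τ η c γ * dir γ (X α) (τ η) := by
    intro c α
    have e := dir_congr (h α) c
    rw [dir_sum c fun b _ => (hV b).fun_mul (hjd b α)] at e
    have hXτ : DifferentiableAt ℝ (fun x => X α (τ x)) η := (hX α).comp η hτd
    rw [dir_mul c hdet hXτ, hdJ, dir_comp hτd (hX α)] at e
    rw [← e]
    exact Finset.sum_congr rfl fun b _ => (dir_mul c (hV b) (hjd b α)).symm
  have h0 : ∀ α, ∑ b, V b η * jac τ η b α = J * X α (τ η) := fun α => (h α).self_of_nhds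
  have hmul1 : ∀ b c, ∑ α, jac τ η b α * C α c = if b = c then J else 0 := by
    intro b c
    have := congrFun (congrFun (Matrix.mul_adjugate (jac τ η)) b) c
    simpa [Matrix.mul_apply, Matrix.one_apply] using this
  have hmul2 : ∀ α γ, ∑ c, C α c * jac τ η c γ = if α = γ then J else 0 := by
    intro b c
    have := congrFun (congrFun (Matrix.adjugate_mul (jac τ η)) b) c
    simpa [Matrix.mul_apply, Matrix.one_apply] using this
  have hsym : ∀ b c α, S c b α = S b c α := fun b c α => dir_jac_comm hτ b c α
  -- contract the derivative of the hypothesis with the adjugate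
  have key : ∑ c, ∑ α, C α c * (∑ b, (dir c (V b) η * jac τ η b α + V b η * S c b α)) =
      ∑ c, ∑ α, C α c * ((∑ b, ∑ β, C β b * S c b β) * X α (τ η) +
        J * ∑ γ, jac τ η c γ * dir γ (X α) (τ η)) :=
    Finset.sum_congr rfl fun c _ => Finset.sum_congr rfl fun α _ => by rw [hd]
  have hVC : ∀ b, V b η = ∑ α, C α b * X α (τ η) := by
    intro b
    have : J * V b η = J * ∑ α, C α b * X α (τ η) := by
      calc J * V b η = ∑ c, V c η * (if c = b then J else 0) := by simp [mul_comm]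
        _ = ∑ c, V c η * ∑ α, jac τ η c α * C α b := by simp only [hmul1]
        _ = ∑ α, C α b * ∑ c, V c η * jac τ η c α := by
          simp only [Finset.mul_sum]
          rw [Finset.sum_comm]
          exact Finset.sum_congr rfl fun α _ => Finset.sum_congr rfl fun c _ => by ring
        _ = J * ∑ α, C α b * X α (τ η) := by
          simp only [h0, Finset.mul_sum]
          exact Finset.sum_congr rfl fun α _ => by ring
    exact mul_left_cancel₀ hJ this
  have l1 : ∑ c, ∑ α, C α c * ∑ b, dir c (V b) η * jac τ η b α = J * ∑ b, dir b (V b) η := by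
    calc _ = ∑ c, ∑ b, dir c (V b) η * ∑ α, jac τ η b α * C α c := by
          refine Finset.sum_congr rfl fun c _ => ?_
          simp only [Finset.mul_sum]
          rw [Finset.sum_comm]
          exact Finset.sum_congr rfl fun α _ => Finset.sum_congr rfl fun c _ => by ring
      _ = _ := by simp [hmul1, Finset.mul_sum, mul_comm]
  have l2 : ∑ c, ∑ α, C α c * ∑ b, V b η * S c b α =
      ∑ c, ∑ α, C α c * ((∑ b, ∑ β, C β b * S c b β) * X α (τ η)) := by
    calc _ = ∑ b, V b η * ∑ c, ∑ α, C α c * S c b α := by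
          simp only [Finset.mul_sum]
          rw [Finset.sum_comm' (t' := Finset.univ) (s' := fun _ => Finset.univ) (by simp)]
          rw [Finset.sum_congr rfl fun α _ => Finset.sum_comm]
          rw [Finset.sum_comm]
          refine Finset.sum_congr rfl fun b _ => ?_
          rw [Finset.sum_comm]
          exact Finset.sum_congr rfl fun c _ => Finset.sum_congr rfl fun α _ => by ring
      _ = ∑ b, (∑ α, C α b * X α (τ η)) * ∑ c, ∑ α, C α c * S b c α := by
          refine Finset.sum_congr rfl fun b _ => ?_
          rw [hVC b]
          congr 1
          exact Finset.sum_congr rfl fun c _ => Finset.sum_congr rfl fun α _ => by rw [hsym]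
      _ = _ := by
          refine Finset.sum_congr rfl fun b _ => ?_
          rw [Finset.sum_mul]
          exact Finset.sum_congr rfl fun α _ => by ring
  have l3 : ∑ c, ∑ α, C α c * (J * ∑ γ, jac τ η c γ * dir γ (X α) (τ η)) =
      J * (J * ∑ α, dir α (X α) (τ η)) := by
    rw [Finset.sum_comm]
    calc _ = ∑ α, J * ∑ γ, (∑ c, C α c * jac τ η c γ) * dir γ (X α) (τ η) := by
          refine Finset.sum_congr rfl fun α _ => ?_
          simp only [Finset.mul_sum, Finset.sum_mul]
          rw [Finset.sum_comm]
          exact Finset.sum_congr rfl fun c _ => Finset.sum_congr rfl fun α _ => by ring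
      _ = _ := by simp [hmul2, Finset.mul_sum]
  simp only [Finset.sum_add_distrib, mul_add] at key
  rw [l1, l2, l3] at key
  exact mul_left_cancel₀ hJ (by linarith)

/-- Let `f ↦ a f + b^α f_α + c^{αβ} f_{αβ}` be a scalar differential operator with values in
densities. Then `b^β - ∂_α c^{αβ}` is a vector density. The hypotheses are the transformation laws
of `c` and `b` under the coordinate change `τ`. -/
theorem boundary_transform {τ : Coord → Coord} {η : Coord} (hτ : ContDiffAt ℝ ∞ τ η)
    (hJ : (jac τ η).det ≠ 0) {c c' : Fin 4 → Fin 4 → Coord → ℝ} {b b' : Fin 4 → ℝ}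
    (hc : ∀ α β, DifferentiableAt ℝ (c α β) (τ η)) (hc' : ∀ α β, DifferentiableAt ℝ (c' α β) η)
    (h2 : ∀ α β, ∀ᶠ x in 𝓝 η, ∑ a, ∑ b, c' a b x * jac τ x a α * jac τ x b β =
      (jac τ x).det * c α β (τ x))
    (h1 : ∀ α, ∑ a, b' a * jac τ η a α +
      ∑ a, ∑ b, c' a b η * dir a (fun x => jac τ x b α) η = (jac τ η).det * b α) (β : Fin 4) :
    ∑ a, jac τ η a β * (b' a - ∑ d, dir d (c' d a) η) =
      (jac τ η).det * (b β - ∑ α, dir α (c α β) (τ η)) := by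
  have hjd : ∀ a α, DifferentiableAt ℝ (fun x => jac τ x a α) η := fun a α =>
    (contDiffAt_jac hτ a α).differentiableAt (by simp)
  have hp := piola hτ hJ (V := fun d x => ∑ a, c' d a x * jac τ x a β) (X := fun α => c α β)
    (fun d => DifferentiableAt.fun_sum fun a _ => (hc' d a).mul (hjd a β)) (fun α => hc α β) (by
      intro α
      filter_upwards [h2 α β] with x hx
      rw [← hx]
      refine Finset.sum_congr rfl fun d _ => ?_
      rw [Finset.sum_mul]
      exact Finset.sum_congr rfl fun a _ => by ring)
  have hd : ∀ d, dir d (fun x => ∑ a, c' d a x * jac τ x a β) η =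
      ∑ a, (dir d (c' d a) η * jac τ η a β + c' d a η * dir d (fun x => jac τ x a β) η) := by
    intro d
    rw [dir_sum d fun a _ => (hc' d a).fun_mul (hjd a β)]
    exact Finset.sum_congr rfl fun a _ => dir_mul d (hc' d a) (hjd a β)
  simp only [hd, Finset.sum_add_distrib] at hp
  rw [mul_sub, ← h1 β, ← hp]
  simp only [mul_sub, Finset.sum_sub_distrib, Finset.mul_sum]
  have e : ∑ d, ∑ a, dir d (c' d a) η * jac τ η a β =
      ∑ a, ∑ d, jac τ η a β * dir d (c' d a) η := by
    rw [Finset.sum_comm]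
    exact Finset.sum_congr rfl fun c _ => Finset.sum_congr rfl fun α _ => by ring
  have e' : ∑ a, jac τ η a β * b' a = ∑ a, b' a * jac τ η a β :=
    Finset.sum_congr rfl fun c _ => mul_comm _ _
  rw [e, e']
  ring

/-! ### Fibre derivatives -/

theorem pd_add {f g : Coord → ℝ} {ξ : Coord} (hf : ContDiffAt ℝ ∞ f ξ) (hg : ContDiffAt ℝ ∞ g ξ)
    {m : ℕ} (α : Fin m → Fin 4) : pd α (fun x => f x + g x) ξ = pd α f ξ + pd α g ξ := by
  unfold pd
  have := iteratedFDeriv_add_apply (hf.of_le (natCast_le_infty m)) (hg.of_le (natCast_le_infty m))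
  rw [show (fun x => f x + g x) = f + g from rfl, this]
  rfl

theorem pd_const_mul {f : Coord → ℝ} {ξ : Coord} (c : ℝ) (hf : ContDiffAt ℝ ∞ f ξ)
    {m : ℕ} (α : Fin m → Fin 4) : pd α (fun x => c * f x) ξ = c * pd α f ξ := by
  unfold pd
  have := iteratedFDeriv_const_smul_apply (a := c) (hf.of_le (natCast_le_infty m))
  rw [show (fun x => c * f x) = c • f from rfl, this]
  rfl

/-- The coordinate `z_{μνα₁…α_m}` as a linear function on the coordinate space. -/
def evz {k m : ℕ} (hm : m ≤ k) (μ ν : Fin 4) (α : Fin m → Fin 4) : JetModel k →L[ℝ] ℝ :=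
  LinearMap.toContinuousLinearMap
    { toFun := fun w => w.2.1 ⟨m, Nat.lt_succ_of_le hm⟩ μ ν α
      map_add' := fun _ _ => rfl
      map_smul' := fun _ _ => rfl }

theorem evz_apply {k m : ℕ} (hm : m ≤ k) (μ ν : Fin 4) (α : Fin m → Fin 4) (w : JetModel k) :
    evz hm μ ν α w = w.2.1 ⟨m, Nat.lt_succ_of_le hm⟩ μ ν α := rfl

theorem jetModel_ext {k : ℕ} {w w' : JetModel k} (h1 : w.1 = w'.1)
    (h2 : ∀ (m : ℕ) (hm : m ≤ k) μ ν (α : Fin m → Fin 4), evz hm μ ν α w = evz hm μ ν α w') :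
    w = w' := by
  refine Prod.ext h1 (Subtype.ext ?_)
  funext m μ ν α
  exact h2 m (Nat.le_of_lt_succ m.2) μ ν α

theorem evz_perm {k m : ℕ} (hm : m ≤ k) (μ ν : Fin 4) (α : Fin m → Fin 4) (s : Equiv.Perm (Fin m))
    (w : JetModel k) : evz hm μ ν (α ∘ s) w = evz hm μ ν α w :=
  (w.2.2 ⟨m, Nat.lt_succ_of_le hm⟩ μ ν α).2 s

/-- The directions `symUnit` of the normalised partial derivatives span: an array is the sum of its
components times them, over all index values. -/
theorem sum_symUnit {k : ℕ} (z : JetFib k) :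
    z = ∑ m : Fin (k + 1), ∑ μ, ∑ ν, ∑ α : Fin m → Fin 4, z.1 m μ ν α • symUnit k μ ν α := by
  have hcard : ∀ (m : Fin (k + 1)) (μ ν : Fin 4) (α' : Fin m → Fin 4),
      ∑ α : Fin m → Fin 4, z.1 m μ ν α *
        ((Nat.card {s : Fin m ≃ Fin m // α ∘ s = α'} : ℝ) / ((m : ℕ).factorial : ℝ)) =
      z.1 m μ ν α' := by
    intro m μ ν α'
    have h1 : ∀ α : Fin m → Fin 4, (Nat.card {s : Fin m ≃ Fin m // α ∘ s = α'} : ℝ) =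
        ∑ s : Fin m ≃ Fin m, if α = α' ∘ s.symm then 1 else 0 := by
      intro α
      classical
      rw [Nat.card_eq_fintype_card, Fintype.card_subtype, Finset.sum_boole]
      congr 3
      ext s
      constructor
      · intro h; rw [← h]; funext i; simp
      · intro h; rw [h]; funext i; simp
    simp only [h1, Finset.sum_div, Finset.mul_sum]
    rw [Finset.sum_comm]
    have h2 : ∀ s : Fin m ≃ Fin m, ∑ α : Fin m → Fin 4, z.1 m μ ν α *
        ((if α = α' ∘ s.symm then (1 : ℝ) else 0) / ((m : ℕ).factorial : ℝ)) =
        z.1 m μ ν α' / ((m : ℕ).factorial : ℝ) := by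
      intro s
      rw [Finset.sum_eq_single (α' ∘ s.symm)]
      · rw [(z.2 m μ ν α').2 s.symm]; simp [div_eq_mul_inv]
      · intro b _ hb; simp [hb]
      · simp
    rw [Finset.sum_congr rfl fun s _ => h2 s, Finset.sum_const, Finset.card_univ,
      Fintype.card_perm, Fintype.card_fin, nsmul_eq_mul]
    have : ((m : ℕ).factorial : ℝ) ≠ 0 := by positivity
    field_simp
  refine Subtype.ext ?_
  funext m' μ' ν' α'
  simp only [Submodule.coe_sum, Finset.sum_apply, Submodule.coe_smul, Pi.smul_apply, smul_eq_mul]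
  rw [Finset.sum_eq_single m']
  · simp only [symUnit]
    have e : ∀ μ ν : Fin 4, ∑ α : Fin m' → Fin 4, z.1 m' μ ν α *
        (((if μ' = μ ∧ ν' = ν then 1 else 0) + (if μ' = ν ∧ ν' = μ then 1 else 0)) / 2 *
        ((Nat.card {s : Fin m' ≃ Fin m' // α ∘ s = α'} : ℝ) / ((m' : ℕ).factorial : ℝ))) =
        ((if μ' = μ ∧ ν' = ν then 1 else 0) + (if μ' = ν ∧ ν' = μ then 1 else 0)) / 2 *
          z.1 m' μ ν α' := by
      intro μ ν
      rw [← hcard m' μ ν α', Finset.mul_sum]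
      exact Finset.sum_congr rfl fun α _ => by ring
    simp only [e]
    have h1 : ∑ μ, ∑ ν, (if μ' = μ ∧ ν' = ν then (1 : ℝ) else 0) * z.1 m' μ ν α' =
        z.1 m' μ' ν' α' := by
      rw [Finset.sum_eq_single μ', Finset.sum_eq_single ν'] <;> simp +contextual [eq_comm]
    have h2 : ∑ μ, ∑ ν, (if μ' = ν ∧ ν' = μ then (1 : ℝ) else 0) * z.1 m' μ ν α' =
        z.1 m' ν' μ' α' := by
      rw [Finset.sum_eq_single ν', Finset.sum_eq_single μ'] <;> simp +contextual [eq_comm]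
    simp only [add_div, add_mul, Finset.sum_add_distrib, div_mul_eq_mul_div, ← Finset.sum_div]
    rw [h1, h2, (z.2 m' ν' μ' α').1]
    ring
  · intro m _ hm
    refine Finset.sum_eq_zero fun μ _ => Finset.sum_eq_zero fun ν _ =>
      Finset.sum_eq_zero fun α _ => ?_
    have : IsEmpty {s : Fin m' ≃ Fin m // α ∘ s = α'} :=
      ⟨fun s => hm (Fin.ext (by simpa using (Fintype.card_congr s.1).symm))⟩
    simp [symUnit]
  · simp

/-- The partial derivative of `L` with respect to `z_{μνα₁…α_m}` in coordinates, with the same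
normalisation as `partialZ`. -/
def coeffZ (L : JetModel 2 → ℝ) {m : ℕ} (μ ν : Fin 4) (α : Fin m → Fin 4) (w : JetModel 2) : ℝ :=
  fderiv ℝ L w (0, symUnit 2 μ ν α)

theorem coeffZ_swap (L : JetModel 2 → ℝ) (μ ν α β : Fin 4) (w : JetModel 2) :
    coeffZ L μ ν ![α, β] w = coeffZ L μ ν ![β, α] w := by
  unfold coeffZ
  congr 2
  refine Subtype.ext ?_
  funext m' μ' ν' α'
  simp only [symUnit]
  congr 3
  refine Nat.card_congr
    { toFun := fun s => ⟨s.1.trans (Equiv.swap 0 1), ?_⟩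
      invFun := fun s => ⟨s.1.trans (Equiv.swap 0 1), ?_⟩
      left_inv := fun s => by ext; simp
      right_inv := fun s => by ext; simp }
  all_goals
    refine Eq.trans (funext fun i => ?_) s.2
    simp only [Function.comp, Equiv.trans_apply]
    generalize s.1 i = t
    fin_cases t <;> simp

/-- The normalisation of the partial derivatives: the differential of `L` along the fibres is
`L^{μν} dy_{μν} + L^{μνα} dz_{μνα} + L^{μναβ} dz_{μναβ}`, summed over all index values. -/
theorem fderiv_fibre_eq_sum (L : JetModel 2 → ℝ) (w : JetModel 2) (z : JetFib 2) :
    fderiv ℝ L w (0, z) = ∑ μ, ∑ ν, (coeffZ L μ ν ![] w * z.1 0 μ ν ![] +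
      ∑ α, coeffZ L μ ν ![α] w * z.1 1 μ ν ![α] +
      ∑ α, ∑ β, coeffZ L μ ν ![α, β] w * z.1 2 μ ν ![α, β]) := by
  have e : ((0 : Coord), z) = LinearMap.inr ℝ Coord (JetFib 2) z := rfl
  conv_lhs => rw [e, sum_symUnit z]
  simp only [map_sum, map_smul, smul_eq_mul, Finset.sum_add_distrib]
  refine (Fin.sum_univ_three _).trans ?_
  have h0 : ∀ F : (Fin 0 → Fin 4) → ℝ, ∑ α, F α = F ![] := fun F => by
    rw [Fintype.sum_unique]; congr 1
  have h1 : ∀ F : (Fin 1 → Fin 4) → ℝ, ∑ α, F α = ∑ a, F ![a] := fun F => by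
    rw [← (Equiv.funUnique (Fin 1) (Fin 4)).symm.sum_comp]
    refine Finset.sum_congr rfl fun a _ => congrArg F ?_
    funext i; fin_cases i; rfl
  have h2 : ∀ F : (Fin 2 → Fin 4) → ℝ, ∑ α, F α = ∑ a, ∑ b, F ![a, b] := fun F => by
    rw [← (finTwoArrowEquiv (Fin 4)).symm.sum_comp, Fintype.sum_prod_type]
    rfl
  congr 1
  · congr 1
    · refine Finset.sum_congr rfl fun μ _ => Finset.sum_congr rfl fun ν _ => ?_
      refine (h0 _).trans ?_
      exact mul_comm _ _
    · refine Finset.sum_congr rfl fun μ _ => Finset.sum_congr rfl fun ν _ => ?_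
      refine (h1 _).trans ?_
      exact Finset.sum_congr rfl fun a _ => mul_comm _ _
  · refine Finset.sum_congr rfl fun μ _ => Finset.sum_congr rfl fun ν _ => ?_
    refine (h2 _).trans ?_
    exact Finset.sum_congr rfl fun a _ => Finset.sum_congr rfl fun b _ => mul_comm _ _

/-- The array of derivatives of a smooth symmetric array `h` of functions. -/
def jetOf (k : ℕ) {h : Fin 4 → Fin 4 → Coord → ℝ} (hs : ∀ μ ν, ContDiff ℝ ∞ (h μ ν))
    (hsymm : ∀ μ ν, h μ ν = h ν μ) (ξ : Coord) : JetFib k :=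
  ⟨fun _ μ ν α => pd α (h μ ν) ξ, fun _ μ ν α => ⟨congrArg (fun u => pd α u ξ) (hsymm μ ν), fun s =>
    pd_perm isOpen_univ (hs μ ν).contDiffOn (Set.mem_univ ξ) α s⟩⟩

/-- The derivative of `L` along the fibres in the direction of the `2`-jet of `h`. -/
def fibOp (L : JetModel 2 → ℝ) (w : JetModel 2) (h : Fin 4 → Fin 4 → Coord → ℝ) (ξ : Coord) : ℝ :=
  ∑ μ, ∑ ν, (coeffZ L μ ν ![] w * h μ ν ξ + ∑ α, coeffZ L μ ν ![α] w * dir α (h μ ν) ξ +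
    ∑ α, ∑ β, coeffZ L μ ν ![α, β] w * dir α (dir β (h μ ν)) ξ)

/-- The coefficients `c^{αβ}` of the operator `f ↦ fibOp L w (f h)`. -/
def fibC (L : JetModel 2 → ℝ) (w : JetModel 2) (h : Fin 4 → Fin 4 → Coord → ℝ) (α β : Fin 4)
    (ξ : Coord) : ℝ :=
  ∑ μ, ∑ ν, coeffZ L μ ν ![α, β] w * h μ ν ξ

/-- The coefficients `b^α` of the operator `f ↦ fibOp L w (f h)`. -/
def fibB (L : JetModel 2 → ℝ) (w : JetModel 2) (h : Fin 4 → Fin 4 → Coord → ℝ) (α : Fin 4)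
    (ξ : Coord) : ℝ :=
  ∑ μ, ∑ ν, (coeffZ L μ ν ![α] w * h μ ν ξ +
    2 * ∑ β, coeffZ L μ ν ![α, β] w * dir β (h μ ν) ξ)

theorem fibC_swap (L : JetModel 2 → ℝ) (w : JetModel 2) (h : Fin 4 → Fin 4 → Coord → ℝ)
    (α β : Fin 4) (ξ : Coord) : fibC L w h α β ξ = fibC L w h β α ξ := by
  unfold fibC
  simp only [coeffZ_swap L _ _ α β]

theorem dir_dir_mul {f g : Coord → ℝ} {ξ : Coord} (hf : ContDiffAt ℝ ∞ f ξ)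
    (hg : ContDiffAt ℝ ∞ g ξ) (α β : Fin 4) :
    dir α (dir β fun x => f x * g x) ξ = dir α (dir β f) ξ * g ξ + dir β f ξ * dir α g ξ +
      (dir α f ξ * dir β g ξ + f ξ * dir α (dir β g) ξ) := by
  have e : (dir β fun x => f x * g x) =ᶠ[𝓝 ξ] fun x => dir β f x * g x + f x * dir β g x := by
    filter_upwards [(hf.of_le one_le_infty).eventually (by simp),
      (hg.of_le one_le_infty).eventually (by simp)] with x hx hx'
    exact dir_mul β (hx.differentiableAt one_ne_zero) (hx'.differentiableAt one_ne_zero)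
  have d : ∀ {u : Coord → ℝ}, ContDiffAt ℝ ∞ u ξ → DifferentiableAt ℝ u ξ := fun hu =>
    hu.differentiableAt (by simp)
  have hf' := d (contDiffAt_dir hf β)
  have hg' := d (contDiffAt_dir hg β)
  rw [dir_congr e, dir_add α (hf'.fun_mul (d hg)) ((d hf).fun_mul hg'), dir_mul α hf' (d hg),
    dir_mul α (d hf) hg']

/-- The Leibniz rule: `f ↦ fibOp L w (f h)` is a second-order operator. -/
theorem fibOp_mul (L : JetModel 2 → ℝ) (w : JetModel 2) {h : Fin 4 → Fin 4 → Coord → ℝ}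
    {f : Coord → ℝ} {ξ : Coord} (hf : ContDiffAt ℝ ∞ f ξ) (hh : ∀ μ ν, ContDiffAt ℝ ∞ (h μ ν) ξ) :
    fibOp L w (fun μ ν x => f x * h μ ν x) ξ = f ξ * fibOp L w h ξ +
      ∑ α, dir α f ξ * fibB L w h α ξ + ∑ α, ∑ β, dir α (dir β f) ξ * fibC L w h α β ξ := by
  have d : ∀ {u : Coord → ℝ}, ContDiffAt ℝ ∞ u ξ → DifferentiableAt ℝ u ξ := fun hu =>
    hu.differentiableAt (by simp)
  have e1 : ∑ α, dir α f ξ * fibB L w h α ξ = ∑ μ, ∑ ν, ∑ α, dir α f ξ *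
      (coeffZ L μ ν ![α] w * h μ ν ξ + 2 * ∑ β, coeffZ L μ ν ![α, β] w * dir β (h μ ν) ξ) := by
    have e : ∀ α, dir α f ξ * fibB L w h α ξ = ∑ μ, ∑ ν, dir α f ξ *
        (coeffZ L μ ν ![α] w * h μ ν ξ + 2 * ∑ β, coeffZ L μ ν ![α, β] w * dir β (h μ ν) ξ) := by
      intro α
      rw [fibB, Finset.mul_sum]
      exact Finset.sum_congr rfl fun μ _ => Finset.mul_sum _ _ _
    rw [Finset.sum_congr rfl fun α _ => e α, Finset.sum_comm]
    exact Finset.sum_congr rfl fun μ _ => Finset.sum_comm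
  have e2 : ∑ α, ∑ β, dir α (dir β f) ξ * fibC L w h α β ξ = ∑ μ, ∑ ν, ∑ α, ∑ β,
      dir α (dir β f) ξ * (coeffZ L μ ν ![α, β] w * h μ ν ξ) := by
    have e : ∀ α β, dir α (dir β f) ξ * fibC L w h α β ξ = ∑ μ, ∑ ν,
        dir α (dir β f) ξ * (coeffZ L μ ν ![α, β] w * h μ ν ξ) := by
      intro α β
      rw [fibC, Finset.mul_sum]
      exact Finset.sum_congr rfl fun μ _ => Finset.mul_sum _ _ _
    simp only [e]
    rw [Finset.sum_congr rfl fun α _ => Finset.sum_comm, Finset.sum_comm]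
    refine Finset.sum_congr rfl fun μ _ => ?_
    rw [Finset.sum_congr rfl fun α _ => Finset.sum_comm, Finset.sum_comm]
  rw [e1, e2]
  simp only [fibOp, Finset.mul_sum (s := Finset.univ) (a := f ξ), ← Finset.sum_add_distrib]
  refine Finset.sum_congr rfl fun μ _ => Finset.sum_congr rfl fun ν _ => ?_
  simp only [fun α => dir_mul α (d hf) (d (hh μ ν)), fun α β => dir_dir_mul hf (hh μ ν) α β]
  simp only [mul_add, Finset.mul_sum, Finset.sum_add_distrib]
  -- the two cross terms agree by the symmetry of the coefficients
  have e3 : ∑ α, ∑ β, coeffZ L μ ν ![α, β] w * (dir β f ξ * dir α (h μ ν) ξ) =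
      ∑ α, ∑ β, coeffZ L μ ν ![α, β] w * (dir α f ξ * dir β (h μ ν) ξ) := by
    rw [Finset.sum_comm]
    exact Finset.sum_congr rfl fun α _ => Finset.sum_congr rfl fun β _ => by rw [coeffZ_swap]
  have e4 : ∑ α, ∑ β, dir α f ξ * (2 * (coeffZ L μ ν ![α, β] w * dir β (h μ ν) ξ)) =
      2 * ∑ α, ∑ β, coeffZ L μ ν ![α, β] w * (dir α f ξ * dir β (h μ ν) ξ) := by
    simp only [Finset.mul_sum]
    exact Finset.sum_congr rfl fun α _ => Finset.sum_congr rfl fun β _ => by ring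
  have e5 : ∑ α, ∑ β, coeffZ L μ ν ![α, β] w * (dir α (dir β f) ξ * h μ ν ξ) =
      ∑ α, ∑ β, dir α (dir β f) ξ * (coeffZ L μ ν ![α, β] w * h μ ν ξ) :=
    Finset.sum_congr rfl fun α _ => Finset.sum_congr rfl fun β _ => by ring
  have e6 : ∑ α, coeffZ L μ ν ![α] w * (dir α f ξ * h μ ν ξ) =
      ∑ α, dir α f ξ * (coeffZ L μ ν ![α] w * h μ ν ξ) :=
    Finset.sum_congr rfl fun α _ => by ring
  have e7 : ∑ α, coeffZ L μ ν ![α] w * (f ξ * dir α (h μ ν) ξ) =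
      ∑ α, f ξ * (coeffZ L μ ν ![α] w * dir α (h μ ν) ξ) :=
    Finset.sum_congr rfl fun α _ => by ring
  have e8 : ∑ α, ∑ β, coeffZ L μ ν ![α, β] w * (f ξ * dir α (dir β (h μ ν)) ξ) =
      ∑ α, ∑ β, f ξ * (coeffZ L μ ν ![α, β] w * dir α (dir β (h μ ν)) ξ) :=
    Finset.sum_congr rfl fun α _ => Finset.sum_congr rfl fun β _ => by ring
  rw [e3, e4, e5, e6, e7, e8]
  ring

/-- The derivative of `L` in the direction of an array `z` that is the `2`-jet of `h` is `fibOp`. -/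
theorem fderiv_jetOf (L : JetModel 2 → ℝ) (w : JetModel 2) {h : Fin 4 → Fin 4 → Coord → ℝ}
    {ξ : Coord} (hh : ∀ μ ν, ContDiffAt ℝ ∞ (h μ ν) ξ) {z : JetFib 2}
    (hz : ∀ (m : ℕ) (hm : m ≤ 2) (μ ν : Fin 4) (α : Fin m → Fin 4),
      z.1 ⟨m, Nat.lt_succ_of_le hm⟩ μ ν α = pd α (h μ ν) ξ) :
    fderiv ℝ L w (0, z) = fibOp L w h ξ := by
  rw [fderiv_fibre_eq_sum]
  unfold fibOp
  refine Finset.sum_congr rfl fun μ _ => Finset.sum_congr rfl fun ν _ => ?_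
  congr 1
  · congr 1
    · rw [← pd_zero (h μ ν) ξ ![], ← hz 0 (by norm_num)]
      rfl
    · refine Finset.sum_congr rfl fun α _ => ?_
      rw [← pd_one (hh μ ν), ← hz 1 (by norm_num)]
      rfl
  · refine Finset.sum_congr rfl fun α _ => Finset.sum_congr rfl fun β _ => ?_
    rw [← pd_two (hh μ ν), ← hz 2 (by norm_num)]
    rfl

section

/-! ### Sections and coordinate changes on the jet bundles -/

/-- The forgetful map in coordinates. -/
def truncate {k l : ℕ} (h : l ≤ k) (w : JetModel k) : JetModel l :=
  (w.1, ⟨fun m μ ν α => w.2.1 ⟨m, by omega⟩ μ ν α, fun m μ ν α => w.2.2 ⟨m, by omega⟩ μ ν α⟩)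

theorem contDiff_truncate {k l : ℕ} (h : l ≤ k) : ContDiff ℝ ∞ (truncate h) := by
  let T : JetModel k →ₗ[ℝ] JetModel l :=
    { toFun := truncate h
      map_add' := fun _ _ => rfl
      map_smul' := fun _ _ => rfl }
  exact T.toContinuousLinearMap.contDiff

/-- The value at `w` of the total derivative `∂/∂x^γ + z_{μνγ} ∂/∂y_{μν} + …`, as a tangent vector
of the jet space of one order less. -/
def totalDir {k : ℕ} (w : JetModel (k + 1)) (γ : Fin 4) : JetModel k :=
  (unitVec γ, ⟨fun m μ ν α => w.2.1 ⟨m + 1, by omega⟩ μ ν (Fin.snoc α γ), fun m μ ν α => by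
    refine ⟨(w.2.2 ⟨m + 1, by omega⟩ μ ν _).1, fun s => ?_⟩
    have e : ∀ α : Fin m → Fin 4, w.2.1 ⟨m + 1, by omega⟩ μ ν (Fin.snoc α γ) =
        w.2.1 ⟨m + 1, by omega⟩ μ ν (Fin.cons γ α) := fun α => by
      rw [Fin.snoc_eq_cons_rotate]
      exact (w.2.2 ⟨m + 1, by omega⟩ μ ν (Fin.cons γ α)).2 (finRotate _)
    refine (e _).trans (Eq.trans ?_ (e _).symm)
    rw [← (w.2.2 ⟨m + 1, by omega⟩ μ ν (Fin.cons γ α)).2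
      (Equiv.Perm.decomposeFin.symm (0, s))]
    refine congrArg (w.2.1 ⟨m + 1, by omega⟩ μ ν) (funext fun i => ?_)
    refine Fin.cases ?_ (fun i => ?_) i
    · simp
    · simp [Equiv.Perm.decomposeFin_symm_apply_succ]⟩)

theorem evz_totalDir {k m : ℕ} (hm : m ≤ k) (μ ν : Fin 4) (α : Fin m → Fin 4) (γ : Fin 4)
    (w : JetModel (k + 1)) :
    evz hm μ ν α (totalDir w γ) = evz (Nat.succ_le_succ hm) μ ν (Fin.snoc α γ) w := rfl

theorem evz_snoc {k m : ℕ} (hm : m + 1 ≤ k) (μ ν : Fin 4) (α : Fin m → Fin 4) (γ : Fin 4)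
    (w : JetModel k) : evz hm μ ν (Fin.snoc α γ) w = evz hm μ ν (Fin.cons γ α) w := by
  have h : (Fin.snoc α γ : Fin (m + 1) → Fin 4) =
      (Fin.cons γ α : Fin (m + 1) → Fin 4) ∘ finRotate (m + 1) := by
    rw [Fin.snoc_eq_cons_rotate]; rfl
  rw [h, evz_perm]

variable {M : Type*} [TopologicalSpace M] [ChartedSpace Coord M] [IsManifold (𝓡 4) ∞ M] {k : ℕ}

theorem LocalMetric.jet_of_mem {σ : LocalMetric M} {x : M} (hx : x ∈ σ.dom) :
    σ.jet k x = Jet.mk k ⟨σ, x, hx⟩ := by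
  unfold LocalMetric.jet
  rw [dif_pos hx]

theorem LocalMetric.base_jet (σ : LocalMetric M) (x : M) : (σ.jet k x).base = x := by
  unfold LocalMetric.jet
  split_ifs with h
  · rfl
  · exact Jet.base_default _ _

theorem Jet.base_forget {l : ℕ} (h : l ≤ k) (j : Jet k M) : (j.forget h).base = j.base := by
  induction j using Quotient.inductionOn with
  | h p => rfl

theorem LocalMetric.forget_jet {l : ℕ} (h : l ≤ k) {σ : LocalMetric M} {x : M} (hx : x ∈ σ.dom) :
    (σ.jet k x).forget h = σ.jet l x := by
  rw [jet_of_mem hx, jet_of_mem hx]; rfl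

theorem Jet.coord_fst (φ : SmoothChart M) {j : Jet k M} (hj : j.base ∈ φ.1.source) :
    (Jet.coord φ j).1 = φ.1 j.base := by
  induction j using Quotient.inductionOn with
  | h p => exact congrArg Prod.fst (coord_mk φ p hj)

theorem Jet.coord_forget {l : ℕ} (h : l ≤ k) (φ : SmoothChart M) {j : Jet k M}
    (hj : j.base ∈ φ.1.source) : Jet.coord φ (j.forget h) = truncate h (Jet.coord φ j) := by
  induction j using Quotient.inductionOn with
  | h p =>
    exact (coord_mk (k := l) φ p hj).trans (congrArg (truncate h) (coord_mk (k := k) φ p hj)).symm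

theorem Jet.ofCoord_coord (φ : SmoothChart M) {j : Jet k M} (hj : j.base ∈ φ.1.source) :
    Jet.ofCoord φ (Jet.coord φ j) = j :=
  (coordEquiv k φ).left_inv hj

theorem Jet.exists_section (j : Jet k M) : ∃ σ : LocalMetric M, j.base ∈ σ.dom ∧
    σ.jet k j.base = j := by
  induction j using Quotient.inductionOn with
  | h p => exact ⟨p.σ, p.mem, LocalMetric.jet_of_mem p.mem⟩

/-! ### The prolongation of a section in coordinates -/

/-- The prolongation `j^k σ` in the coordinates induced by `φ`. -/
def secCoord (k : ℕ) (φ : SmoothChart M) (σ : LocalMetric M) (ξ : Coord) : JetModel k :=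
  Jet.coord φ (σ.jet k (φ.1.symm ξ))

/-- The domain of a section in the coordinates `φ`. -/
def secDom (φ : SmoothChart M) (σ : LocalMetric M) : Set Coord := φ.1.target ∩ φ.1.symm ⁻¹' σ.dom

theorem isOpen_secDom (φ : SmoothChart M) (σ : LocalMetric M) : IsOpen (secDom φ σ) :=
  φ.1.isOpen_inter_preimage_symm σ.isOpen_dom

theorem mem_secDom {φ : SmoothChart M} {σ : LocalMetric M} {x : M} (hx : x ∈ σ.dom)
    (hφ : x ∈ φ.1.source) : φ.1 x ∈ secDom φ σ :=
  ⟨φ.1.map_source hφ, by simpa [φ.1.left_inv hφ] using hx⟩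

theorem secCoord_eq (φ : SmoothChart M) (σ : LocalMetric M) {ξ : Coord} (hξ : ξ ∈ secDom φ σ) :
    secCoord k φ σ ξ = (φ.1 (φ.1.symm ξ),
      Jet.fibCoord k φ ⟨σ, φ.1.symm ξ, hξ.2⟩ (φ.1.map_target hξ.1)) := by
  unfold secCoord
  rw [LocalMetric.jet_of_mem hξ.2, Jet.coord_mk φ _ (φ.1.map_target hξ.1)]

theorem secCoord_fst (φ : SmoothChart M) (σ : LocalMetric M) {ξ : Coord} (hξ : ξ ∈ secDom φ σ) :
    (secCoord k φ σ ξ).1 = ξ := by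
  rw [secCoord_eq φ σ hξ]; exact φ.1.right_inv hξ.1

theorem evz_secCoord (φ : SmoothChart M) (σ : LocalMetric M) {ξ : Coord} (hξ : ξ ∈ secDom φ σ)
    {m : ℕ} (hm : m ≤ k) (μ ν : Fin 4) (α : Fin m → Fin 4) :
    evz hm μ ν α (secCoord k φ σ ξ) = pd α (metricComp φ.1 σ.g μ ν) ξ := by
  rw [secCoord_eq φ σ hξ]
  show pd α (metricComp φ.1 σ.g μ ν) (φ.1 (φ.1.symm ξ)) = _
  rw [φ.1.right_inv hξ.1]

theorem contDiffOn_secCoord (φ : SmoothChart M) (σ : LocalMetric M) :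
    ContDiffOn ℝ ∞ (secCoord k φ σ) (secDom φ σ) := by
  refine (contDiffOn_prod_iff _).2 ⟨contDiffOn_id.congr fun ξ hξ => secCoord_fst φ σ hξ,
    (Jet.contDiffOn_subtype_iff (JetFib k)).2 ?_⟩
  refine contDiffOn_pi.2 fun m => contDiffOn_pi.2 fun μ => contDiffOn_pi.2 fun ν =>
    contDiffOn_pi.2 fun α => ?_
  have h : ContDiffOn ℝ ∞ (fun ξ => pd α (metricComp φ.1 σ.g μ ν) ξ) (secDom φ σ) := by
    intro ξ hξ
    have h1 : ContDiffAt ℝ ∞ (metricComp φ.1 σ.g μ ν) ξ :=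
      (σ.smooth φ μ ν).contDiffAt ((isOpen_secDom φ σ).mem_nhds hξ)
    have h2 := h1.iteratedFDeriv_right (m := ∞) (i := m) (infty_add_le m)
    exact ((ContinuousMultilinearMap.apply ℝ (fun _ : Fin m => Coord) ℝ
      (fun i => unitVec (α i))).contDiff.contDiffAt.comp ξ h2).contDiffWithinAt
  exact h.congr fun ξ hξ => evz_secCoord φ σ hξ (Nat.le_of_lt_succ m.2) μ ν α

theorem hasFDerivAt_secCoord (φ : SmoothChart M) (σ : LocalMetric M) {ξ : Coord}
    (hξ : ξ ∈ secDom φ σ) : HasFDerivAt (secCoord k φ σ) (fderiv ℝ (secCoord k φ σ) ξ) ξ :=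
  (((contDiffOn_secCoord (k := k) φ σ).contDiffAt
    ((isOpen_secDom φ σ).mem_nhds hξ)).differentiableAt (by simp)).hasFDerivAt

theorem fderiv_secCoord_fst (φ : SmoothChart M) (σ : LocalMetric M) {ξ : Coord}
    (hξ : ξ ∈ secDom φ σ) (v : Coord) : (fderiv ℝ (secCoord k φ σ) ξ v).1 = v := by
  have h := (ContinuousLinearMap.fst ℝ Coord (JetFib k)).hasFDerivAt.comp ξ
    (hasFDerivAt_secCoord (k := k) φ σ hξ)
  have e : ((ContinuousLinearMap.fst ℝ Coord (JetFib k)) ∘ secCoord k φ σ) =ᶠ[𝓝 ξ] id := by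
    filter_upwards [(isOpen_secDom φ σ).mem_nhds hξ] with x hx using secCoord_fst φ σ hx
  have h' := (h.congr_of_eventuallyEq e.symm).unique (hasFDerivAt_id ξ)
  exact congrArg (fun L : Coord →L[ℝ] Coord => L v) h'

/-- The derivative of a prolonged section is given by the total derivatives. -/
theorem fderiv_secCoord (φ : SmoothChart M) (σ : LocalMetric M) {ξ : Coord}
    (hξ : ξ ∈ secDom φ σ) (γ : Fin 4) :
    fderiv ℝ (secCoord k φ σ) ξ (unitVec γ) = totalDir (secCoord (k + 1) φ σ ξ) γ := by
  refine jetModel_ext (fderiv_secCoord_fst φ σ hξ _) fun m hm μ ν α => ?_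
  have h := (evz hm μ ν α).hasFDerivAt.comp ξ (hasFDerivAt_secCoord (k := k) φ σ hξ)
  have e : (evz hm μ ν α ∘ secCoord k φ σ) =ᶠ[𝓝 ξ] pd α (metricComp φ.1 σ.g μ ν) := by
    filter_upwards [(isOpen_secDom φ σ).mem_nhds hξ] with x hx using evz_secCoord φ σ hx hm μ ν α
  have h' := (h.congr_of_eventuallyEq e.symm).fderiv
  have hs : ContDiffAt ℝ ∞ (metricComp φ.1 σ.g μ ν) ξ :=
    (σ.smooth φ μ ν).contDiffAt ((isOpen_secDom φ σ).mem_nhds hξ)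
  rw [evz_totalDir, evz_snoc, evz_secCoord φ σ hξ, pd_cons hs, dir, h']
  rfl

/-! ### Coordinate changes -/

/-- The components in new coordinates of a symmetric array `h`, with `τ` expressing the old
coordinates through the new ones. -/
def pull (τ : Coord → Coord) (h : Fin 4 → Fin 4 → Coord → ℝ) (μ ν : Fin 4) (η : Coord) : ℝ :=
  ∑ a, ∑ b, (jac τ η μ a * jac τ η ν b) * h a b (τ η)

theorem contDiffAt_pull {τ : Coord → Coord} {η : Coord} (hτ : ContDiffAt ℝ ∞ τ η)
    {h : Fin 4 → Fin 4 → Coord → ℝ} (hh : ∀ a b, ContDiffAt ℝ ∞ (h a b) (τ η)) (μ ν : Fin 4) :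
    ContDiffAt ℝ ∞ (pull τ h μ ν) η :=
  ContDiffAt.sum fun a _ => ContDiffAt.sum fun b _ =>
    ((contDiffAt_jac hτ μ a).mul (contDiffAt_jac hτ ν b)).mul ((hh a b).comp η hτ)

theorem pull_mul (τ : Coord → Coord) (f : Coord → ℝ) (h : Fin 4 → Fin 4 → Coord → ℝ)
    (μ ν : Fin 4) (η : Coord) :
    pull τ (fun a b x => f x * h a b x) μ ν η = f (τ η) * pull τ h μ ν η := by
  simp only [pull, Finset.mul_sum]
  exact Finset.sum_congr rfl fun a _ => Finset.sum_congr rfl fun b _ => by ring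

/-- The derivatives of the transformed components depend only on the jet of the components. -/
theorem pd_pull_congr {τ : Coord → Coord} {U : Set Coord} (hU : IsOpen U)
    (hτ : ContDiffOn ℝ ∞ τ U) {η : Coord} (hη : η ∈ U) {h h' : Fin 4 → Fin 4 → Coord → ℝ}
    (hh : ∀ a b, ContDiff ℝ ∞ (h a b)) (hh' : ∀ a b, ContDiff ℝ ∞ (h' a b))
    (e : ∀ a b, ∀ m ≤ k, ∀ α : Fin m → Fin 4, pd α (h a b) (τ η) = pd α (h' a b) (τ η)) {m : ℕ}
    (hm : m ≤ k) (α : Fin m → Fin 4) (μ ν : Fin 4) :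
    pd α (pull τ h μ ν) η = pd α (pull τ h' μ ν) η := by
  have hτη : ContDiffAt ℝ ∞ τ η := hτ.contDiffAt (hU.mem_nhds hη)
  have hjac : ∀ a b, ContDiffOn ℝ ∞ (fun x => jac τ x μ a * jac τ x ν b) U := fun a b x hx =>
    ((contDiffAt_jac (hτ.contDiffAt (hU.mem_nhds hx)) μ a).mul
      (contDiffAt_jac (hτ.contDiffAt (hU.mem_nhds hx)) ν b)).contDiffWithinAt
  have hd : ∀ a b, ContDiff ℝ ∞ (fun x => h a b x + (-1) * h' a b x) := fun a b =>
    (hh a b).add (contDiff_const.mul (hh' a b))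
  have hz : ∀ a b, ∀ m ≤ k, iteratedFDeriv ℝ m (fun x => h a b x + (-1) * h' a b x) (τ η) = 0 := by
    intro a b m hm
    refine iteratedFDeriv_eq_zero_of_pd fun α => ?_
    rw [pd_add (hh a b).contDiffAt (contDiff_const.mul (hh' a b)).contDiffAt,
      pd_const_mul _ (hh' a b).contDiffAt, e a b m hm α]
    ring
  have h0 : ∀ a b, iteratedFDeriv ℝ m (fun x => (jac τ x μ a * jac τ x ν b) *
      (h a b (τ x) + (-1) * h' a b (τ x))) η = 0 := fun a b =>
    jet_zero_mul_comp hU isOpen_univ hτ (hjac a b) (hd a b).contDiffOn (Set.mapsTo_univ _ _) hη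
      (hz a b) m hm
  have hs : pd α (fun x => ∑ p : Fin 4 × Fin 4, (jac τ x μ p.1 * jac τ x ν p.2) *
      (h p.1 p.2 (τ x) + (-1) * h' p.1 p.2 (τ x))) η = 0 := by
    unfold pd
    rw [iteratedFDeriv_fun_sum_apply]
    · rw [Finset.sum_eq_zero fun p _ => h0 p.1 p.2]; rfl
    · intro p _
      exact ((((hjac p.1 p.2).mul ((hd p.1 p.2).comp_contDiffOn hτ)).contDiffAt
        (hU.mem_nhds hη))).of_le (natCast_le_infty m)
  have he : (fun x => ∑ p : Fin 4 × Fin 4, (jac τ x μ p.1 * jac τ x ν p.2) *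
      (h p.1 p.2 (τ x) + (-1) * h' p.1 p.2 (τ x))) =
      fun x => pull τ h μ ν x + (-1) * pull τ h' μ ν x := by
    funext x
    simp only [pull, Fintype.sum_prod_type, Finset.mul_sum, ← Finset.sum_add_distrib]
    exact Finset.sum_congr rfl fun a _ => Finset.sum_congr rfl fun b _ => by ring
  have hp' := contDiffAt_pull hτη (fun a b => (hh' a b).contDiffAt) μ ν
  rw [he, pd_add (contDiffAt_pull hτη (fun a b => (hh a b).contDiffAt) μ ν)
    (contDiffAt_const.mul hp'), pd_const_mul _ hp'] at hs
  linarith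

/-- The coordinate change on `M` from `ψ` to `φ`. -/
def baseTrans (φ ψ : SmoothChart M) : Coord → Coord := φ.1 ∘ ψ.1.symm

theorem mem_trans_source {φ ψ : SmoothChart M} {x : M} (hφ : x ∈ φ.1.source)
    (hψ : x ∈ ψ.1.source) : ψ.1 x ∈ (ψ.1.symm ≫ₕ φ.1).source := by
  simp [ψ.1.map_source hψ, ψ.1.left_inv hψ, hφ]

theorem contDiffAt_baseTrans (φ ψ : SmoothChart M) {η : Coord}
    (hη : η ∈ (ψ.1.symm ≫ₕ φ.1).source) : ContDiffAt ℝ ∞ (baseTrans φ ψ) η :=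
  (φ.contDiffOn_trans ψ).contDiffAt ((ψ.1.symm ≫ₕ φ.1).open_source.mem_nhds hη)

theorem baseTrans_apply (φ ψ : SmoothChart M) {x : M} (hψ : x ∈ ψ.1.source) :
    baseTrans φ ψ (ψ.1 x) = φ.1 x := by
  simp [baseTrans, ψ.1.left_inv hψ]

theorem metricComp_eq_pull (φ ψ : SmoothChart M)
    (g : ∀ x : M, LinearMap.BilinForm ℝ (TangentSpace (𝓡 4) x)) (μ ν : Fin 4) {η : Coord}
    (hη : η ∈ (ψ.1.symm ≫ₕ φ.1).source) :
    metricComp ψ.1 g μ ν η = pull (baseTrans φ ψ) (metricComp φ.1 g) μ ν η :=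
  metricComp_trans φ ψ g μ ν hη

/-- The coordinate change on `J^k(M, N)` from `φ` to `ψ`. -/
def jetTrans (k : ℕ) (φ ψ : SmoothChart M) (w : JetModel k) : JetModel k :=
  Jet.coord ψ (Jet.ofCoord φ w)

/-- The domain of the coordinate change `jetTrans`. -/
def jetTransDom (k : ℕ) (φ ψ : SmoothChart M) : Set (JetModel k) :=
  {w | w ∈ Jet.coordTarget k φ ∧ φ.1.symm w.1 ∈ ψ.1.source}

theorem jetTransDom_eq (φ ψ : SmoothChart M) : jetTransDom k φ ψ =
    ((Jet.coordEquiv k φ).symm.trans (Jet.coordEquiv k ψ)).source := by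
  ext w
  rw [Jet.coordEquiv_trans_source]
  refine ⟨fun h => ⟨h.1, ?_⟩, fun h => ⟨h.1, ?_⟩⟩
  · simpa using And.intro h.1.1 h.2
  · exact (show w.1 ∈ φ.1.target ∧ φ.1.symm w.1 ∈ ψ.1.source by simpa using h.2).2

theorem isOpen_jetTransDom (φ ψ : SmoothChart M) : IsOpen (jetTransDom k φ ψ) := by
  rw [jetTransDom_eq]; exact Jet.isOpen_trans_source φ ψ

theorem contDiffOn_jetTrans (φ ψ : SmoothChart M) :
    ContDiffOn ℝ ∞ (jetTrans k φ ψ) (jetTransDom k φ ψ) := by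
  rw [jetTransDom_eq]; exact Jet.contDiffOn_coord_trans φ ψ

theorem hasFDerivAt_jetTrans (φ ψ : SmoothChart M) {w : JetModel k} (hw : w ∈ jetTransDom k φ ψ) :
    HasFDerivAt (jetTrans k φ ψ) (fderiv ℝ (jetTrans k φ ψ) w) w :=
  (((contDiffOn_jetTrans φ ψ).contDiffAt ((isOpen_jetTransDom φ ψ).mem_nhds hw)).differentiableAt
    (by simp)).hasFDerivAt

theorem jetTrans_fst (φ ψ : SmoothChart M) {w : JetModel k} (hw : w ∈ jetTransDom k φ ψ) :
    (jetTrans k φ ψ w).1 = ψ.1 (φ.1.symm w.1) := by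
  have hb : (Jet.ofCoord φ w).base ∈ ψ.1.source := by rw [Jet.base_ofCoord]; exact hw.2
  unfold jetTrans
  rw [Jet.coord_fst ψ hb, Jet.base_ofCoord]

theorem evz_jetTrans (φ ψ : SmoothChart M) {w : JetModel k} (hw : w ∈ jetTransDom k φ ψ) {m : ℕ}
    (hm : m ≤ k) (μ ν : Fin 4) (α : Fin m → Fin 4) :
    evz hm μ ν α (jetTrans k φ ψ w) =
      pd α (pull (baseTrans φ ψ) (taylor w) μ ν) (ψ.1 (φ.1.symm w.1)) := by
  have hη := mem_trans_source (φ := φ) (φ.1.map_target hw.1.1) hw.2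
  have h1 : jetTrans k φ ψ w = (ψ.1 (φ.1.symm w.1),
      Jet.fibCoord k ψ ⟨taylorMetric φ w, _, Jet.taylorMetric_mem hw.1⟩ hw.2) := by
    unfold jetTrans Jet.ofCoord
    rw [dif_pos hw.1, Jet.coord_mk ψ _ hw.2]
  rw [h1]
  show pd α (metricComp ψ.1 (taylorForm φ w) μ ν) (ψ.1 (φ.1.symm w.1)) = _
  unfold pd
  refine congrArg (fun L : Coord [×m]→L[ℝ] ℝ => L fun i => unitVec (α i))
    (Filter.EventuallyEq.iteratedFDeriv ℝ ?_ m).self_of_nhds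
  filter_upwards [(ψ.1.symm ≫ₕ φ.1).open_source.mem_nhds hη] with η hη
  have h2 : η ∈ ψ.1.target ∧ ψ.1.symm η ∈ φ.1.source := by simpa using hη
  rw [metricComp_eq_pull φ ψ _ μ ν hη]
  refine Finset.sum_congr rfl fun a _ => Finset.sum_congr rfl fun b _ => ?_
  rw [show baseTrans φ ψ η = φ.1 (ψ.1.symm η) from rfl,
    metricComp_taylorForm φ w a b (φ.1.map_source h2.2)]

theorem taylor_add_smul (w : JetModel k) (δ : JetFib k) (t : ℝ) (μ ν : Fin 4) (η : Coord) :
    taylor (w + t • ((0 : Coord), δ)) μ ν η = taylor w μ ν η + t * taylor (w.1, δ) μ ν η := by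
  unfold taylor
  rw [Finset.mul_sum, ← Finset.sum_add_distrib]
  refine Finset.sum_congr rfl fun m _ => ?_
  have e1 : (w + t • ((0 : Coord), δ)).1 = w.1 := by simp
  have e2 : ∀ α, (w + t • ((0 : Coord), δ)).2.1 m μ ν α = w.2.1 m μ ν α + t * δ.1 m μ ν α :=
    fun α => rfl
  simp only [e1, e2, Finset.mul_sum, ← Finset.sum_add_distrib]
  exact Finset.sum_congr rfl fun α _ => by ring

/-- The derivative of a coordinate change on `J^k(M, N)` along the fibres: the array of derivatives
of a field `h` goes to the array of derivatives of the transformed field. -/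
theorem fderiv_jetTrans_vertical (φ ψ : SmoothChart M) {w : JetModel k}
    (hw : w ∈ jetTransDom k φ ψ) (δ : JetFib k) :
    (fderiv ℝ (jetTrans k φ ψ) w (0, δ)).1 = 0 ∧
    ∀ (m : ℕ) (hm : m ≤ k) (μ ν : Fin 4) (α : Fin m → Fin 4),
      evz hm μ ν α (fderiv ℝ (jetTrans k φ ψ) w (0, δ)) =
        pd α (pull (baseTrans φ ψ) (taylor (w.1, δ)) μ ν) (ψ.1 (φ.1.symm w.1)) := by
  have hη := mem_trans_source (φ := φ) (φ.1.map_target hw.1.1) hw.2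
  have hτ := contDiffAt_baseTrans φ ψ hη
  have hline : HasDerivAt (fun t : ℝ => w + t • ((0 : Coord), δ)) ((0 : Coord), δ) 0 := by
    simpa using ((hasDerivAt_id (0 : ℝ)).smul_const ((0 : Coord), δ)).const_add w
  have hw0 : w + (0 : ℝ) • ((0 : Coord), δ) = w := by simp
  have hcomp : HasDerivAt (fun t : ℝ => jetTrans k φ ψ (w + t • ((0 : Coord), δ)))
      (fderiv ℝ (jetTrans k φ ψ) w (0, δ)) 0 := by
    have h := hasFDerivAt_jetTrans φ ψ hw
    rw [← hw0] at h
    have := h.comp_hasDerivAt (0 : ℝ) hline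
    rw [hw0] at this
    exact this
  have hev : ∀ᶠ t : ℝ in 𝓝 0, w + t • ((0 : Coord), δ) ∈ jetTransDom k φ ψ := by
    have := hline.continuousAt
    apply this.preimage_mem_nhds
    rw [hw0]
    exact (isOpen_jetTransDom φ ψ).mem_nhds hw
  have hfst : ∀ t : ℝ, (w + t • ((0 : Coord), δ)).1 = w.1 := fun t => by simp
  refine ⟨?_, fun m hm μ ν α => ?_⟩
  · have h := (ContinuousLinearMap.fst ℝ Coord (JetFib k)).hasFDerivAt.comp_hasDerivAt (0 : ℝ) hcomp
    have e : ((ContinuousLinearMap.fst ℝ Coord (JetFib k)) ∘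
        fun t : ℝ => jetTrans k φ ψ (w + t • ((0 : Coord), δ))) =ᶠ[𝓝 0]
        fun _ => ψ.1 (φ.1.symm w.1) := by
      filter_upwards [hev] with t ht
      rw [← hfst t]
      exact jetTrans_fst φ ψ ht
    exact (h.congr_of_eventuallyEq e.symm).unique (hasDerivAt_const _ _)
  · have h := (evz hm μ ν α).hasFDerivAt.comp_hasDerivAt (0 : ℝ) hcomp
    have hs : ∀ w' : JetModel k, ContDiffAt ℝ ∞ (pull (baseTrans φ ψ) (taylor w') μ ν)
        (ψ.1 (φ.1.symm w.1)) := fun w' =>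
      contDiffAt_pull hτ (fun a b => (contDiff_taylor_right w' a b).contDiffAt) μ ν
    have e : (evz hm μ ν α ∘ fun t : ℝ => jetTrans k φ ψ (w + t • ((0 : Coord), δ))) =ᶠ[𝓝 0]
        fun t => pd α (pull (baseTrans φ ψ) (taylor w) μ ν) (ψ.1 (φ.1.symm w.1)) +
          t * pd α (pull (baseTrans φ ψ) (taylor (w.1, δ)) μ ν) (ψ.1 (φ.1.symm w.1)) := by
      filter_upwards [hev] with t ht
      refine (evz_jetTrans φ ψ ht hm μ ν α).trans ?_
      rw [hfst t, ← pd_const_mul t (hs (w.1, δ)), ← pd_add (hs w) (contDiffAt_const.mul (hs _))]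
      congr 1
      funext η
      simp only [pull, taylor_add_smul, Finset.mul_sum, ← Finset.sum_add_distrib]
      exact Finset.sum_congr rfl fun a _ => Finset.sum_congr rfl fun b _ => by ring
    have hr : HasDerivAt (fun t : ℝ => pd α (pull (baseTrans φ ψ) (taylor w) μ ν)
        (ψ.1 (φ.1.symm w.1)) +
          t * pd α (pull (baseTrans φ ψ) (taylor (w.1, δ)) μ ν) (ψ.1 (φ.1.symm w.1)))
        (pd α (pull (baseTrans φ ψ) (taylor (w.1, δ)) μ ν) (ψ.1 (φ.1.symm w.1))) 0 := by
      simpa using ((hasDerivAt_id (0 : ℝ)).mul_const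
        (pd α (pull (baseTrans φ ψ) (taylor (w.1, δ)) μ ν) (ψ.1 (φ.1.symm w.1)))).const_add
        (pd α (pull (baseTrans φ ψ) (taylor w) μ ν) (ψ.1 (φ.1.symm w.1)))
    exact (h.congr_of_eventuallyEq e.symm).unique hr

/-- Coordinate changes map prolonged sections to prolonged sections. -/
theorem jetTrans_secCoord (φ ψ : SmoothChart M) (σ : LocalMetric M) {η : Coord}
    (hη : η ∈ (ψ.1.symm ≫ₕ φ.1).source) :
    jetTrans k φ ψ (secCoord k φ σ (baseTrans φ ψ η)) = secCoord k ψ σ η := by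
  have h2 : η ∈ ψ.1.target ∧ ψ.1.symm η ∈ φ.1.source := by simpa using hη
  have e : φ.1.symm (baseTrans φ ψ η) = ψ.1.symm η := φ.1.left_inv h2.2
  unfold jetTrans secCoord
  rw [e, Jet.ofCoord_coord φ (by rw [LocalMetric.base_jet]; exact h2.2)]

end

section

/-! ### The boundary current of the first variation -/

/-- The function `p^{μνα}` on `J³(M, N)` in coordinates. -/
def momentum₁ (L : JetModel 2 → ℝ) (μ ν α : Fin 4) (w : JetModel 3) : ℝ :=
  coeffZ L μ ν ![α] (truncate (by norm_num) w) -
    ∑ β, fderiv ℝ (coeffZ L μ ν ![α, β]) (truncate (by norm_num) w) (totalDir w β)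

/-- The function `p^{μναβ}` on `J³(M, N)` in coordinates. -/
def momentum₂ (L : JetModel 2 → ℝ) (μ ν α β : Fin 4) (w : JetModel 3) : ℝ :=
  coeffZ L μ ν ![α, β] (truncate (by norm_num) w)

/-- The boundary current `p^{μναβ} h_{μν,α} + p^{μνβ} h_{μν}` of the first variation in the
direction of the field `h`. -/
def current (L : JetModel 2 → ℝ) (w : JetModel 3) (h : Fin 4 → Fin 4 → Coord → ℝ) (β : Fin 4) : ℝ :=
  ∑ μ, ∑ ν, (∑ α, momentum₂ L μ ν α β w * dir α (h μ ν) w.1 + momentum₁ L μ ν β w * h μ ν w.1)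

/-- A function `u` vanishing at the point removes the coefficient of order zero. -/
theorem fibOp_mul_of_eq_zero (L : JetModel 2 → ℝ) (w : JetModel 2)
    {h : Fin 4 → Fin 4 → Coord → ℝ} {u : Coord → ℝ} {ξ : Coord} (hu : ContDiffAt ℝ ∞ u ξ)
    (hu0 : u ξ = 0) (hh : ∀ μ ν, ContDiffAt ℝ ∞ (h μ ν) ξ) :
    fibOp L w (fun μ ν x => u x * h μ ν x) ξ =
      ∑ α, dir α u ξ * fibB L w h α ξ + ∑ α, ∑ β, dir α (dir β u) ξ * fibC L w h α β ξ := by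
  rw [fibOp_mul L w hu hh, hu0]
  ring

/-- Products of functions vanishing at the point isolate the second-order coefficients. -/
theorem fibOp_mul_mul_of_eq_zero (L : JetModel 2 → ℝ) (w : JetModel 2)
    {h : Fin 4 → Fin 4 → Coord → ℝ} {u v : Coord → ℝ} {ξ : Coord} (hu : ContDiffAt ℝ ∞ u ξ)
    (hv : ContDiffAt ℝ ∞ v ξ) (hu0 : u ξ = 0) (hv0 : v ξ = 0)
    (hh : ∀ μ ν, ContDiffAt ℝ ∞ (h μ ν) ξ) :
    fibOp L w (fun μ ν x => (u x * v x) * h μ ν x) ξ =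
      2 * ∑ α, ∑ β, fibC L w h α β ξ * dir α u ξ * dir β v ξ := by
  have d : ∀ {u : Coord → ℝ}, ContDiffAt ℝ ∞ u ξ → DifferentiableAt ℝ u ξ := fun hu =>
    hu.differentiableAt (by simp)
  rw [fibOp_mul_of_eq_zero L w (u := fun x => u x * v x) (hu.mul hv) (by simp [hu0]) hh]
  simp only [fun α => dir_mul α (d hu) (d hv), fun α β => dir_dir_mul hu hv α β, hu0, hv0]
  simp only [mul_zero, zero_mul, add_zero, zero_add, Finset.sum_const_zero, add_mul,
    Finset.sum_add_distrib]
  have e1 : ∑ α, ∑ β, dir β u ξ * dir α v ξ * fibC L w h α β ξ =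
      ∑ α, ∑ β, fibC L w h α β ξ * dir α u ξ * dir β v ξ := by
    rw [Finset.sum_comm]
    exact Finset.sum_congr rfl fun α _ => Finset.sum_congr rfl fun β _ => by
      rw [fibC_swap]; ring
  have e2 : ∑ α, ∑ β, dir α u ξ * dir β v ξ * fibC L w h α β ξ =
      ∑ α, ∑ β, fibC L w h α β ξ * dir α u ξ * dir β v ξ :=
    Finset.sum_congr rfl fun α _ => Finset.sum_congr rfl fun β _ => by ring
  rw [e1, e2]
  ring

theorem contDiffOn_coeffZ {L : JetModel 2 → ℝ} {S : Set (JetModel 2)} (hS : IsOpen S)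
    (hL : ContDiffOn ℝ ∞ L S) {m : ℕ} (μ ν : Fin 4) (α : Fin m → Fin 4) :
    ContDiffOn ℝ ∞ (coeffZ L μ ν α) S :=
  (hL.fderiv_of_isOpen hS (m := ∞) (infty_add_le 1)).clm_apply contDiffOn_const

/-- The coordinate function `x^α`, normalised to vanish at `c`. -/
def centred (c : Coord) (α : Fin 4) (x : Coord) : ℝ := x α - c α

theorem contDiff_centred (c : Coord) (α : Fin 4) : ContDiff ℝ ∞ (centred c α) :=
  (EuclideanSpace.proj α : Coord →L[ℝ] ℝ).contDiff.sub contDiff_const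

theorem dir_centred (c : Coord) (α γ : Fin 4) (x : Coord) :
    dir γ (centred c α) x = if γ = α then 1 else 0 := by
  have h : HasFDerivAt (centred c α) (EuclideanSpace.proj α : Coord →L[ℝ] ℝ) x :=
    (EuclideanSpace.proj α : Coord →L[ℝ] ℝ).hasFDerivAt.sub_const _
  unfold dir
  rw [h.fderiv]
  simp [unitVec, eq_comm]

theorem dir_dir_centred (c : Coord) (α γ δ : Fin 4) (x : Coord) :
    dir γ (dir δ (centred c α)) x = 0 := by
  have : dir δ (centred c α) = fun _ => if δ = α then 1 else 0 := funext (dir_centred c α δ)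
  rw [this]
  simp [dir]

theorem dir_centred_comp {τ : Coord → Coord} {η : Coord} (hτ : DifferentiableAt ℝ τ η) (c : Coord)
    (α a : Fin 4) : dir a (fun x => centred c α (τ x)) η = jac τ η a α := by
  rw [dir_comp hτ ((contDiff_centred c α).contDiffAt.differentiableAt (by simp))]
  simp [dir_centred]

theorem dir_dir_centred_comp {τ : Coord → Coord} {η : Coord} (hτ : ContDiffAt ℝ ∞ τ η) (c : Coord)
    (α a b : Fin 4) : dir a (dir b fun x => centred c α (τ x)) η =
      dir a (fun x => jac τ x b α) η := by
  refine dir_congr ?_ a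
  filter_upwards [(hτ.of_le one_le_infty).eventually (by simp)] with x hx
  exact dir_centred_comp (hx.differentiableAt one_ne_zero) c α b

variable {M : Type*} [TopologicalSpace M] [ChartedSpace Coord M] [IsManifold (𝓡 4) ∞ M]

/-- The current in terms of the coefficients of the operator `f ↦ fibOp L (j²σ) (f h)` along a
section `σ`. -/
theorem current_eq {φ : SmoothChart M} {L : JetModel 2 → ℝ}
    (hL : ContDiffOn ℝ ∞ L (Jet.coordTarget 2 φ)) {σ : LocalMetric M} {ξ : Coord}
    (hξ : ξ ∈ secDom φ σ) {h : Fin 4 → Fin 4 → Coord → ℝ}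
    (hh : ∀ μ ν, ContDiffAt ℝ ∞ (h μ ν) ξ) (β : Fin 4) :
    (∀ α, DifferentiableAt ℝ (fun x => fibC L (secCoord 2 φ σ x) h α β x) ξ) ∧
    current L (secCoord 3 φ σ ξ) h β = fibB L (secCoord 2 φ σ ξ) h β ξ -
      ∑ α, dir α (fun x => fibC L (secCoord 2 φ σ x) h α β x) ξ := by
  have hbase : (σ.jet 3 (φ.1.symm ξ)).base ∈ φ.1.source := by
    rw [LocalMetric.base_jet]; exact φ.1.map_target hξ.1
  have htr : truncate (by norm_num) (secCoord 3 φ σ ξ) = secCoord 2 φ σ ξ := by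
    unfold secCoord
    rw [← Jet.coord_forget (by norm_num) φ hbase, LocalMetric.forget_jet _ hξ.2]
  have hmem : secCoord 2 φ σ ξ ∈ Jet.coordTarget 2 φ :=
    Jet.coord_mem φ (by rw [LocalMetric.base_jet]; exact φ.1.map_target hξ.1)
  have hcd : ∀ μ ν α, DifferentiableAt ℝ (coeffZ L μ ν ![α, β]) (secCoord 2 φ σ ξ) := fun μ ν α =>
    ((contDiffOn_coeffZ (Jet.isOpen_coordTarget φ) hL μ ν ![α, β]).contDiffAt
      ((Jet.isOpen_coordTarget φ).mem_nhds hmem)).differentiableAt (by simp)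
  have hcomp : ∀ μ ν α, HasFDerivAt (fun x => coeffZ L μ ν ![α, β] (secCoord 2 φ σ x))
      ((fderiv ℝ (coeffZ L μ ν ![α, β]) (secCoord 2 φ σ ξ)).comp
        (fderiv ℝ (secCoord 2 φ σ) ξ)) ξ := fun μ ν α =>
    (hcd μ ν α).hasFDerivAt.comp ξ (hasFDerivAt_secCoord φ σ hξ)
  have hdir : ∀ μ ν α, dir α (fun x => coeffZ L μ ν ![α, β] (secCoord 2 φ σ x)) ξ =
      fderiv ℝ (coeffZ L μ ν ![β, α]) (secCoord 2 φ σ ξ) (totalDir (secCoord 3 φ σ ξ) α) := by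
    intro μ ν α
    rw [dir, (hcomp μ ν α).fderiv, ContinuousLinearMap.comp_apply, fderiv_secCoord φ σ hξ]
    congr 2
    funext w
    exact coeffZ_swap L μ ν α β w
  have hhd : ∀ μ ν, DifferentiableAt ℝ (h μ ν) ξ := fun μ ν => (hh μ ν).differentiableAt (by simp)
  have hterm : ∀ α μ ν, DifferentiableAt ℝ
      (fun x => coeffZ L μ ν ![α, β] (secCoord 2 φ σ x) * h μ ν x) ξ := fun α μ ν =>
    (hcomp μ ν α).differentiableAt.fun_mul (hhd μ ν)
  refine ⟨fun α => DifferentiableAt.fun_sum fun μ _ => DifferentiableAt.fun_sum fun ν _ =>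
    hterm α μ ν, ?_⟩
  have hC : ∀ α, dir α (fun x => fibC L (secCoord 2 φ σ x) h α β x) ξ = ∑ μ, ∑ ν,
      (fderiv ℝ (coeffZ L μ ν ![β, α]) (secCoord 2 φ σ ξ) (totalDir (secCoord 3 φ σ ξ) α) *
          h μ ν ξ +
        coeffZ L μ ν ![α, β] (secCoord 2 φ σ ξ) * dir α (h μ ν) ξ) := by
    intro α
    unfold fibC
    rw [dir_sum α fun μ _ => DifferentiableAt.fun_sum fun ν _ => hterm α μ ν]
    refine Finset.sum_congr rfl fun μ _ => ?_
    rw [dir_sum α fun ν _ => hterm α μ ν]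
    refine Finset.sum_congr rfl fun ν _ => ?_
    rw [dir_mul α (hcomp μ ν α).differentiableAt (hhd μ ν), hdir]
  have hCs : ∑ α, dir α (fun x => fibC L (secCoord 2 φ σ x) h α β x) ξ = ∑ μ, ∑ ν, ∑ α,
      (fderiv ℝ (coeffZ L μ ν ![β, α]) (secCoord 2 φ σ ξ) (totalDir (secCoord 3 φ σ ξ) α) *
          h μ ν ξ +
        coeffZ L μ ν ![α, β] (secCoord 2 φ σ ξ) * dir α (h μ ν) ξ) := by
    rw [Finset.sum_congr rfl fun α _ => hC α, Finset.sum_comm]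
    exact Finset.sum_congr rfl fun μ _ => Finset.sum_comm
  rw [hCs]
  unfold current fibB momentum₁ momentum₂
  rw [htr, secCoord_fst φ σ hξ]
  simp only [← Finset.sum_sub_distrib]
  refine Finset.sum_congr rfl fun μ _ => Finset.sum_congr rfl fun ν _ => ?_
  simp only [fun α => coeffZ_swap L μ ν β α, Finset.sum_add_distrib, ← Finset.sum_mul]
  ring

/-- The transformation law of a Lagrangian density under the change of coordinates from `φ` to
`ψ`. -/
def IsDensityPair (φ ψ : SmoothChart M) (L L' : JetModel 2 → ℝ) : Prop :=
  ∀ j : Jet 2 M, j.base ∈ φ.1.source → j.base ∈ ψ.1.source →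
    L' (Jet.coord ψ j) = (jac (baseTrans φ ψ) (ψ.1 j.base)).det * L (Jet.coord φ j)

theorem mem_jetTransDom {k : ℕ} {φ ψ : SmoothChart M} {j : Jet k M} (hφ : j.base ∈ φ.1.source)
    (hψ : j.base ∈ ψ.1.source) : Jet.coord φ j ∈ jetTransDom k φ ψ :=
  ⟨Jet.coord_mem φ hφ, by rw [Jet.coord_fst φ hφ, φ.1.left_inv hφ]; exact hψ⟩

theorem jetTrans_coord {k : ℕ} {φ ψ : SmoothChart M} {j : Jet k M} (hφ : j.base ∈ φ.1.source) :
    jetTrans k φ ψ (Jet.coord φ j) = Jet.coord ψ j := by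
  unfold jetTrans
  rw [Jet.ofCoord_coord φ hφ]

/-- The fibre derivative of a Lagrangian density, in the direction of a field `h`, is a density:
this is the derivative of the law `IsDensityPair` along a line in the fibre. -/
theorem fibOp_transform {φ ψ : SmoothChart M} {L L' : JetModel 2 → ℝ}
    (hL : ContDiffOn ℝ ∞ L (Jet.coordTarget 2 φ)) (hL' : ContDiffOn ℝ ∞ L' (Jet.coordTarget 2 ψ))
    (hLL' : IsDensityPair φ ψ L L') {j : Jet 2 M} (hφ : j.base ∈ φ.1.source)
    (hψ : j.base ∈ ψ.1.source) {h : Fin 4 → Fin 4 → Coord → ℝ} (hh : ∀ μ ν, ContDiff ℝ ∞ (h μ ν))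
    (hsymm : ∀ μ ν, h μ ν = h ν μ) :
    fibOp L' (Jet.coord ψ j) (pull (baseTrans φ ψ) h) (ψ.1 j.base) =
      (jac (baseTrans φ ψ) (ψ.1 j.base)).det * fibOp L (Jet.coord φ j) h (φ.1 j.base) := by
  set w := Jet.coord φ j with hwdef
  set η := ψ.1 j.base with hηdef
  set τ := baseTrans φ ψ with hτdef
  have hw : w ∈ jetTransDom 2 φ ψ := mem_jetTransDom hφ hψ
  have hw1 : w.1 = φ.1 j.base := Jet.coord_fst φ hφ
  have hηw : ψ.1 (φ.1.symm w.1) = η := by rw [hw1, φ.1.left_inv hφ]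
  have hTw : jetTrans 2 φ ψ w = Jet.coord ψ j := jetTrans_coord hφ
  have hηV : η ∈ (ψ.1.symm ≫ₕ φ.1).source := mem_trans_source hφ hψ
  have hτη : τ η = w.1 := by rw [hw1]; exact baseTrans_apply φ ψ hψ
  let δ : JetFib 2 := jetOf 2 hh hsymm w.1
  have hδ : fderiv ℝ L w (0, δ) = fibOp L w h w.1 :=
    fderiv_jetOf L w (fun μ ν => (hh μ ν).contDiffAt) fun m hm μ ν α => rfl
  obtain ⟨hv1, hv2⟩ := fderiv_jetTrans_vertical φ ψ hw δ
  have hv : fderiv ℝ (jetTrans 2 φ ψ) w (0, δ) = (0, (fderiv ℝ (jetTrans 2 φ ψ) w (0, δ)).2) :=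
    Prod.ext hv1 rfl
  have hδ' : fderiv ℝ L' (Jet.coord ψ j) (fderiv ℝ (jetTrans 2 φ ψ) w (0, δ)) =
      fibOp L' (Jet.coord ψ j) (pull τ h) η := by
    rw [hv]
    refine fderiv_jetOf L' _ (fun μ ν => contDiffAt_pull (contDiffAt_baseTrans φ ψ hηV)
      (fun a b => (hh a b).contDiffAt) μ ν) fun m hm μ ν α => ?_
    have h1 := hv2 m hm μ ν α
    rw [hηw] at h1
    refine (evz_apply hm μ ν α _).symm.trans (h1.trans ?_)
    refine pd_pull_congr (k := 2) (ψ.1.symm ≫ₕ φ.1).open_source (φ.contDiffOn_trans ψ) hηV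
      (fun a b => contDiff_taylor_right _ a b) hh ?_ hm α μ ν
    intro a b m hm α
    have h2 := pd_taylor ((w.1, δ) : JetModel 2) a b ⟨m, Nat.lt_succ_of_le hm⟩ α
    change pd α (taylor (w.1, δ) a b) (τ η) = pd α (h a b) (τ η)
    rw [hτη]
    exact h2
  -- differentiate the transformation law along a line in the fibre
  have hline : HasDerivAt (fun t : ℝ => w + t • ((0 : Coord), δ)) ((0 : Coord), δ) 0 := by
    simpa using ((hasDerivAt_id (0 : ℝ)).smul_const ((0 : Coord), δ)).const_add w
  have hw0 : w + (0 : ℝ) • ((0 : Coord), δ) = w := by simp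
  have hLd : HasFDerivAt L (fderiv ℝ L w) w :=
    ((hL.contDiffAt ((Jet.isOpen_coordTarget φ).mem_nhds hw.1)).differentiableAt
      (by simp)).hasFDerivAt
  have hL'd : HasFDerivAt L' (fderiv ℝ L' (jetTrans 2 φ ψ w)) (jetTrans 2 φ ψ w) := by
    rw [hTw]
    exact ((hL'.contDiffAt ((Jet.isOpen_coordTarget ψ).mem_nhds
      (Jet.coord_mem ψ hψ))).differentiableAt (by simp)).hasFDerivAt
  have h1 : HasDerivAt (fun t : ℝ => L (w + t • ((0 : Coord), δ))) (fderiv ℝ L w (0, δ)) 0 := by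
    rw [← hw0] at hLd
    have := hLd.comp_hasDerivAt (0 : ℝ) hline
    rw [hw0] at this
    exact this
  have h2 : HasDerivAt (fun t : ℝ => L' (jetTrans 2 φ ψ (w + t • ((0 : Coord), δ))))
      (fderiv ℝ L' (jetTrans 2 φ ψ w) (fderiv ℝ (jetTrans 2 φ ψ) w (0, δ))) 0 := by
    have h3 := hL'd.comp w (hasFDerivAt_jetTrans φ ψ hw)
    rw [← hw0] at h3
    have := h3.comp_hasDerivAt (0 : ℝ) hline
    rw [hw0] at this
    exact this
  have hev : (fun t : ℝ => L' (jetTrans 2 φ ψ (w + t • ((0 : Coord), δ)))) =ᶠ[𝓝 0]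
      fun t => (jac τ η).det * L (w + t • ((0 : Coord), δ)) := by
    have hin : ∀ᶠ t : ℝ in 𝓝 0, w + t • ((0 : Coord), δ) ∈ jetTransDom 2 φ ψ := by
      apply hline.continuousAt.preimage_mem_nhds
      rw [hw0]
      exact (isOpen_jetTransDom φ ψ).mem_nhds hw
    filter_upwards [hin] with t ht
    have hb : (Jet.ofCoord φ (w + t • ((0 : Coord), δ))).base = j.base := by
      rw [Jet.base_ofCoord]
      simp [hw1, φ.1.left_inv hφ]
    have := hLL' (Jet.ofCoord φ (w + t • ((0 : Coord), δ))) (by rw [hb]; exact hφ)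
      (by rw [hb]; exact hψ)
    rw [hb, Jet.coord_ofCoord φ ht.1] at this
    exact this
  have := (h2.congr_of_eventuallyEq hev.symm).unique (h1.const_mul (jac τ η).det)
  rw [hδ, hTw, hδ', hw1] at this
  exact this

theorem det_jac_baseTrans_ne_zero {φ ψ : SmoothChart M} {x : M} (hφ : x ∈ φ.1.source)
    (hψ : x ∈ ψ.1.source) : (jac (baseTrans φ ψ) (ψ.1 x)).det ≠ 0 := by
  have h1 := (contDiffAt_baseTrans φ ψ (mem_trans_source hφ hψ)).differentiableAt (by simp)
  have h2 := (contDiffAt_baseTrans ψ φ (mem_trans_source hψ hφ)).differentiableAt (by simp)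
  have hx := baseTrans_apply φ ψ hψ
  rw [← hx] at h2
  have hmul : jac (baseTrans φ ψ) (ψ.1 x) * jac (baseTrans ψ φ) (φ.1 x) = 1 := by
    ext a b
    have hev : (fun y => baseTrans ψ φ (baseTrans φ ψ y) b) =ᶠ[𝓝 (ψ.1 x)] fun y => y b := by
      filter_upwards [(ψ.1.symm ≫ₕ φ.1).open_source.mem_nhds (mem_trans_source hφ hψ)] with y hy
      have h2 : y ∈ ψ.1.target ∧ ψ.1.symm y ∈ φ.1.source := by simpa using hy
      simp [baseTrans, φ.1.left_inv h2.2, ψ.1.right_inv h2.1]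
    have hc := dir_comp (f := fun y => baseTrans ψ φ y b) h1
      ((EuclideanSpace.proj b : Coord →L[ℝ] ℝ).differentiableAt.comp _ h2) a
    rw [dir_congr hev] at hc
    have e := dir_centred 0 b a (ψ.1 x)
    rw [show centred 0 b = fun y : Coord => y b from funext fun y => by simp [centred]] at e
    rw [e] at hc
    rw [Matrix.mul_apply, Matrix.one_apply, hc]
    refine Finset.sum_congr rfl fun γ _ => ?_
    rw [← hx, jac_eq_dir h2]
  intro h0
  have := congrArg Matrix.det hmul
  rw [Matrix.det_mul, h0] at this
  simp at this

/-- The current is a vector density. Along a section through the jet, the fibre derivative in the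
direction `f h` is a second-order operator on `f` with values in densities. Inserting products of
two centred coordinates, and centred coordinates, for `f` gives the transformation laws of its
coefficients, to which `boundary_transform` applies. -/
theorem current_transform {φ ψ : SmoothChart M} {L L' : JetModel 2 → ℝ}
    (hL : ContDiffOn ℝ ∞ L (Jet.coordTarget 2 φ)) (hL' : ContDiffOn ℝ ∞ L' (Jet.coordTarget 2 ψ))
    (hLL' : IsDensityPair φ ψ L L') {j : Jet 3 M} (hφ : j.base ∈ φ.1.source)
    (hψ : j.base ∈ ψ.1.source) {h : Fin 4 → Fin 4 → Coord → ℝ} (hh : ∀ μ ν, ContDiff ℝ ∞ (h μ ν))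
    (hsymm : ∀ μ ν, h μ ν = h ν μ) (β : Fin 4) :
    ∑ a, jac (baseTrans φ ψ) (ψ.1 j.base) a β *
        current L' (Jet.coord ψ j) (pull (baseTrans φ ψ) h) a =
      (jac (baseTrans φ ψ) (ψ.1 j.base)).det * current L (Jet.coord φ j) h β := by
  obtain ⟨σ, hσ, hj⟩ := j.exists_section
  set x := j.base with hx
  set τ := baseTrans φ ψ with hτdef
  have hηV : ψ.1 x ∈ (ψ.1.symm ≫ₕ φ.1).source := mem_trans_source hφ hψ
  have hτ : ContDiffAt ℝ ∞ τ (ψ.1 x) := contDiffAt_baseTrans φ ψ hηV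
  have hτx : τ (ψ.1 x) = φ.1 x := baseTrans_apply φ ψ hψ
  have hjφ : Jet.coord φ j = secCoord 3 φ σ (φ.1 x) := by
    rw [secCoord, φ.1.left_inv hφ, hj]
  have hjψ : Jet.coord ψ j = secCoord 3 ψ σ (ψ.1 x) := by
    rw [secCoord, ψ.1.left_inv hψ, hj]
  have hDφ := mem_secDom hσ hφ
  have hDψ := mem_secDom hσ hψ
  have hps : ∀ {η}, η ∈ (ψ.1.symm ≫ₕ φ.1).source → ∀ μ ν, ContDiffAt ℝ ∞ (pull τ h μ ν) η :=
    fun hη μ ν => contDiffAt_pull (contDiffAt_baseTrans φ ψ hη) (fun a b => (hh a b).contDiffAt) μ ν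
  have hhs : ∀ {ξ}, ∀ μ ν, ContDiffAt ℝ ∞ (h μ ν) ξ := fun μ ν => (hh μ ν).contDiffAt
  -- the transformation law of the fibre derivative along the section
  have hop : ∀ {η}, η ∈ (ψ.1.symm ≫ₕ φ.1).source → ∀ f : Coord → ℝ, ContDiff ℝ ∞ f →
      fibOp L' (secCoord 2 ψ σ η) (fun μ ν y => f (τ y) * pull τ h μ ν y) η =
        (jac τ η).det * fibOp L (secCoord 2 φ σ (τ η)) (fun μ ν y => f y * h μ ν y) (τ η) := by
    intro η hη f hf
    have h2 : η ∈ ψ.1.target ∧ ψ.1.symm η ∈ φ.1.source := by simpa using hη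
    have hb : (σ.jet 2 (ψ.1.symm η)).base = ψ.1.symm η := LocalMetric.base_jet σ _
    have ht := fibOp_transform hL hL' hLL' (j := σ.jet 2 (ψ.1.symm η)) (by rw [hb]; exact h2.2)
      (by rw [hb]; exact ψ.1.map_target h2.1) (h := fun μ ν y => f y * h μ ν y)
      (fun μ ν => hf.mul (hh μ ν)) (fun μ ν => by simp only [hsymm μ ν])
    rw [hb, ψ.1.right_inv h2.1] at ht
    have e1 : secCoord 2 φ σ (τ η) = Jet.coord φ (σ.jet 2 (ψ.1.symm η)) := by
      unfold secCoord
      rw [show φ.1.symm (τ η) = ψ.1.symm η from φ.1.left_inv h2.2]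
    have e2 : (fun μ ν y => f (τ y) * pull τ h μ ν y) = pull τ (fun μ ν y => f y * h μ ν y) := by
      funext μ ν y
      exact (pull_mul τ f h μ ν y).symm
    rw [e1, e2]
    exact ht
  have hcφ := fun β => current_eq hL hDφ (h := h) hhs β
  have hcψ := fun β => current_eq hL' hDψ (h := pull τ h) (hps hηV) β
  rw [hjφ, hjψ]
  simp only [fun β => (hcφ β).2, fun β => (hcψ β).2]
  rw [← hτx] at hcφ ⊢
  refine boundary_transform hτ (det_jac_baseTrans_ne_zero hφ hψ)
    (c := fun α β y => fibC L (secCoord 2 φ σ y) h α β y)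
    (c' := fun a b y => fibC L' (secCoord 2 ψ σ y) (pull τ h) a b y)
    (b := fun α => fibB L (secCoord 2 φ σ (τ (ψ.1 x))) h α (τ (ψ.1 x)))
    (b' := fun a => fibB L' (secCoord 2 ψ σ (ψ.1 x)) (pull τ h) a (ψ.1 x))
    (fun α β => (hcφ β).1 α) (fun α β => (hcψ β).1 α) ?_ ?_ β
  · intro α β
    filter_upwards [(ψ.1.symm ≫ₕ φ.1).open_source.mem_nhds hηV] with η hη
    have hτη := contDiffAt_baseTrans φ ψ hη
    have hτd : DifferentiableAt ℝ τ η := hτη.differentiableAt (by simp)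
    have hc := fun α => contDiff_centred (τ η) α
    have h1 := hop hη (fun y => centred (τ η) α y * centred (τ η) β y) ((hc α).mul (hc β))
    rw [fibOp_mul_mul_of_eq_zero L _ (hc α).contDiffAt (hc β).contDiffAt (by simp [centred])
      (by simp [centred]) hhs, fibOp_mul_mul_of_eq_zero L' _
      (u := fun y => centred (τ η) α (τ y)) (v := fun y => centred (τ η) β (τ y))
      ((hc α).contDiffAt.comp η hτη) ((hc β).contDiffAt.comp η hτη) (by simp [centred])
      (by simp [centred]) (hps hη)] at h1
    simp only [dir_centred_comp hτd, dir_centred] at h1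
    simp only [mul_ite, mul_one, mul_zero, Finset.sum_ite_eq', Finset.mem_univ, if_true] at h1
    linarith
  · intro α
    have hc := contDiff_centred (τ (ψ.1 x)) α
    have h1 := hop hηV (centred (τ (ψ.1 x)) α) hc
    rw [fibOp_mul_of_eq_zero L _ hc.contDiffAt (by simp [centred]) hhs, fibOp_mul_of_eq_zero L' _
      (u := fun y => centred (τ (ψ.1 x)) α (τ y)) (hc.contDiffAt.comp _ hτ) (by simp [centred])
      (hps hηV)] at h1
    simp only [dir_centred_comp (hτ.differentiableAt (by simp)), dir_dir_centred_comp hτ,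
      dir_centred, dir_dir_centred] at h1
    simp only [ite_mul, one_mul, zero_mul, Finset.sum_ite_eq', Finset.mem_univ, if_true,
      Finset.sum_const_zero, add_zero] at h1
    rw [← h1]
    simp only [mul_comm]

end

section

/-! ### Tangent vectors of the jet bundles in coordinates -/

variable {M : Type*} [TopologicalSpace M] [ChartedSpace Coord M] [IsManifold (𝓡 4) ∞ M] {k : ℕ}

theorem Jet.chart_mdifferentiable (φ : SmoothChart M) :
    (Jet.chart k φ).MDifferentiable 𝓘(ℝ, JetModel k) 𝓘(ℝ, JetModel k) :=
  mdifferentiable_of_mem_atlas (Jet.mem_atlas_iff.2 ⟨φ, rfl⟩)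

/-- The components of a tangent vector of `J^k(M, N)` in the coordinates induced by `φ`. -/
def tangentCoord (φ : SmoothChart M) (j : Jet k M) : JetTangent k M j →ₗ[ℝ] JetModel k :=
  (mfderiv 𝓘(ℝ, JetModel k) 𝓘(ℝ, JetModel k) (Jet.chart k φ) j).toLinearMap

/-- The tangent vector of `J^k(M, N)` with given components in the coordinates induced by `φ`. -/
def ofTangentCoord (φ : SmoothChart M) (w : JetModel k) :
    JetModel k →ₗ[ℝ] JetTangent k M ((Jet.chart k φ).symm w) :=
  (mfderiv 𝓘(ℝ, JetModel k) 𝓘(ℝ, JetModel k) (Jet.chart k φ).symm w).toLinearMap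

theorem tangentCoord_ofTangentCoord (φ : SmoothChart M) {w : JetModel k}
    (hw : w ∈ Jet.coordTarget k φ) (v : JetModel k) :
    tangentCoord φ ((Jet.chart k φ).symm w) (ofTangentCoord φ w v) = v :=
  congrArg (fun L => L v) ((Jet.chart_mdifferentiable φ).comp_symm_deriv (x := w) hw)

theorem base_chart_symm (φ : SmoothChart M) {w : JetModel k} (hw : w ∈ Jet.coordTarget k φ) :
    ((Jet.chart k φ).symm w).base ∈ φ.1.source :=
  (Jet.chart k φ).map_target hw

theorem coord_chart_symm (φ : SmoothChart M) {w : JetModel k} (hw : w ∈ Jet.coordTarget k φ) :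
    Jet.coord φ ((Jet.chart k φ).symm w) = w :=
  Jet.coord_ofCoord φ hw

theorem mfderiv_comp_chart {E : Type*} [NormedAddCommGroup E] [NormedSpace ℝ E]
    {φ : SmoothChart M} {j : Jet k M} (hj : j.base ∈ φ.1.source) {F : JetModel k → E}
    (hF : DifferentiableAt ℝ F (Jet.coord φ j)) (v : JetTangent k M j) :
    mfderiv 𝓘(ℝ, JetModel k) 𝓘(ℝ, E) (fun j => F (Jet.coord φ j)) j v =
      fderiv ℝ F (Jet.coord φ j) (tangentCoord φ j v) := by
  have h1 := (Jet.chart_mdifferentiable (k := k) φ).mdifferentiableAt (x := j) hj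
  have h2 : MDifferentiableAt 𝓘(ℝ, JetModel k) 𝓘(ℝ, E) F (Jet.chart k φ j) :=
    hF.mdifferentiableAt
  have h := mfderiv_comp j h2 h1
  rw [mfderiv_eq_fderiv] at h
  exact congrArg (fun L => L v) h

theorem diff_comp_coord {φ : SmoothChart M} {j : Jet k M} (hj : j.base ∈ φ.1.source)
    (E : JetModel k →L[ℝ] ℝ) (v : JetTangent k M j) :
    diff (fun j => E (Jet.coord φ j)) j v = E (tangentCoord φ j v) := by
  refine (mfderiv_comp_chart hj E.differentiableAt v).trans ?_
  rw [E.fderiv]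

theorem dx_apply {φ : SmoothChart M} {j : Jet k M} (hj : j.base ∈ φ.1.source) (μ : Fin 4)
    (v : JetTangent k M j) : dx φ μ j v = (tangentCoord φ j v).1 μ :=
  diff_comp_coord hj ((EuclideanSpace.proj μ : Coord →L[ℝ] ℝ).comp
    (ContinuousLinearMap.fst ℝ Coord (JetFib k))) v

/-- The contact form `dz_{μνα₁…α_m} - z_{μνα₁…α_mγ} dx^γ` in coordinates. -/
def contactCoord {m : ℕ} (hm : m + 1 ≤ k) (μ ν : Fin 4) (α : Fin m → Fin 4)
    (w v : JetModel k) : ℝ :=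
  evz (Nat.le_of_succ_le hm) μ ν α v - ∑ γ, evz hm μ ν (Fin.snoc α γ) w * v.1 γ

theorem contact_apply {φ : SmoothChart M} {j : Jet k M} (hj : j.base ∈ φ.1.source) {m : ℕ}
    (hm : m + 1 ≤ k) (μ ν : Fin 4) (α : Fin m → Fin 4) (v : JetTangent k M j) :
    contact φ hm μ ν α j v = contactCoord hm μ ν α (Jet.coord φ j) (tangentCoord φ j v) := by
  have h1 : diff (zCoord φ (Nat.le_of_succ_le hm) μ ν α) j v =
      evz (Nat.le_of_succ_le hm) μ ν α (tangentCoord φ j v) :=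
    diff_comp_coord hj (evz (Nat.le_of_succ_le hm) μ ν α) v
  unfold contact contactCoord
  rw [LinearMap.sub_apply, h1, LinearMap.sum_apply]
  congr 1
  refine Finset.sum_congr rfl fun γ _ => ?_
  rw [LinearMap.smul_apply, dx_apply hj]
  rfl

theorem d4x_apply {φ : SmoothChart M} {j : Jet k M} (hj : j.base ∈ φ.1.source)
    (v : Fin 4 → JetTangent k M j) :
    d4x φ j v = (Matrix.of fun i μ => (tangentCoord φ j (v i)).1 μ).det := by
  have e : (fun i => LinearMap.pi (fun μ => dx φ μ j) (v i)) =
      fun i μ => (tangentCoord φ j (v i)).1 μ := by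
    funext i μ
    exact dx_apply hj μ (v i)
  show Matrix.detRowAlternating (fun i => LinearMap.pi (fun μ => dx φ μ j) (v i)) = _
  rw [e]
  rfl

theorem eventually_base_mem {φ : SmoothChart M} {j : Jet k M} (hj : j.base ∈ φ.1.source) :
    ∀ᶠ j' in 𝓝 j, j'.base ∈ φ.1.source :=
  (Jet.chart k φ).open_source.mem_nhds hj

theorem tangentCoord_trans {φ ψ : SmoothChart M} {j : Jet k M} (hφ : j.base ∈ φ.1.source)
    (hψ : j.base ∈ ψ.1.source) (v : JetTangent k M j) :
    tangentCoord ψ j v = fderiv ℝ (jetTrans k φ ψ) (Jet.coord φ j) (tangentCoord φ j v) := by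
  rw [← mfderiv_comp_chart hφ (hasFDerivAt_jetTrans φ ψ (mem_jetTransDom hφ hψ)).differentiableAt]
  have e : (Jet.chart k ψ : Jet k M → JetModel k) =ᶠ[𝓝 j]
      fun j => jetTrans k φ ψ (Jet.coord φ j) := by
    filter_upwards [eventually_base_mem hφ] with j' hj' using (jetTrans_coord hj').symm
  exact congrArg (fun L : JetModel k →L[ℝ] JetModel k => L v)
    (e.mfderiv_eq (I := 𝓘(ℝ, JetModel k)) (I' := 𝓘(ℝ, JetModel k)))

/-- The horizontal components of a tangent vector transform with the Jacobian of the coordinate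
change on `M`. -/
theorem tangentCoord_fst_trans {φ ψ : SmoothChart M} {j : Jet k M} (hφ : j.base ∈ φ.1.source)
    (hψ : j.base ∈ ψ.1.source) (v : JetTangent k M j) (α : Fin 4) :
    (tangentCoord φ j v).1 α =
      ∑ a, (tangentCoord ψ j v).1 a * jac (baseTrans φ ψ) (ψ.1 j.base) a α := by
  have hη := mem_trans_source hφ hψ
  have h1 : (Jet.coord ψ j).1 = ψ.1 j.base := Jet.coord_fst ψ hψ
  have hτ : HasFDerivAt (baseTrans φ ψ) (fderiv ℝ (baseTrans φ ψ) (ψ.1 j.base))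
      (Jet.coord ψ j).1 := by
    rw [h1]
    exact ((contDiffAt_baseTrans φ ψ hη).differentiableAt (by simp)).hasFDerivAt
  have hF : HasFDerivAt (fun w : JetModel k => baseTrans φ ψ w.1)
      ((fderiv ℝ (baseTrans φ ψ) (ψ.1 j.base)).comp
        (ContinuousLinearMap.fst ℝ Coord (JetFib k))) (Jet.coord ψ j) :=
    HasFDerivAt.comp (Jet.coord ψ j) hτ (hasFDerivAt_fst (p := Jet.coord ψ j))
  have e : (fun j => baseTrans φ ψ (Jet.coord ψ j).1) =ᶠ[𝓝 j]
      fun j => (Jet.coord φ j).1 := by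
    filter_upwards [eventually_base_mem hφ, eventually_base_mem hψ] with j' h h'
    rw [Jet.coord_fst ψ h', Jet.coord_fst φ h, baseTrans_apply φ ψ h']
  have h2 := mfderiv_comp_chart hψ hF.differentiableAt v
  have h3 := mfderiv_comp_chart hφ (F := fun w : JetModel k => w.1)
    differentiableAt_fst v
  rw [hF.fderiv] at h2
  have h4 : mfderiv 𝓘(ℝ, JetModel k) 𝓘(ℝ, Coord) (fun j => baseTrans φ ψ (Jet.coord ψ j).1) j v =
      mfderiv 𝓘(ℝ, JetModel k) 𝓘(ℝ, Coord) (fun j => (Jet.coord φ j).1) j v :=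
    congrArg (fun L : JetModel k →L[ℝ] Coord => L v)
      (e.mfderiv_eq (I := 𝓘(ℝ, JetModel k)) (I' := 𝓘(ℝ, Coord)))
  have h5 : fderiv ℝ (fun w : JetModel k => w.1) (Jet.coord φ j) (tangentCoord φ j v) =
      (tangentCoord φ j v).1 := by rw [fderiv_fst]; rfl
  have h6 : (tangentCoord φ j v).1 =
      fderiv ℝ (baseTrans φ ψ) (ψ.1 j.base) (tangentCoord ψ j v).1 :=
    h5.symm.trans (h3.symm.trans (h4.symm.trans h2))
  rw [h6, fderiv_apply_eq_sum_jac]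

/-- A tangent vector whose `dx` components vanish is tangent to the fibres of the source
projection. -/
theorem mfderiv_base_eq_zero {φ : SmoothChart M} {j : Jet k M} (hj : j.base ∈ φ.1.source)
    {v : JetTangent k M j} (hv : (tangentCoord φ j v).1 = 0) :
    mfderiv 𝓘(ℝ, JetModel k) (𝓡 4) Jet.base j v = 0 := by
  have h1 := (Jet.chart_mdifferentiable (k := k) φ).mdifferentiableAt (x := j) hj
  have h2 : MDifferentiableAt 𝓘(ℝ, JetModel k) 𝓘(ℝ, Coord) (fun w : JetModel k => w.1)
      (Jet.chart k φ j) := differentiableAt_fst.mdifferentiableAt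
  have h3 : MDifferentiableAt (𝓡 4) (𝓡 4) φ.1.symm (Jet.chart k φ j).1 := by
    have : (Jet.chart k φ j).1 = φ.1 j.base := Jet.coord_fst φ hj
    rw [this]
    exact φ.mdifferentiable.mdifferentiableAt_symm (φ.1.map_source hj)
  have e : (Jet.base : Jet k M → M) =ᶠ[𝓝 j]
      φ.1.symm ∘ (fun j : Jet k M => (Jet.chart k φ j).1) := by
    filter_upwards [eventually_base_mem hj] with j' hj'
    have : (Jet.chart k φ j').1 = φ.1 j'.base := Jet.coord_fst φ hj'
    simp [this, φ.1.left_inv hj']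
  have h4 : MDifferentiableAt 𝓘(ℝ, JetModel k) 𝓘(ℝ, Coord)
      (fun j : Jet k M => (Jet.chart k φ j).1) j := h2.comp j h1
  have h5 : mfderiv 𝓘(ℝ, JetModel k) 𝓘(ℝ, Coord) (fun j : Jet k M => (Jet.chart k φ j).1) j v =
      0 := by
    refine (mfderiv_comp_chart hj (F := fun w : JetModel k => w.1) differentiableAt_fst v).trans ?_
    rw [fderiv_fst]
    exact hv
  have h6 := mfderiv_comp j h3 h4
  rw [e.mfderiv_eq, h6]
  refine (congrArg (mfderiv (𝓡 4) (𝓡 4) φ.1.symm (Jet.chart k φ j).1) h5).trans ?_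
  exact map_zero _

/-! ### Lagrange forms -/

/-- The Lagrangian `L` of `Λ = L d₄x` in the coordinates induced by `φ`. -/
def lagrangian (Λ : JetForm 2 M) (φ : SmoothChart M) : JetModel 2 → ℝ :=
  Λ.comp φ fun i => (unitVec i, 0)

theorem IsLagrangeForm.contDiffOn_lagrangian {Λ : JetForm 2 M} (hΛ : IsLagrangeForm Λ)
    (φ : SmoothChart M) : ContDiffOn ℝ ∞ (lagrangian Λ φ) (Jet.coordTarget 2 φ) :=
  hΛ.smooth φ _

/-- An alternating map that vanishes when one argument lies in `P` does not change when its
arguments change by elements of `P`. -/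
theorem alternatingMap_eq_of_sub_mem {T : Type*} [AddCommGroup T] [Module ℝ T]
    (f : T [⋀^Fin 4]→ₗ[ℝ] ℝ) {P : Set T} (hP : ∀ v : Fin 4 → T, (∃ i, v i ∈ P) → f v = 0)
    {v v' : Fin 4 → T} (h : ∀ i, v i - v' i ∈ P) : f v = f v' := by
  have e : v = v' + fun i => v i - v' i := by funext i; simp
  rw [e]
  have := f.toMultilinearMap.map_add_univ v' fun i => v i - v' i
  refine this.trans ?_
  rw [Finset.sum_eq_single Finset.univ]
  · simp
  · intro s _ hs
    obtain ⟨i, hi⟩ : ∃ i, i ∉ s := by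
      by_contra! hc
      exact hs (Finset.eq_univ_iff_forall.2 hc)
    exact hP _ ⟨i, by rw [Finset.piecewise_eq_of_notMem _ _ _ hi]; exact h i⟩
  · simp

/-- A Lagrange form is locally `L d₄x`: being semi-basic, it sees only the horizontal parts of its
arguments, on which every `4`-form is a multiple of the determinant. -/
theorem IsLagrangeForm.apply_eq {Λ : JetForm 2 M} (hΛ : IsLagrangeForm Λ) {φ : SmoothChart M}
    {w : JetModel 2} (hw : w ∈ Jet.coordTarget 2 φ)
    (v : Fin 4 → JetTangent 2 M ((Jet.chart 2 φ).symm w)) :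
    Λ ((Jet.chart 2 φ).symm w) v = lagrangian Λ φ w * d4x φ ((Jet.chart 2 φ).symm w) v := by
  have hb : ((Jet.chart 2 φ).symm w).base ∈ φ.1.source := base_chart_symm φ hw
  -- the horizontal lift of `ℝ⁴`
  let s : (Fin 4 → ℝ) →ₗ[ℝ] JetTangent 2 M ((Jet.chart 2 φ).symm w) :=
    (ofTangentCoord φ w).comp ((LinearMap.inl ℝ Coord (JetFib 2)).comp
      (EuclideanSpace.equiv (Fin 4) ℝ).symm.toLinearEquiv.toLinearMap)
  have hs : ∀ c : Fin 4 → ℝ, tangentCoord φ ((Jet.chart 2 φ).symm w) (s c) =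
      ((EuclideanSpace.equiv (Fin 4) ℝ).symm c, 0) := fun c =>
    tangentCoord_ofTangentCoord φ hw _
  let c : Fin 4 → Fin 4 → ℝ := fun i μ => (tangentCoord φ ((Jet.chart 2 φ).symm w) (v i)).1 μ
  have h1 : Λ ((Jet.chart 2 φ).symm w) v = Λ ((Jet.chart 2 φ).symm w) fun i => s (c i) := by
    refine alternatingMap_eq_of_sub_mem (Λ ((Jet.chart 2 φ).symm w))
      (P := {v | mfderiv 𝓘(ℝ, JetModel 2) (𝓡 4) Jet.base ((Jet.chart 2 φ).symm w) v = 0})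
      (hΛ.semibasic ((Jet.chart 2 φ).symm w)) fun i => ?_
    refine mfderiv_base_eq_zero hb ?_
    rw [map_sub, hs]
    ext μ
    simp [c]
  have h2 : (Λ ((Jet.chart 2 φ).symm w)).compLinearMap s =
      ((Λ ((Jet.chart 2 φ).symm w)).compLinearMap s (Pi.basisFun ℝ (Fin 4))) •
      (Pi.basisFun ℝ (Fin 4)).det := AlternatingMap.eq_smul_basis_det _ _
  have h3 : (Λ ((Jet.chart 2 φ).symm w)).compLinearMap s (Pi.basisFun ℝ (Fin 4)) =
      lagrangian Λ φ w := by
    show Λ ((Jet.chart 2 φ).symm w) (fun i => s (Pi.basisFun ℝ (Fin 4) i)) =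
      Λ ((Jet.chart 2 φ).symm w) fun i => ofTangentCoord φ w (unitVec i, 0)
    congr 1
    funext i
    show ofTangentCoord φ w ((EuclideanSpace.equiv (Fin 4) ℝ).symm (Pi.basisFun ℝ (Fin 4) i), 0) = _
    congr 2
    ext μ
    simp [unitVec]
  rw [h1, d4x_apply hb]
  have h4 := congrArg (fun f => f c) h2
  refine Eq.trans h4 ?_
  rw [h3, AlternatingMap.smul_apply, smul_eq_mul, Pi.basisFun_det]
  rfl

theorem Jet.chart_symm_coord (φ : SmoothChart M) {j : Jet k M} (hj : j.base ∈ φ.1.source) :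
    (Jet.chart k φ).symm (Jet.coord φ j) = j := Jet.ofCoord_coord φ hj

/-- This is `IsLagrangeForm.apply_eq`, transported along `(Jet.chart 2 φ).symm (Jet.coord φ j) = j`. -/
theorem IsLagrangeForm.eq_smul {Λ : JetForm 2 M} (hΛ : IsLagrangeForm Λ) {φ : SmoothChart M}
    {j : Jet 2 M} (hj : j.base ∈ φ.1.source) :
    Λ j = lagrangian Λ φ (Jet.coord φ j) • d4x φ j := by
  have h : ∀ j', (Jet.chart 2 φ).symm (Jet.coord φ j) = j' →
      Λ j' = lagrangian Λ φ (Jet.coord φ j) • d4x φ j' := by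
    rintro _ rfl
    exact AlternatingMap.ext fun v => hΛ.apply_eq (Jet.coord_mem φ hj) v
  exact h j (Jet.chart_symm_coord φ hj)

theorem exists_tangentCoord_eq {φ : SmoothChart M} {j : Jet k M} (hj : j.base ∈ φ.1.source)
    (v : JetModel k) : ∃ u : JetTangent k M j, tangentCoord φ j u = v := by
  have h : ∀ j', (Jet.chart k φ).symm (Jet.coord φ j) = j' →
      ∃ u : JetTangent k M j', tangentCoord φ j' u = v := by
    rintro _ rfl
    exact ⟨_, tangentCoord_ofTangentCoord φ (Jet.coord_mem φ hj) v⟩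
  exact h j (Jet.chart_symm_coord φ hj)

theorem exists_d4x_eq_one {φ : SmoothChart M} {j : Jet k M} (hj : j.base ∈ φ.1.source) :
    ∃ u : Fin 4 → JetTangent k M j, (∀ i, tangentCoord φ j (u i) = (unitVec i, 0)) ∧
      d4x φ j u = 1 := by
  choose u hu using fun i : Fin 4 => exists_tangentCoord_eq hj ((unitVec i, 0) : JetModel k)
  refine ⟨u, hu, ?_⟩
  rw [d4x_apply hj]
  simp only [hu]
  convert Matrix.det_one (n := Fin 4) (R := ℝ) using 2
  ext i μ
  simp [unitVec, Matrix.one_apply, eq_comm]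

theorem IsLagrangeForm.isDensityPair {Λ : JetForm 2 M} (hΛ : IsLagrangeForm Λ)
    (φ ψ : SmoothChart M) : IsDensityPair φ ψ (lagrangian Λ φ) (lagrangian Λ ψ) := by
  intro j hφ hψ
  obtain ⟨u, hu, hu1⟩ := exists_d4x_eq_one hψ
  have h := congrArg (fun f => f u) ((hΛ.eq_smul hφ).symm.trans (hΛ.eq_smul hψ))
  simp only [AlternatingMap.smul_apply, smul_eq_mul, hu1, mul_one] at h
  rw [← h, d4x_apply hφ, mul_comm]
  congr 2
  ext i α
  rw [Matrix.of_apply, tangentCoord_fst_trans hφ hψ, hu]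
  simp [unitVec]

end

section

/-! ### The De Donder form in coordinates -/

/-- The vector `p^{μναβ} ω_{μνα}(v) + p^{μνβ} ω_{μν}(v)` with given momenta, where `ω` are the
contact forms at the jet with coordinates `w`. -/
def boundaryVec (P₂ : Fin 4 → Fin 4 → Fin 4 → Fin 4 → ℝ) (P₁ : Fin 4 → Fin 4 → Fin 4 → ℝ)
    (w v : JetModel 3) (β : Fin 4) : ℝ :=
  ∑ μ, ∑ ν, (∑ α, P₂ μ ν α β * contactCoord (m := 1) (by norm_num) μ ν ![α] w v +
    P₁ μ ν β * contactCoord (m := 0) (by norm_num) μ ν ![] w v)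

/-- The value on four tangent vectors of
`ℓ d₄x + p^{μναβ} ω_{μνα} ∧ (∂_β ⌟ d₄x) + p^{μνα} ω_{μν} ∧ (∂_α ⌟ d₄x)`. -/
def formVal (ℓ : ℝ) (P₂ : Fin 4 → Fin 4 → Fin 4 → Fin 4 → ℝ) (P₁ : Fin 4 → Fin 4 → Fin 4 → ℝ)
    (w : JetModel 3) (v : Fin 4 → JetModel 3) : ℝ :=
  ℓ * (Matrix.of fun i μ => (v i).1 μ).det +
    ∑ i : Fin 4, (-1) ^ (i : ℕ) * ∑ β, boundaryVec P₂ P₁ w (v i) β *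
      (Matrix.of (Matrix.vecCons (Pi.single β 1) fun l μ => (i.removeNth v l).1 μ)).det

/-- Contracting the forms `∂_β ⌟ d₄x` with a vector `B` inserts `B` into the determinant. -/
theorem sum_mul_det_vecCons (B : Fin 4 → ℝ) (r : Fin 3 → Fin 4 → ℝ) :
    ∑ β, B β * (Matrix.of (Matrix.vecCons (Pi.single β 1) r)).det =
      (Matrix.of (Matrix.vecCons B r)).det := by
  let F : (Fin 4 → ℝ) →ₗ[ℝ] ℝ :=
    { toFun := fun x => (Matrix.detRowAlternating (R := ℝ) (n := Fin 4)).curryLeft x r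
      map_add' := fun x y => by rw [map_add]; rfl
      map_smul' := fun c x => by rw [map_smul]; rfl }
  have e : ∑ β, B β • (Pi.single β 1 : Fin 4 → ℝ) = B := by
    ext i; simp [Finset.sum_apply, Pi.single_apply]
  have h := congrArg F e
  rw [map_sum] at h
  refine Eq.trans (Finset.sum_congr rfl fun β _ => ?_) h
  rw [map_smul]
  rfl

/-- The value of the De Donder form of `L d₄x` on four tangent vectors. -/
def deDonderVal (L : JetModel 2 → ℝ) (w : JetModel 3) (v : Fin 4 → JetModel 3) : ℝ :=
  formVal (L (truncate (by norm_num) w)) (fun μ ν α β => momentum₂ L μ ν α β w)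
    (fun μ ν α => momentum₁ L μ ν α w) w v

theorem formVal_lin (a b ℓ ℓ' : ℝ) (P₂ P₂' : Fin 4 → Fin 4 → Fin 4 → Fin 4 → ℝ)
    (P₁ P₁' : Fin 4 → Fin 4 → Fin 4 → ℝ) (w : JetModel 3) (v : Fin 4 → JetModel 3) :
    formVal (a * ℓ + b * ℓ') (fun μ ν α β => a * P₂ μ ν α β + b * P₂' μ ν α β)
      (fun μ ν α => a * P₁ μ ν α + b * P₁' μ ν α) w v =
      a * formVal ℓ P₂ P₁ w v + b * formVal ℓ' P₂' P₁' w v := by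
  have hB : ∀ v β, boundaryVec (fun μ ν α β => a * P₂ μ ν α β + b * P₂' μ ν α β)
      (fun μ ν α => a * P₁ μ ν α + b * P₁' μ ν α) w v β =
      a * boundaryVec P₂ P₁ w v β + b * boundaryVec P₂' P₁' w v β := by
    intro v β
    simp only [boundaryVec, Finset.mul_sum, ← Finset.sum_add_distrib]
    refine Finset.sum_congr rfl fun μ _ => Finset.sum_congr rfl fun ν _ => ?_
    simp only [add_mul, Finset.sum_add_distrib, mul_add, Finset.mul_sum, mul_assoc]
    ring
  unfold formVal
  simp only [hB, add_mul, Finset.sum_add_distrib, mul_add]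
  simp only [Finset.mul_sum, ← mul_assoc]
  simp only [mul_comm _ a, mul_comm _ b]
  ring

variable {M : Type*} [TopologicalSpace M] [ChartedSpace Coord M] [IsManifold (𝓡 4) ∞ M]

/-! ### Independence of the coordinates -/

theorem evz_taylor {k : ℕ} (ξ : Coord) (z : JetFib k) {m : ℕ} (hm : m ≤ k) (μ ν : Fin 4)
    (α : Fin m → Fin 4) : pd α (taylor (ξ, z) μ ν) ξ = z.1 ⟨m, Nat.lt_succ_of_le hm⟩ μ ν α :=
  pd_taylor ((ξ, z) : JetModel k) μ ν ⟨m, Nat.lt_succ_of_le hm⟩ α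

/-- The contact forms vanish on tangent vectors of prolonged sections. -/
theorem contactCoord_fderiv_secCoord {φ : SmoothChart M} {σ : LocalMetric M} {ξ : Coord}
    (hξ : ξ ∈ secDom φ σ) {k m : ℕ} (hm : m + 1 ≤ k) (μ ν : Fin 4) (α : Fin m → Fin 4) (y : Coord) :
    contactCoord hm μ ν α (secCoord k φ σ ξ) (fderiv ℝ (secCoord k φ σ) ξ y) = 0 := by
  have e : fderiv ℝ (secCoord k φ σ) ξ y =
      ∑ γ, y γ • totalDir (secCoord (k + 1) φ σ ξ) γ := by
    conv_lhs => rw [coord_eq_sum y]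
    rw [map_sum]
    exact Finset.sum_congr rfl fun γ _ => by rw [map_smul, fderiv_secCoord φ σ hξ]
  unfold contactCoord
  rw [fderiv_secCoord_fst φ σ hξ, e, map_sum, sub_eq_zero]
  refine Finset.sum_congr rfl fun γ _ => ?_
  rw [map_smul, evz_totalDir, evz_secCoord φ σ hξ, evz_secCoord φ σ hξ, smul_eq_mul, mul_comm]

theorem contactCoord_add {k m : ℕ} (hm : m + 1 ≤ k) (μ ν : Fin 4) (α : Fin m → Fin 4)
    (w v v' : JetModel k) : contactCoord hm μ ν α w (v + v') =
      contactCoord hm μ ν α w v + contactCoord hm μ ν α w v' := by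
  unfold contactCoord
  simp only [map_add, Prod.fst_add, PiLp.add_apply, mul_add, Finset.sum_add_distrib]
  ring

theorem contactCoord_vertical {k m : ℕ} (hm : m + 1 ≤ k) (μ ν : Fin 4) (α : Fin m → Fin 4)
    (w : JetModel k) {v : JetModel k} (hv : v.1 = 0) :
    contactCoord hm μ ν α w v = evz (Nat.le_of_succ_le hm) μ ν α v := by
  unfold contactCoord
  rw [hv]
  simp

/-- The values of the contact forms on a tangent vector are the derivatives of a field `h`, and in
other coordinates they are those of the transformed field: modulo vectors tangent to a section,
every tangent vector is vertical. -/
theorem exists_contact_field {φ ψ : SmoothChart M} {j : Jet 3 M} (hφ : j.base ∈ φ.1.source)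
    (hψ : j.base ∈ ψ.1.source) (v : JetTangent 3 M j) :
    ∃ h : Fin 4 → Fin 4 → Coord → ℝ, (∀ μ ν, ContDiff ℝ ∞ (h μ ν)) ∧ (∀ μ ν, h μ ν = h ν μ) ∧
      ∀ (m : ℕ) (hm : m + 1 ≤ 3) (μ ν : Fin 4) (α : Fin m → Fin 4),
        contactCoord hm μ ν α (Jet.coord φ j) (tangentCoord φ j v) =
          pd α (h μ ν) (φ.1 j.base) ∧
        contactCoord hm μ ν α (Jet.coord ψ j) (tangentCoord ψ j v) =
          pd α (pull (baseTrans φ ψ) h μ ν) (ψ.1 j.base) := by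
  obtain ⟨σ, hσ, hj⟩ := j.exists_section
  have hηV := mem_trans_source hφ hψ
  have hτ := contDiffAt_baseTrans φ ψ hηV
  have hτx : baseTrans φ ψ (ψ.1 j.base) = φ.1 j.base := baseTrans_apply φ ψ hψ
  have hjφ : Jet.coord φ j = secCoord 3 φ σ (φ.1 j.base) := by
    rw [secCoord, φ.1.left_inv hφ, hj]
  have hjψ : Jet.coord ψ j = secCoord 3 ψ σ (ψ.1 j.base) := by
    rw [secCoord, ψ.1.left_inv hψ, hj]
  have hDφ := mem_secDom hσ hφ
  have hDψ := mem_secDom hσ hψ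
  have hw : Jet.coord φ j ∈ jetTransDom 3 φ ψ := mem_jetTransDom hφ hψ
  -- the tangent vector of the section over the same vector of `M`
  set u := fderiv ℝ (secCoord 3 φ σ) (φ.1 j.base) (tangentCoord φ j v).1 with hu
  set z := (tangentCoord φ j v - u).2 with hz
  have hvz : tangentCoord φ j v = u + (0, z) := by
    refine Prod.ext ?_ (by simp [hz])
    simp [hu, fderiv_secCoord_fst φ σ hDφ]
  have hu' : fderiv ℝ (jetTrans 3 φ ψ) (Jet.coord φ j) u =
      fderiv ℝ (secCoord 3 ψ σ) (ψ.1 j.base) (tangentCoord ψ j v).1 := by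
    have hs : HasFDerivAt (secCoord 3 φ σ) (fderiv ℝ (secCoord 3 φ σ) (φ.1 j.base))
        (baseTrans φ ψ (ψ.1 j.base)) := by
      rw [hτx]; exact hasFDerivAt_secCoord φ σ hDφ
    have ht : HasFDerivAt (jetTrans 3 φ ψ) (fderiv ℝ (jetTrans 3 φ ψ) (Jet.coord φ j))
        (secCoord 3 φ σ (baseTrans φ ψ (ψ.1 j.base))) := by
      rw [hτx, ← hjφ]; exact hasFDerivAt_jetTrans φ ψ hw
    have hc := HasFDerivAt.comp (ψ.1 j.base) ht
      (HasFDerivAt.comp (ψ.1 j.base) hs (hτ.differentiableAt (by simp)).hasFDerivAt)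
    have he : secCoord 3 ψ σ =ᶠ[𝓝 (ψ.1 j.base)]
        jetTrans 3 φ ψ ∘ (secCoord 3 φ σ ∘ baseTrans φ ψ) := by
      filter_upwards [(ψ.1.symm ≫ₕ φ.1).open_source.mem_nhds hηV] with η hη
      exact (jetTrans_secCoord φ ψ σ hη).symm
    rw [(hc.congr_of_eventuallyEq he).fderiv, hu]
    show _ = fderiv ℝ (jetTrans 3 φ ψ) (Jet.coord φ j) (fderiv ℝ (secCoord 3 φ σ) (φ.1 j.base)
      (fderiv ℝ (baseTrans φ ψ) (ψ.1 j.base) (tangentCoord ψ j v).1))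
    congr 2
    ext α
    rw [fderiv_apply_eq_sum_jac, tangentCoord_fst_trans hφ hψ]
  obtain ⟨hv1, hv2⟩ := fderiv_jetTrans_vertical φ ψ hw z
  have hfst : (Jet.coord φ j).1 = φ.1 j.base := Jet.coord_fst φ hφ
  refine ⟨taylor (φ.1 j.base, z), fun μ ν => contDiff_taylor_right _ μ ν,
    fun μ ν => funext fun η => taylor_symm _ μ ν η, fun m hm μ ν α => ⟨?_, ?_⟩⟩
  · rw [hvz, contactCoord_add, hu, hjφ, contactCoord_fderiv_secCoord hDφ, zero_add,
      contactCoord_vertical _ _ _ _ _ rfl, evz_taylor _ _ (Nat.le_of_succ_le hm)]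
    rfl
  · rw [tangentCoord_trans hφ hψ, hvz, map_add, contactCoord_add, hu', hjψ,
      contactCoord_fderiv_secCoord hDψ, zero_add, contactCoord_vertical _ _ _ _ _ hv1,
      hv2 m (Nat.le_of_succ_le hm), hfst, φ.1.left_inv hφ]

/-- The De Donder form does not depend on the coordinates: `exists_contact_field` turns the contact
part into the current of a field, which is a vector density by `current_transform`, and inserting a
vector density into `d₄x` is invariant. -/
theorem deDonderVal_transform {φ ψ : SmoothChart M} {L L' : JetModel 2 → ℝ}
    (hL : ContDiffOn ℝ ∞ L (Jet.coordTarget 2 φ)) (hL' : ContDiffOn ℝ ∞ L' (Jet.coordTarget 2 ψ))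
    (hLL' : IsDensityPair φ ψ L L') {j : Jet 3 M} (hφ : j.base ∈ φ.1.source)
    (hψ : j.base ∈ ψ.1.source) (v : Fin 4 → JetTangent 3 M j) :
    deDonderVal L' (Jet.coord ψ j) (fun i => tangentCoord ψ j (v i)) =
      deDonderVal L (Jet.coord φ j) (fun i => tangentCoord φ j (v i)) := by
  set A := jac (baseTrans φ ψ) (ψ.1 j.base) with hA
  have hJ : A.det ≠ 0 := det_jac_baseTrans_ne_zero hφ hψ
  have hv : ∀ i α, (tangentCoord φ j (v i)).1 α = ∑ a, (tangentCoord ψ j (v i)).1 a * A a α :=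
    fun i α => tangentCoord_fst_trans hφ hψ (v i) α
  have hfφ : (Jet.coord φ j).1 = φ.1 j.base := Jet.coord_fst φ hφ
  have hfψ : (Jet.coord ψ j).1 = ψ.1 j.base := Jet.coord_fst ψ hψ
  -- the boundary vectors are vector densities
  have hB : ∀ i β, ∑ a, boundaryVec (fun μ ν α β => momentum₂ L' μ ν α β (Jet.coord ψ j))
        (fun μ ν α => momentum₁ L' μ ν α (Jet.coord ψ j)) (Jet.coord ψ j)
        (tangentCoord ψ j (v i)) a * A a β =
      A.det * boundaryVec (fun μ ν α β => momentum₂ L μ ν α β (Jet.coord φ j))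
        (fun μ ν α => momentum₁ L μ ν α (Jet.coord φ j)) (Jet.coord φ j)
        (tangentCoord φ j (v i)) β := by
    intro i β
    obtain ⟨h, hh, hsymm, hc⟩ := exists_contact_field hφ hψ (v i)
    have ht := current_transform hL hL' hLL' hφ hψ hh hsymm β
    have hp : ∀ μ ν, ContDiffAt ℝ ∞ (pull (baseTrans φ ψ) h μ ν) (ψ.1 j.base) := fun μ ν =>
      contDiffAt_pull (contDiffAt_baseTrans φ ψ (mem_trans_source hφ hψ))
        (fun a b => (hh a b).contDiffAt) μ ν
    have e1 : ∀ β, boundaryVec (fun μ ν α β => momentum₂ L μ ν α β (Jet.coord φ j))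
        (fun μ ν α => momentum₁ L μ ν α (Jet.coord φ j)) (Jet.coord φ j)
        (tangentCoord φ j (v i)) β = current L (Jet.coord φ j) h β := by
      intro β
      unfold boundaryVec current
      simp only [fun μ ν α => (hc 1 (by norm_num) μ ν ![α]).1,
        fun μ ν => (hc 0 (by norm_num) μ ν ![]).1,
        fun μ ν α => pd_one (hh μ ν).contDiffAt (ξ := φ.1 j.base) α, pd_zero, hfφ]
    have e2 : ∀ β, boundaryVec (fun μ ν α β => momentum₂ L' μ ν α β (Jet.coord ψ j))
        (fun μ ν α => momentum₁ L' μ ν α (Jet.coord ψ j)) (Jet.coord ψ j)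
        (tangentCoord ψ j (v i)) β = current L' (Jet.coord ψ j) (pull (baseTrans φ ψ) h) β := by
      intro β
      unfold boundaryVec current
      simp only [fun μ ν α => (hc 1 (by norm_num) μ ν ![α]).2,
        fun μ ν => (hc 0 (by norm_num) μ ν ![]).2,
        fun μ ν α => pd_one (hp μ ν) α, pd_zero, hfψ]
    rw [e1, ← ht]
    exact Finset.sum_congr rfl fun a _ => by rw [e2, mul_comm]
  have hlag : L' (truncate (by norm_num) (Jet.coord ψ j)) =
      A.det * L (truncate (by norm_num) (Jet.coord φ j)) := by
    have := hLL' (j.forget (by norm_num)) (by rw [Jet.base_forget]; exact hφ)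
      (by rw [Jet.base_forget]; exact hψ)
    rwa [Jet.base_forget, Jet.coord_forget (by norm_num) φ hφ,
      Jet.coord_forget (by norm_num) ψ hψ] at this
  unfold deDonderVal formVal
  simp only [sum_mul_det_vecCons]
  congr 1
  · have : (Matrix.of fun i μ => (tangentCoord φ j (v i)).1 μ) =
        (Matrix.of fun i μ => (tangentCoord ψ j (v i)).1 μ) * A := by
      ext i α
      rw [Matrix.mul_apply, Matrix.of_apply, hv]
      rfl
    rw [this, Matrix.det_mul, hlag]
    ring
  · refine Finset.sum_congr rfl fun i _ => ?_
    congr 1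
    set B' := boundaryVec (fun μ ν α β => momentum₂ L' μ ν α β (Jet.coord ψ j))
      (fun μ ν α => momentum₁ L' μ ν α (Jet.coord ψ j)) (Jet.coord ψ j) (tangentCoord ψ j (v i))
    set B := boundaryVec (fun μ ν α β => momentum₂ L μ ν α β (Jet.coord φ j))
      (fun μ ν α => momentum₁ L μ ν α (Jet.coord φ j)) (Jet.coord φ j) (tangentCoord φ j (v i))
    set r' : Fin 3 → Fin 4 → ℝ :=
      fun l μ => (i.removeNth (fun i => tangentCoord ψ j (v i)) l : JetModel 3).1 μ
    set r : Fin 3 → Fin 4 → ℝ :=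
      fun l μ => (i.removeNth (fun i => tangentCoord φ j (v i)) l : JetModel 3).1 μ
    have hmul : (Matrix.of (Matrix.vecCons B' r') : Matrix (Fin 4) (Fin 4) ℝ) * A =
        Matrix.of (Matrix.vecCons (A.det • B) r) := by
      ext l β
      rw [Matrix.mul_apply]
      refine Fin.cases ?_ (fun l => ?_) l
      · exact hB i β
      · exact (hv _ β).symm
    have h1 := congrArg Matrix.det hmul
    rw [Matrix.det_mul] at h1
    have h2 : (Matrix.of (Matrix.vecCons (A.det • B) r) : Matrix (Fin 4) (Fin 4) ℝ).det =
        A.det * (Matrix.of (Matrix.vecCons B r) : Matrix (Fin 4) (Fin 4) ℝ).det := by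
      rw [← sum_mul_det_vecCons, ← sum_mul_det_vecCons, Finset.mul_sum]
      exact Finset.sum_congr rfl fun β _ => by simp [mul_assoc]
    rw [h2, mul_comm] at h1
    exact mul_left_cancel₀ hJ h1

end

section

variable {M : Type*} [TopologicalSpace M] [ChartedSpace Coord M] [IsManifold (𝓡 4) ∞ M]

/-! ### De Donder forms in a chart -/

theorem wedge_intd4x_apply {φ : SmoothChart M} {j : Jet 3 M} (hj : j.base ∈ φ.1.source)
    (θ : JetTangent 3 M j →ₗ[ℝ] ℝ) (β : Fin 4) (v : Fin 4 → JetTangent 3 M j) :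
    wedge θ (intd4x φ β j) v = ∑ i : Fin 4, (-1) ^ (i : ℕ) * (θ (v i) *
      (Matrix.of (Matrix.vecCons (Pi.single β 1)
        fun l μ => (i.removeNth (fun i => tangentCoord φ j (v i)) l : JetModel 3).1 μ)).det) := by
  unfold wedge
  rw [AlternatingMap.alternatizeUncurryFin_apply]
  refine Finset.sum_congr rfl fun i _ => ?_
  have e : (fun l => LinearMap.pi (fun μ => dx φ μ j) (i.removeNth v l)) =
      fun l μ => (i.removeNth (fun i => tangentCoord φ j (v i)) l : JetModel 3).1 μ := by
    funext l μ
    exact dx_apply hj μ _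
  have e2 : intd4x φ β j (i.removeNth v) = (Matrix.of (Matrix.vecCons (Pi.single β 1)
        fun l μ => (i.removeNth (fun i => tangentCoord φ j (v i)) l : JetModel 3).1 μ)).det := by
    rw [← e]; rfl
  rw [LinearMap.smulRight_apply, AlternatingMap.smul_apply, e2]
  simp

theorem sum_mul_sum_rearrange (s : Fin 4 → ℝ) (P₂ : Fin 4 → Fin 4 → Fin 4 → Fin 4 → ℝ)
    (P₁ : Fin 4 → Fin 4 → Fin 4 → ℝ) (C₁ : Fin 4 → Fin 4 → Fin 4 → Fin 4 → ℝ)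
    (C₀ : Fin 4 → Fin 4 → Fin 4 → ℝ) (D : Fin 4 → Fin 4 → ℝ) :
    ∑ μ, ∑ ν, ∑ α, ∑ β, P₂ μ ν α β * ∑ i, s i * (C₁ μ ν α i * D i β) +
      ∑ μ, ∑ ν, ∑ α, P₁ μ ν α * ∑ i, s i * (C₀ μ ν i * D i α) =
    ∑ i, s i * ∑ β,
      (∑ μ, ∑ ν, (∑ α, P₂ μ ν α β * C₁ μ ν α i + P₁ μ ν β * C₀ μ ν i)) * D i β := by
  have sum3 : ∀ F : Fin 4 → Fin 4 → Fin 4 → ℝ,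
      ∑ i, ∑ β, ∑ μ, F i β μ = ∑ μ, ∑ β, ∑ i, F i β μ := fun F =>
    Finset.sum_comm.trans ((Finset.sum_congr rfl fun β _ => Finset.sum_comm).trans Finset.sum_comm)
  have sum4 : ∀ F : Fin 4 → Fin 4 → Fin 4 → Fin 4 → ℝ,
      ∑ i, ∑ β, ∑ μ, ∑ ν, F i β μ ν = ∑ μ, ∑ ν, ∑ β, ∑ i, F i β μ ν := fun F =>
    (sum3 fun i β μ => ∑ ν, F i β μ ν).trans (Finset.sum_congr rfl fun μ _ =>
      (sum3 fun β i ν => F i β μ ν).trans (Finset.sum_congr rfl fun ν _ => Finset.sum_comm))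
  have sum5 : ∀ F : Fin 4 → Fin 4 → Fin 4 → Fin 4 → Fin 4 → ℝ,
      ∑ i, ∑ β, ∑ μ, ∑ ν, ∑ α, F i β μ ν α = ∑ μ, ∑ ν, ∑ α, ∑ β, ∑ i, F i β μ ν α := fun F =>
    (sum4 fun i β μ ν => ∑ α, F i β μ ν α).trans (Finset.sum_congr rfl fun μ _ =>
      Finset.sum_congr rfl fun ν _ => (sum3 fun β i α => F i β μ ν α).trans
        (Finset.sum_congr rfl fun α _ => Finset.sum_comm))
  have h : ∀ i, s i * ∑ β,
      (∑ μ, ∑ ν, (∑ α, P₂ μ ν α β * C₁ μ ν α i + P₁ μ ν β * C₀ μ ν i)) * D i β =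
      (∑ β, ∑ μ, ∑ ν, ∑ α, P₂ μ ν α β * (s i * (C₁ μ ν α i * D i β))) +
        ∑ β, ∑ μ, ∑ ν, P₁ μ ν β * (s i * (C₀ μ ν i * D i β)) := by
    intro i
    rw [Finset.mul_sum, ← Finset.sum_add_distrib]
    refine Finset.sum_congr rfl fun β _ => ?_
    simp only [Finset.sum_add_distrib, add_mul, mul_add, Finset.sum_mul, Finset.mul_sum]
    congr 1
    · exact Finset.sum_congr rfl fun μ _ => Finset.sum_congr rfl fun ν _ =>
        Finset.sum_congr rfl fun α _ => by ring
    · exact Finset.sum_congr rfl fun μ _ => Finset.sum_congr rfl fun ν _ => by ring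
  rw [Finset.sum_congr rfl fun i _ => h i, Finset.sum_add_distrib]
  simp only [Finset.mul_sum]
  exact congrArg₂ (· + ·) (sum5 fun i β μ ν α => P₂ μ ν α β * (s i * (C₁ μ ν α i * D i β))).symm
    (sum4 fun i β μ ν => P₁ μ ν β * (s i * (C₀ μ ν i * D i β))).symm

/-- The local expression of the De Donder form, evaluated in coordinates. -/
theorem localForm_apply {φ : SmoothChart M} {j : Jet 3 M} (hj : j.base ∈ φ.1.source) (ℓ : ℝ)
    (P₂ : Fin 4 → Fin 4 → Fin 4 → Fin 4 → ℝ) (P₁ : Fin 4 → Fin 4 → Fin 4 → ℝ)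
    (v : Fin 4 → JetTangent 3 M j) :
    (ℓ • d4x φ j + ∑ μ, ∑ ν, ∑ α, ∑ β, P₂ μ ν α β •
        wedge (contact φ (m := 1) (by norm_num) μ ν ![α] j) (intd4x φ β j) +
      ∑ μ, ∑ ν, ∑ α, P₁ μ ν α •
        wedge (contact φ (m := 0) (by norm_num) μ ν ![] j) (intd4x φ α j)) v =
      formVal ℓ P₂ P₁ (Jet.coord φ j) (fun i => tangentCoord φ j (v i)) := by
  set D : Fin 4 → Fin 4 → ℝ := fun i β => (Matrix.of (Matrix.vecCons (Pi.single β 1)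
    fun l μ => (i.removeNth (fun i => tangentCoord φ j (v i)) l : JetModel 3).1 μ)).det with hD
  set C₁ : Fin 4 → Fin 4 → Fin 4 → Fin 4 → ℝ := fun μ ν α i =>
    contactCoord (m := 1) (k := 3) (by norm_num) μ ν ![α] (Jet.coord φ j) (tangentCoord φ j (v i))
  set C₀ : Fin 4 → Fin 4 → Fin 4 → ℝ := fun μ ν i =>
    contactCoord (m := 0) (k := 3) (by norm_num) μ ν ![] (Jet.coord φ j) (tangentCoord φ j (v i))
  have hsum : ∀ (f : Fin 4 → JetTangent 3 M j [⋀^Fin 4]→ₗ[ℝ] ℝ), (∑ x, f x) v = ∑ x, f x v :=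
    fun f => by
      simp only [Fin.sum_univ_four, AlternatingMap.add_apply]
  have hw : ∀ (θ : JetTangent 3 M j →ₗ[ℝ] ℝ) β, wedge θ (intd4x φ β j) v =
      ∑ i : Fin 4, (-1) ^ (i : ℕ) * (θ (v i) * D i β) := fun θ β => wedge_intd4x_apply hj θ β v
  have l : formVal ℓ P₂ P₁ (Jet.coord φ j) (fun i => tangentCoord φ j (v i)) =
      ℓ * d4x φ j v + ∑ i : Fin 4, (-1) ^ (i : ℕ) * ∑ β,
        (∑ μ, ∑ ν, (∑ α, P₂ μ ν α β * C₁ μ ν α i + P₁ μ ν β * C₀ μ ν i)) * D i β := by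
    rw [d4x_apply hj]
    rfl
  rw [l]
  simp only [AlternatingMap.add_apply, hsum, AlternatingMap.smul_apply, hw, smul_eq_mul,
    contact_apply hj]
  rw [add_assoc]
  congr 1
  exact sum_mul_sum_rearrange _ P₂ P₁ C₁ C₀ D

theorem partialZ_eq {φ : SmoothChart M} {L : Jet 2 M → ℝ} {ℓ : JetModel 2 → ℝ}
    (h : ∀ j : Jet 2 M, j.base ∈ φ.1.source → L j = ℓ (Jet.coord φ j)) {j : Jet 2 M}
    (hj : j.base ∈ φ.1.source) {m : ℕ} (μ ν : Fin 4) (α : Fin m → Fin 4) :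
    partialZ φ L μ ν α j = coeffZ ℓ μ ν α (Jet.coord φ j) := by
  unfold partialZ coeffZ
  have e : (fun w => L ((Jet.chart 2 φ).symm w)) =ᶠ[𝓝 (Jet.coord φ j)] ℓ := by
    filter_upwards [(Jet.isOpen_coordTarget φ).mem_nhds (Jet.coord_mem φ hj)] with w hw
    rw [h _ (base_chart_symm φ hw), coord_chart_symm φ hw]
  rw [e.fderiv_eq]

/-- The defining equations of the momenta along a section: `∂/∂x^β` of a function along the section
is its total derivative. -/
theorem momentum_section {φ : SmoothChart M} {L : Jet 2 M → ℝ} {ℓ : JetModel 2 → ℝ}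
    (hℓ : ContDiffOn ℝ ∞ ℓ (Jet.coordTarget 2 φ))
    (h : ∀ j : Jet 2 M, j.base ∈ φ.1.source → L j = ℓ (Jet.coord φ j)) {σ : LocalMetric M} {x : M}
    (hx : x ∈ σ.dom) (hφ : x ∈ φ.1.source) (μ ν α : Fin 4) :
    (∀ β, partialZ φ L μ ν ![α, β] (σ.jet 2 x) =
      momentum₂ ℓ μ ν α β (Jet.coord φ (σ.jet 3 x))) ∧
    partialZ φ L μ ν ![α] (σ.jet 2 x) -
      ∑ β, partialX φ (fun x' => partialZ φ L μ ν ![α, β] (σ.jet 2 x')) β x =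
      momentum₁ ℓ μ ν α (Jet.coord φ (σ.jet 3 x)) := by
  have hb2 : (σ.jet 2 x).base ∈ φ.1.source := by rw [LocalMetric.base_jet]; exact hφ
  have hb3 : (σ.jet 3 x).base ∈ φ.1.source := by rw [LocalMetric.base_jet]; exact hφ
  have htr : truncate (by norm_num) (Jet.coord φ (σ.jet 3 x)) = Jet.coord φ (σ.jet 2 x) := by
    rw [← Jet.coord_forget (by norm_num) φ hb3, LocalMetric.forget_jet _ hx]
  have hD := mem_secDom hx hφ
  have hs2 : secCoord 2 φ σ (φ.1 x) = Jet.coord φ (σ.jet 2 x) := by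
    rw [secCoord, φ.1.left_inv hφ]
  have hs3 : secCoord 3 φ σ (φ.1 x) = Jet.coord φ (σ.jet 3 x) := by
    rw [secCoord, φ.1.left_inv hφ]
  have hX : ∀ β, partialX φ (fun x' => partialZ φ L μ ν ![α, β] (σ.jet 2 x')) β x =
      fderiv ℝ (coeffZ ℓ μ ν ![α, β]) (Jet.coord φ (σ.jet 2 x))
        (totalDir (Jet.coord φ (σ.jet 3 x)) β) := by
    intro β
    have e : (fun ξ => partialZ φ L μ ν ![α, β] (σ.jet 2 (φ.1.symm ξ))) =ᶠ[𝓝 (φ.1 x)]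
        coeffZ ℓ μ ν ![α, β] ∘ secCoord 2 φ σ := by
      filter_upwards [(isOpen_secDom φ σ).mem_nhds hD] with ξ hξ
      exact partialZ_eq h (by rw [LocalMetric.base_jet]; exact φ.1.map_target hξ.1) μ ν _
    have hd : HasFDerivAt (coeffZ ℓ μ ν ![α, β])
        (fderiv ℝ (coeffZ ℓ μ ν ![α, β]) (Jet.coord φ (σ.jet 2 x))) (secCoord 2 φ σ (φ.1 x)) := by
      rw [hs2]
      exact (((contDiffOn_coeffZ (Jet.isOpen_coordTarget φ) hℓ μ ν ![α, β]).contDiffAt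
        ((Jet.isOpen_coordTarget φ).mem_nhds (Jet.coord_mem φ hb2))).differentiableAt
          (by simp)).hasFDerivAt
    have hc := hd.comp (φ.1 x) (hasFDerivAt_secCoord φ σ hD)
    unfold partialX
    rw [e.fderiv_eq, hc.fderiv, ContinuousLinearMap.comp_apply, fderiv_secCoord φ σ hD, hs3]
  refine ⟨fun β => ?_, ?_⟩
  · rw [partialZ_eq h hb2, momentum₂, htr]
  · rw [partialZ_eq h hb2, momentum₁, htr]
    simp only [hX]

/-- The De Donder form in the coordinates `φ` exists and is unique over the chart domain: it is
given by `deDonderVal`. -/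
theorem isDeDonderIn_iff {Λ : JetForm 2 M} (hΛ : IsLagrangeForm Λ) (φ : SmoothChart M)
    (Θ : JetForm 3 M) : IsDeDonderIn φ Λ Θ ↔ ∀ j : Jet 3 M, j.base ∈ φ.1.source →
      ∀ v, Θ j v = deDonderVal (lagrangian Λ φ) (Jet.coord φ j)
        (fun i => tangentCoord φ j (v i)) := by
  have hℓ := hΛ.contDiffOn_lagrangian φ
  constructor
  · rintro ⟨L, p₂, p₁, hL, h₂, h₁, hΘ⟩ j hj v
    have hLℓ : ∀ j : Jet 2 M, j.base ∈ φ.1.source → L j = lagrangian Λ φ (Jet.coord φ j) := by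
      intro j hj
      obtain ⟨u, -, hu⟩ := exists_d4x_eq_one hj
      have h := congrArg (fun f => f u) ((hL j hj).symm.trans (hΛ.eq_smul hj))
      simpa only [AlternatingMap.smul_apply, smul_eq_mul, hu, mul_one] using h
    obtain ⟨σ, hσ, hjσ⟩ := j.exists_section
    have e₂ : ∀ μ ν α β, p₂ μ ν α β j = momentum₂ (lagrangian Λ φ) μ ν α β (Jet.coord φ j) := by
      intro μ ν α β
      have h := h₂ σ j.base ⟨hσ, hj⟩ μ ν α β
      rwa [(momentum_section hℓ hLℓ hσ hj μ ν α).1 β, hjσ] at h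
    have e₁ : ∀ μ ν α, p₁ μ ν α j = momentum₁ (lagrangian Λ φ) μ ν α (Jet.coord φ j) := by
      intro μ ν α
      have h := h₁ σ j.base ⟨hσ, hj⟩ μ ν α
      rwa [(momentum_section hℓ hLℓ hσ hj μ ν α).2, hjσ] at h
    rw [hΘ j hj, localForm_apply hj, hLℓ _ (by rw [Jet.base_forget]; exact hj),
      Jet.coord_forget _ φ hj]
    simp only [e₁, e₂]
    rfl
  · intro h
    refine ⟨fun j => lagrangian Λ φ (Jet.coord φ j),
      fun μ ν α β j => momentum₂ (lagrangian Λ φ) μ ν α β (Jet.coord φ j),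
      fun μ ν α j => momentum₁ (lagrangian Λ φ) μ ν α (Jet.coord φ j),
      fun j hj => hΛ.eq_smul hj, ?_, ?_, fun j hj => ?_⟩
    · rintro σ x ⟨hx, hφ⟩ μ ν α β
      exact ((momentum_section hℓ (fun _ _ => rfl) hx hφ μ ν α).1 β).symm
    · rintro σ x ⟨hx, hφ⟩ μ ν α
      exact (momentum_section hℓ (fun _ _ => rfl) hx hφ μ ν α).2.symm
    · refine AlternatingMap.ext fun v => ?_
      rw [h j hj v, localForm_apply hj]
      beta_reduce
      rw [Jet.coord_forget _ φ hj]
      rfl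

/-- The De Donder form of `Λ` in the coordinates `φ`. -/
def deDonderIn (φ : SmoothChart M) (Λ : JetForm 2 M) : JetForm 3 M := fun j =>
  lagrangian Λ φ (truncate (by norm_num) (Jet.coord φ j)) • d4x φ j +
    ∑ μ, ∑ ν, ∑ α, ∑ β, momentum₂ (lagrangian Λ φ) μ ν α β (Jet.coord φ j) •
      wedge (contact φ (m := 1) (by norm_num) μ ν ![α] j) (intd4x φ β j) +
    ∑ μ, ∑ ν, ∑ α, momentum₁ (lagrangian Λ φ) μ ν α (Jet.coord φ j) •
      wedge (contact φ (m := 0) (by norm_num) μ ν ![] j) (intd4x φ α j)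

theorem deDonderIn_apply {φ : SmoothChart M} (Λ : JetForm 2 M) {j : Jet 3 M}
    (hj : j.base ∈ φ.1.source) (v : Fin 4 → JetTangent 3 M j) :
    deDonderIn φ Λ j v = deDonderVal (lagrangian Λ φ) (Jet.coord φ j)
      (fun i => tangentCoord φ j (v i)) :=
  localForm_apply hj _ _ _ v

/-! ### The global De Donder form -/

/-- The De Donder form of `Λ`: at each jet the form in the preferred chart of `M` at its base point.
The choice of the chart does not matter, by `deDonderForm_apply`. -/
def deDonderForm (Λ : JetForm 2 M) : JetForm 3 M := fun j =>
  deDonderIn (Jet.chartAt' j.base) Λ j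

theorem deDonderForm_apply {Λ : JetForm 2 M} (hΛ : IsLagrangeForm Λ) {φ : SmoothChart M}
    {j : Jet 3 M} (hj : j.base ∈ φ.1.source) (v : Fin 4 → JetTangent 3 M j) :
    deDonderForm Λ j v = deDonderVal (lagrangian Λ φ) (Jet.coord φ j)
      (fun i => tangentCoord φ j (v i)) := by
  have hx : j.base ∈ (Jet.chartAt' j.base).1.source := mem_chart_source Coord j.base
  refine (deDonderIn_apply Λ hx v).trans ?_
  exact deDonderVal_transform (hΛ.contDiffOn_lagrangian φ) (hΛ.contDiffOn_lagrangian _)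
    (hΛ.isDensityPair _ _) hj hx v

theorem isDeDonderIn_deDonderForm {Λ : JetForm 2 M} (hΛ : IsLagrangeForm Λ) (φ : SmoothChart M) :
    IsDeDonderIn φ Λ (deDonderForm Λ) :=
  (isDeDonderIn_iff hΛ φ _).2 fun _ hj v => deDonderForm_apply hΛ hj v

theorem IsDeDonderIn.eq_deDonderForm {Λ : JetForm 2 M} (hΛ : IsLagrangeForm Λ) {φ : SmoothChart M}
    {Θ : JetForm 3 M} (h : IsDeDonderIn φ Λ Θ) {j : Jet 3 M} (hj : j.base ∈ φ.1.source) :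
    Θ j = deDonderForm Λ j :=
  AlternatingMap.ext fun v => by
    rw [(isDeDonderIn_iff hΛ φ Θ).1 h j hj v, deDonderForm_apply hΛ hj]

theorem contDiffOn_momentum₂ {S : Set (JetModel 2)} (hS : IsOpen S) {L : JetModel 2 → ℝ}
    (hL : ContDiffOn ℝ ∞ L S) (μ ν α β : Fin 4) :
    ContDiffOn ℝ ∞ (momentum₂ L μ ν α β) (truncate (by norm_num) ⁻¹' S : Set (JetModel 3)) :=
  (contDiffOn_coeffZ hS hL μ ν ![α, β]).comp (contDiff_truncate _).contDiffOn fun _ h => h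

theorem contDiff_totalDir {k : ℕ} (γ : Fin 4) :
    ContDiff ℝ ∞ (fun w : JetModel (k + 1) => totalDir w γ) := by
  let T : JetModel (k + 1) →ₗ[ℝ] JetFib k :=
    { toFun := fun w => (totalDir w γ).2
      map_add' := fun _ _ => rfl
      map_smul' := fun _ _ => rfl }
  exact contDiff_const.prodMk T.toContinuousLinearMap.contDiff

theorem contDiffOn_momentum₁ {S : Set (JetModel 2)} (hS : IsOpen S) {L : JetModel 2 → ℝ}
    (hL : ContDiffOn ℝ ∞ L S) (μ ν α : Fin 4) :
    ContDiffOn ℝ ∞ (momentum₁ L μ ν α) (truncate (by norm_num) ⁻¹' S : Set (JetModel 3)) := by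
  have ht : ContDiffOn ℝ ∞ (truncate (by norm_num) : JetModel 3 → JetModel 2)
      (truncate (by norm_num) ⁻¹' S : Set (JetModel 3)) := (contDiff_truncate _).contDiffOn
  refine ((contDiffOn_coeffZ hS hL μ ν ![α]).comp ht fun _ h => h).sub
    (ContDiffOn.sum fun β _ => ?_)
  exact (((contDiffOn_coeffZ hS hL μ ν ![α, β]).fderiv_of_isOpen hS (m := ∞)
    (infty_add_le 1)).comp ht fun _ h => h).clm_apply (contDiff_totalDir β).contDiffOn

theorem contDiffOn_deDonderVal {S : Set (JetModel 2)} (hS : IsOpen S) {L : JetModel 2 → ℝ}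
    (hL : ContDiffOn ℝ ∞ L S) (v : Fin 4 → JetModel 3) :
    ContDiffOn ℝ ∞ (fun w => deDonderVal L w v)
      (truncate (by norm_num) ⁻¹' S : Set (JetModel 3)) := by
  have hc : ∀ {m : ℕ} (hm : m + 1 ≤ 3) (μ ν : Fin 4) (α : Fin m → Fin 4) (v : JetModel 3),
      ContDiffOn ℝ ∞ (fun w => contactCoord hm μ ν α w v)
        (truncate (by norm_num) ⁻¹' S : Set (JetModel 3)) := fun hm μ ν α v =>
    contDiffOn_const.sub (ContDiffOn.sum fun γ _ =>
      (evz hm μ ν (Fin.snoc α γ)).contDiff.contDiffOn.mul contDiffOn_const)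
  unfold deDonderVal formVal boundaryVec
  refine ContDiffOn.add (ContDiffOn.mul ?_ contDiffOn_const) (ContDiffOn.sum fun i _ =>
    contDiffOn_const.mul (ContDiffOn.sum fun β _ => ContDiffOn.mul (ContDiffOn.sum fun μ _ =>
      ContDiffOn.sum fun ν _ => ContDiffOn.add (ContDiffOn.sum fun α _ =>
        (contDiffOn_momentum₂ hS hL μ ν α β).mul (hc _ _ _ _ _))
        ((contDiffOn_momentum₁ hS hL μ ν β).mul (hc _ _ _ _ _))) contDiffOn_const))
  exact hL.comp (contDiff_truncate _).contDiffOn fun _ h => h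

theorem isSmooth_deDonderForm {Λ : JetForm 2 M} (hΛ : IsLagrangeForm Λ) :
    (deDonderForm Λ).IsSmooth := by
  intro φ v
  refine ((contDiffOn_deDonderVal (Jet.isOpen_coordTarget φ) (hΛ.contDiffOn_lagrangian φ) v).mono
    fun w hw => ?_).congr fun w hw => ?_
  · exact (hw : w ∈ Jet.coordTarget 3 φ)
  · refine (deDonderForm_apply hΛ (base_chart_symm φ hw) _).trans ?_
    rw [coord_chart_symm φ hw]
    congr 1
    funext i
    exact tangentCoord_ofTangentCoord φ hw (v i)

theorem IsDeDonder.eq_deDonderForm {𝒪 : OrientedAtlas M} {Λ : JetForm 2 M}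
    (hΛ : IsLagrangeForm Λ) {Θ : JetForm 3 M} (h : IsDeDonder 𝒪 Λ Θ) : Θ = deDonderForm Λ := by
  funext j
  obtain ⟨φ, hφ, hj⟩ := 𝒪.covers j.base
  exact (h.eq φ hφ).eq_deDonderForm hΛ hj

theorem isDeDonder_deDonderForm (𝒪 : OrientedAtlas M) {Λ : JetForm 2 M} (hΛ : IsLagrangeForm Λ) :
    IsDeDonder 𝒪 Λ (deDonderForm Λ) :=
  ⟨isSmooth_deDonderForm hΛ, fun φ _ => isDeDonderIn_deDonderForm hΛ φ⟩

/-! ### Linearity and order -/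

theorem IsLagrangeForm.lin {Λ₁ Λ₂ : JetForm 2 M} (h₁ : IsLagrangeForm Λ₁) (h₂ : IsLagrangeForm Λ₂)
    (a b : ℝ) : IsLagrangeForm (a • Λ₁ + b • Λ₂) where
  smooth φ v := (contDiffOn_const.mul (h₁.smooth φ v)).add (contDiffOn_const.mul (h₂.smooth φ v))
  semibasic j v hv := by
    show a * Λ₁ j v + b * Λ₂ j v = 0
    rw [h₁.semibasic j v hv, h₂.semibasic j v hv]
    simp

theorem deDonderVal_lin {S : Set (JetModel 2)} (hS : IsOpen S) {L₁ L₂ : JetModel 2 → ℝ}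
    (h₁ : ContDiffOn ℝ ∞ L₁ S) (h₂ : ContDiffOn ℝ ∞ L₂ S) (a b : ℝ) {w : JetModel 3}
    (hw : truncate (by norm_num) w ∈ S) (v : Fin 4 → JetModel 3) :
    deDonderVal (fun w => a * L₁ w + b * L₂ w) w v =
      a * deDonderVal L₁ w v + b * deDonderVal L₂ w v := by
  have hd : ∀ {L : JetModel 2 → ℝ}, ContDiffOn ℝ ∞ L S → ∀ w ∈ S, DifferentiableAt ℝ L w :=
    fun hL w hw => (hL.contDiffAt (hS.mem_nhds hw)).differentiableAt (by simp)
  have hlin : ∀ {L L' : JetModel 2 → ℝ}, ContDiffOn ℝ ∞ L S → ContDiffOn ℝ ∞ L' S → ∀ w ∈ S, ∀ e,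
      fderiv ℝ (fun w => a * L w + b * L' w) w e = a * fderiv ℝ L w e + b * fderiv ℝ L' w e := by
    intro L L' hL hL' w hw e
    rw [fderiv_fun_add ((hd hL w hw).const_mul a) ((hd hL' w hw).const_mul b),
      fderiv_const_mul (hd hL w hw), fderiv_const_mul (hd hL' w hw)]
    rfl
  have hc : ∀ {m : ℕ} (μ ν : Fin 4) (α : Fin m → Fin 4), ∀ w ∈ S,
      coeffZ (fun w => a * L₁ w + b * L₂ w) μ ν α w =
        a * coeffZ L₁ μ ν α w + b * coeffZ L₂ μ ν α w := fun μ ν α w hw => hlin h₁ h₂ w hw _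
  have hc' : ∀ {m : ℕ} (μ ν : Fin 4) (α : Fin m → Fin 4) (e : JetModel 2),
      fderiv ℝ (coeffZ (fun w => a * L₁ w + b * L₂ w) μ ν α) (truncate (by norm_num) w) e =
        a * fderiv ℝ (coeffZ L₁ μ ν α) (truncate (by norm_num) w) e +
          b * fderiv ℝ (coeffZ L₂ μ ν α) (truncate (by norm_num) w) e := by
    intro m μ ν α e
    rw [← hlin (contDiffOn_coeffZ hS h₁ μ ν α) (contDiffOn_coeffZ hS h₂ μ ν α) _ hw]
    have : coeffZ (fun w => a * L₁ w + b * L₂ w) μ ν α =ᶠ[𝓝 (truncate (by norm_num) w)]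
        fun w => a * coeffZ L₁ μ ν α w + b * coeffZ L₂ μ ν α w := by
      filter_upwards [hS.mem_nhds hw] with w hw using hc μ ν α w hw
    rw [this.fderiv_eq]
  unfold deDonderVal
  rw [← formVal_lin]
  congr 1
  · funext μ ν α β
    exact hc μ ν _ _ hw
  · funext μ ν α
    unfold momentum₁
    rw [hc μ ν _ _ hw]
    simp only [hc', Finset.sum_add_distrib, ← Finset.mul_sum]
    ring

theorem deDonderForm_lin {Λ₁ Λ₂ : JetForm 2 M} (h₁ : IsLagrangeForm Λ₁) (h₂ : IsLagrangeForm Λ₂)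
    (a b : ℝ) : deDonderForm (a • Λ₁ + b • Λ₂) = a • deDonderForm Λ₁ + b • deDonderForm Λ₂ := by
  funext j
  refine AlternatingMap.ext fun v => ?_
  have hx : j.base ∈ (Jet.chartAt' j.base).1.source := mem_chart_source Coord j.base
  have hw : truncate (by norm_num) (Jet.coord (Jet.chartAt' j.base) j) ∈
      Jet.coordTarget 2 (Jet.chartAt' j.base) := Jet.coord_mem (Jet.chartAt' j.base) hx
  show _ = a * deDonderForm Λ₁ j v + b * deDonderForm Λ₂ j v
  rw [deDonderForm_apply (h₁.lin h₂ a b) hx, deDonderForm_apply h₁ hx, deDonderForm_apply h₂ hx]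
  exact deDonderVal_lin (Jet.isOpen_coordTarget _) (h₁.contDiffOn_lagrangian _)
    (h₂.contDiffOn_lagrangian _) a b hw _

/-- The value of the De Donder form depends only on the `2`-jet of the Lagrangian. -/
theorem deDonderVal_congr {L₁ L₂ : JetModel 2 → ℝ} {w : JetModel 3}
    (h₁ : ContDiffAt ℝ ∞ L₁ (truncate (by norm_num) w))
    (h₂ : ContDiffAt ℝ ∞ L₂ (truncate (by norm_num) w))
    (h : ∀ m ≤ 2, iteratedFDeriv ℝ m L₁ (truncate (by norm_num) w) =
      iteratedFDeriv ℝ m L₂ (truncate (by norm_num) w)) (v : Fin 4 → JetModel 3) :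
    deDonderVal L₁ w v = deDonderVal L₂ w v := by
  have h0 : L₁ (truncate (by norm_num) w) = L₂ (truncate (by norm_num) w) := by
    have := congrArg (fun f => f 0) (h 0 (by norm_num))
    simpa using this
  have hc : ∀ {m : ℕ} (μ ν : Fin 4) (α : Fin m → Fin 4),
      coeffZ L₁ μ ν α (truncate (by norm_num) w) = coeffZ L₂ μ ν α (truncate (by norm_num) w) := by
    intro m μ ν α
    have := congrArg (fun f => f fun _ => (0, symUnit 2 μ ν α)) (h 1 (by norm_num))
    simpa [coeffZ, iteratedFDeriv_one_apply] using this
  have hs : ∀ {L : JetModel 2 → ℝ}, ContDiffAt ℝ ∞ L (truncate (by norm_num) w) →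
      ∀ {m : ℕ} (μ ν : Fin 4) (α : Fin m → Fin 4) (e : JetModel 2),
      fderiv ℝ (coeffZ L μ ν α) (truncate (by norm_num) w) e =
        iteratedFDeriv ℝ 2 L (truncate (by norm_num) w) ![e, (0, symUnit 2 μ ν α)] := by
    intro L hL m μ ν α e
    have hd : DifferentiableAt ℝ (fderiv ℝ L) (truncate (by norm_num) w) :=
      (hL.fderiv_right (m := ∞) (infty_add_le 1)).differentiableAt (by simp)
    rw [iteratedFDeriv_two_apply]
    show fderiv ℝ (fun w => fderiv ℝ L w (0, symUnit 2 μ ν α)) _ e = _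
    rw [fderiv_clm_apply hd (differentiableAt_const _)]
    simp
  unfold deDonderVal
  rw [h0]
  congr 1
  · funext μ ν α β
    exact hc μ ν _
  · funext μ ν α
    unfold momentum₁
    rw [hc]
    simp only [hs h₁, hs h₂, h 2 le_rfl]

theorem deDonderForm_congr {Λ₁ Λ₂ : JetForm 2 M} (h₁ : IsLagrangeForm Λ₁) (h₂ : IsLagrangeForm Λ₂)
    {j : Jet 3 M} (h : JetForm.EqToOrder 2 Λ₁ Λ₂ (j.forget (by norm_num))) :
    deDonderForm Λ₁ j = deDonderForm Λ₂ j := by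
  refine AlternatingMap.ext fun v => ?_
  have hx : j.base ∈ (Jet.chartAt' j.base).1.source := mem_chart_source Coord j.base
  have hw : truncate (by norm_num) (Jet.coord (Jet.chartAt' j.base) j) ∈
      Jet.coordTarget 2 (Jet.chartAt' j.base) := Jet.coord_mem (Jet.chartAt' j.base) hx
  have hn := (Jet.isOpen_coordTarget (Jet.chartAt' j.base)).mem_nhds hw
  rw [deDonderForm_apply h₁ hx, deDonderForm_apply h₂ hx]
  refine deDonderVal_congr ((h₁.contDiffOn_lagrangian _).contDiffAt hn)
    ((h₂.contDiffOn_lagrangian _).contDiffAt hn) (fun m hm => ?_) _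
  have := h (Jet.chartAt' j.base) (by rw [Jet.base_forget]; exact hx)
    (fun i => (unitVec i, 0)) m hm
  rwa [Jet.coord_forget (by norm_num) _ hx] at this

/-! ### Naturality -/

variable {M' : Type*} [TopologicalSpace M'] [ChartedSpace Coord M'] [IsManifold (𝓡 4) ∞ M']

theorem mem_source_chart {f : LocalDiffeo M M'} {ψ : SmoothChart M'} {x : M} :
    x ∈ (f.chart ψ).1.source ↔ x ∈ f.e.source ∧ f.e x ∈ ψ.1.source := by
  show x ∈ (f.e ≫ₕ ψ.1).source ↔ _
  simp

variable {k : ℕ}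

theorem LocalDiffeo.jet_mk (f : LocalDiffeo M M') {p : MetricAt M} (h : p.pt ∈ f.e.source) :
    f.jet k (Jet.mk k p) = Jet.mk k ⟨f.push p.σ, f.e p.pt, f.mem_push p.mem h⟩ := by
  unfold LocalDiffeo.jet Jet.mk
  exact dif_pos h

theorem LocalDiffeo.base_jet (f : LocalDiffeo M M') {j : Jet k M} (h : j.base ∈ f.e.source) :
    (f.jet k j).base = f.e j.base := by
  induction j using Quotient.inductionOn with
  | h p => exact congrArg Jet.base (f.jet_mk (k := k) (p := p) h)

/-- The prolongation of `f` is the identity in the coordinates `ψ ∘ f` and `ψ`. -/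
theorem LocalDiffeo.coord_jet (f : LocalDiffeo M M') {ψ : SmoothChart M'} {j : Jet k M}
    (h : j.base ∈ (f.chart ψ).1.source) :
    Jet.coord ψ (f.jet k j) = Jet.coord (f.chart ψ) j := by
  induction j using Quotient.inductionOn with
  | h p =>
    have h' := mem_source_chart.1 h
    have h1 : p.pt ∈ f.e.source := h'.1
    have h2 : f.e p.pt ∈ ψ.1.source := h'.2
    refine (congrArg (Jet.coord ψ) (f.jet_mk (k := k) h1)).trans ?_
    refine (Jet.coord_mk ψ _ h2).trans (Eq.trans ?_ (Jet.coord_mk (f.chart ψ) p h).symm)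
    refine Prod.ext rfl (Subtype.ext ?_)
    funext m μ ν α
    exact f.pd_push p.σ ψ h1 h2 α μ ν

theorem LocalDiffeo.tangentCoord_jet (f : LocalDiffeo M M') {ψ : SmoothChart M'} {j : Jet k M}
    (h : j.base ∈ (f.chart ψ).1.source) (v : JetTangent k M j) :
    tangentCoord ψ (f.jet k j)
      (mfderiv 𝓘(ℝ, JetModel k) 𝓘(ℝ, JetModel k) (f.jet k) j v) =
      tangentCoord (f.chart ψ) j v := by
  have h' := mem_source_chart.1 h
  have hb : (f.jet k j).base ∈ ψ.1.source := by rw [f.base_jet h'.1]; exact h'.2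
  have hψ := (Jet.chart_mdifferentiable (k := k) ψ).mdifferentiableAt (x := f.jet k j) hb
  have hχ := (Jet.chart_mdifferentiable (k := k) (f.chart ψ)).mdifferentiableAt (x := j) h
  have hsymm : MDifferentiableAt 𝓘(ℝ, JetModel k) 𝓘(ℝ, JetModel k) (Jet.chart k ψ).symm
      (Jet.chart k (f.chart ψ) j) := by
    have e : (Jet.chart k (f.chart ψ) j) = Jet.chart k ψ (f.jet k j) := (f.coord_jet h).symm
    rw [e]
    exact (Jet.chart_mdifferentiable (k := k) ψ).mdifferentiableAt_symm
      ((Jet.chart k ψ).map_source hb)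
  have he : f.jet k =ᶠ[𝓝 j] (Jet.chart k ψ).symm ∘ Jet.chart k (f.chart ψ) := by
    filter_upwards [eventually_base_mem h] with j' hj'
    have h'' := mem_source_chart.1 hj'
    have e : Jet.chart k (f.chart ψ) j' = Jet.coord ψ (f.jet k j') := (f.coord_jet hj').symm
    rw [Function.comp_apply, e]
    exact (Jet.chart_symm_coord ψ (by rw [f.base_jet h''.1]; exact h''.2)).symm
  have hf : MDifferentiableAt 𝓘(ℝ, JetModel k) 𝓘(ℝ, JetModel k) (f.jet k) j :=
    (hsymm.comp j hχ).congr_of_eventuallyEq he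
  have hc := mfderiv_comp j hψ hf
  have he2 : (Jet.chart k ψ : Jet k M' → JetModel k) ∘ f.jet k =ᶠ[𝓝 j]
      Jet.chart k (f.chart ψ) := by
    filter_upwards [eventually_base_mem h] with j' hj' using f.coord_jet hj'
  have hm := he2.mfderiv_eq (I := 𝓘(ℝ, JetModel k)) (I' := 𝓘(ℝ, JetModel k))
  exact congrArg (fun L : JetModel k →L[ℝ] JetModel k => L v) (hc.symm.trans hm)

theorem JetForm.pullback_apply (Θ : JetForm k M') (f : LocalDiffeo M M') (j : Jet k M)
    (v : Fin 4 → JetTangent k M j) : Θ.pullback f j v = Θ (f.jet k j)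
      fun i => mfderiv 𝓘(ℝ, JetModel k) 𝓘(ℝ, JetModel k) (f.jet k) j (v i) :=
  rfl

theorem lagrangian_eq_of_pullback {f : LocalDiffeo M M'} {Λ : JetForm 2 M} {Λ' : JetForm 2 M'}
    (hΛ : IsLagrangeForm Λ) (hΛ' : IsLagrangeForm Λ')
    (h : ∀ j : Jet 2 M, j.base ∈ f.e.source → Λ j = Λ'.pullback f j) {ψ : SmoothChart M'}
    {w : JetModel 2} (hw : w ∈ Jet.coordTarget 2 (f.chart ψ)) :
    lagrangian Λ (f.chart ψ) w = lagrangian Λ' ψ w := by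
  set j := (Jet.chart 2 (f.chart ψ)).symm w with hjdef
  have hj : j.base ∈ (f.chart ψ).1.source := base_chart_symm _ hw
  have hjw : Jet.coord (f.chart ψ) j = w := coord_chart_symm _ hw
  have h' := mem_source_chart.1 hj
  have hb : (f.jet 2 j).base ∈ ψ.1.source := by rw [f.base_jet h'.1]; exact h'.2
  obtain ⟨u, -, hu⟩ := exists_d4x_eq_one hj
  have h1 := congrArg (fun F => F u) (h j h'.1)
  rw [hΛ.eq_smul hj, hjw] at h1
  have h2 : Λ'.pullback f j u = lagrangian Λ' ψ (Jet.coord ψ (f.jet 2 j)) * d4x ψ (f.jet 2 j)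
      fun i => mfderiv 𝓘(ℝ, JetModel 2) 𝓘(ℝ, JetModel 2) (f.jet 2) j (u i) := by
    rw [JetForm.pullback_apply, hΛ'.eq_smul hb]
    rfl
  have h3 : (d4x ψ (f.jet 2 j)
      fun i => mfderiv 𝓘(ℝ, JetModel 2) 𝓘(ℝ, JetModel 2) (f.jet 2) j (u i)) = 1 := by
    rw [← hu, d4x_apply hb, d4x_apply hj]
    simp only [f.tangentCoord_jet hj]
  have h4 := h1.trans h2
  rw [h3, f.coord_jet hj, hjw, mul_one] at h4
  simpa only [AlternatingMap.smul_apply, smul_eq_mul, hu, mul_one] using h4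

theorem deDonderVal_congr_of_eqOn {S : Set (JetModel 2)} (hS : IsOpen S) {L₁ L₂ : JetModel 2 → ℝ}
    (h : Set.EqOn L₁ L₂ S) {w : JetModel 3} (hw : truncate (by norm_num) w ∈ S)
    (v : Fin 4 → JetModel 3) : deDonderVal L₁ w v = deDonderVal L₂ w v := by
  have hc : ∀ {m : ℕ} (μ ν : Fin 4) (α : Fin m → Fin 4),
      Set.EqOn (coeffZ L₁ μ ν α) (coeffZ L₂ μ ν α) S := fun μ ν α w hw => by
    unfold coeffZ
    rw [(h.eventuallyEq_of_mem (hS.mem_nhds hw)).fderiv_eq]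
  unfold deDonderVal
  rw [h hw]
  congr 1
  · funext μ ν α β
    exact hc μ ν _ hw
  · funext μ ν α
    unfold momentum₁
    rw [hc μ ν _ hw]
    simp only [((hc μ ν _).eventuallyEq_of_mem (hS.mem_nhds hw)).fderiv_eq]

/-- Naturality: in the coordinates `ψ ∘ f` and `ψ` the prolongation of `f` is the identity, so that
both sides are given by the same Lagrangian. -/
theorem deDonderForm_pullback {f : LocalDiffeo M M'} {Λ : JetForm 2 M} {Λ' : JetForm 2 M'}
    (hΛ : IsLagrangeForm Λ) (hΛ' : IsLagrangeForm Λ')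
    (h : ∀ j : Jet 2 M, j.base ∈ f.e.source → Λ j = Λ'.pullback f j) {j : Jet 3 M}
    (hj : j.base ∈ f.e.source) : deDonderForm Λ j = (deDonderForm Λ').pullback f j := by
  obtain ⟨ψ, hψ⟩ : ∃ ψ : SmoothChart M', f.e j.base ∈ ψ.1.source :=
    ⟨Jet.chartAt' (f.e j.base), mem_chart_source Coord _⟩
  have hχ : j.base ∈ (f.chart ψ).1.source := mem_source_chart.2 ⟨hj, hψ⟩
  have hb : (f.jet 3 j).base ∈ ψ.1.source := by rw [f.base_jet hj]; exact hψ
  have hw : truncate (by norm_num) (Jet.coord (f.chart ψ) j) ∈ Jet.coordTarget 2 (f.chart ψ) :=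
    Jet.coord_mem (f.chart ψ) hχ
  refine AlternatingMap.ext fun v => ?_
  have h1 : (deDonderForm Λ').pullback f j v = deDonderVal (lagrangian Λ' ψ)
      (Jet.coord (f.chart ψ) j) (fun i => tangentCoord (f.chart ψ) j (v i)) := by
    rw [JetForm.pullback_apply, deDonderForm_apply hΛ' hb, f.coord_jet hχ]
    simp only [f.tangentCoord_jet hχ]
  rw [h1, deDonderForm_apply hΛ hχ]
  exact deDonderVal_congr_of_eqOn (Jet.isOpen_coordTarget (f.chart ψ))
    (fun w hw => lagrangian_eq_of_pullback hΛ hΛ' h hw) hw _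

end

end DeDonder

end

theorem theorem2 {M : Type*} [TopologicalSpace M] [ChartedSpace DeDonder.Coord M]
    [IsManifold (𝓡 4) ∞ M] (𝒪 : DeDonder.OrientedAtlas M) :
    -- For every invariant second-order Lagrange form `Λ` the local De Donder forms exist, do not
    -- depend on the positively oriented coordinates, and define a unique global De Donder form.
    (∀ Λ : DeDonder.JetForm 2 M, DeDonder.IsLagrangeForm Λ → DeDonder.IsInvariant 𝒪 Λ →
      (∀ φ ∈ 𝒪.charts, ∃ Θ : DeDonder.JetForm 3 M, DeDonder.IsDeDonderIn φ Λ Θ) ∧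
      (∀ φ ∈ 𝒪.charts, ∀ ψ ∈ 𝒪.charts, ∀ Θ₁ Θ₂ : DeDonder.JetForm 3 M,
        DeDonder.IsDeDonderIn φ Λ Θ₁ → DeDonder.IsDeDonderIn ψ Λ Θ₂ →
        ∀ j : DeDonder.Jet 3 M, j.base ∈ φ.1.source → j.base ∈ ψ.1.source → Θ₁ j = Θ₂ j) ∧
      ∃! Θ : DeDonder.JetForm 3 M, DeDonder.IsDeDonder 𝒪 Λ Θ) ∧
    -- The map `Λ ↦ Θ` is a linear differential operator of order (at most) two:
    (∀ (Λ₁ Λ₂ : DeDonder.JetForm 2 M) (Θ₁ Θ₂ : DeDonder.JetForm 3 M),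
      DeDonder.IsLagrangeForm Λ₁ → DeDonder.IsInvariant 𝒪 Λ₁ →
      DeDonder.IsLagrangeForm Λ₂ → DeDonder.IsInvariant 𝒪 Λ₂ →
      DeDonder.IsDeDonder 𝒪 Λ₁ Θ₁ → DeDonder.IsDeDonder 𝒪 Λ₂ Θ₂ →
      (∀ a b : ℝ, DeDonder.IsDeDonder 𝒪 (a • Λ₁ + b • Λ₂) (a • Θ₁ + b • Θ₂)) ∧
      ∀ j : DeDonder.Jet 3 M,
        DeDonder.JetForm.EqToOrder 2 Λ₁ Λ₂ (j.forget (by norm_num)) → Θ₁ j = Θ₂ j) ∧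
    -- and it is natural: it commutes with the pull-back by orientation preserving local
    -- diffeomorphisms between oriented 4-manifolds.
    ∀ (M' : Type*) [TopologicalSpace M'] [ChartedSpace DeDonder.Coord M'] [IsManifold (𝓡 4) ∞ M']
      (𝒪' : DeDonder.OrientedAtlas M') (f : DeDonder.LocalDiffeo M M')
      (Λ : DeDonder.JetForm 2 M) (Λ' : DeDonder.JetForm 2 M')
      (Θ : DeDonder.JetForm 3 M) (Θ' : DeDonder.JetForm 3 M'),
      f.PreservesOrientation 𝒪 𝒪' →
      DeDonder.IsLagrangeForm Λ → DeDonder.IsInvariant 𝒪 Λ →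
      DeDonder.IsLagrangeForm Λ' → DeDonder.IsInvariant 𝒪' Λ' →
      DeDonder.IsDeDonder 𝒪 Λ Θ → DeDonder.IsDeDonder 𝒪' Λ' Θ' →
      (∀ j : DeDonder.Jet 2 M, j.base ∈ f.e.source → Λ j = Λ'.pullback f j) →
      ∀ j : DeDonder.Jet 3 M, j.base ∈ f.e.source → Θ j = Θ'.pullback f j := by
  refine ⟨fun Λ hΛ _ => ⟨fun φ _ => ⟨_, DeDonder.isDeDonderIn_deDonderForm hΛ φ⟩, ?_, ?_⟩, ?_, ?_⟩
  · intro φ _ ψ _ Θ₁ Θ₂ h₁ h₂ j hφ hψ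
    rw [h₁.eq_deDonderForm hΛ hφ, h₂.eq_deDonderForm hΛ hψ]
  · exact ⟨DeDonder.deDonderForm Λ, DeDonder.isDeDonder_deDonderForm 𝒪 hΛ,
      fun Θ h => h.eq_deDonderForm hΛ⟩
  · intro Λ₁ Λ₂ Θ₁ Θ₂ hΛ₁ _ hΛ₂ _ h₁ h₂
    rw [h₁.eq_deDonderForm hΛ₁, h₂.eq_deDonderForm hΛ₂]
    refine ⟨fun a b => ?_, fun j hj => DeDonder.deDonderForm_congr hΛ₁ hΛ₂ hj⟩
    rw [← DeDonder.deDonderForm_lin hΛ₁ hΛ₂]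
    exact DeDonder.isDeDonder_deDonderForm 𝒪 (hΛ₁.lin hΛ₂ a b)
  · intro M' _ _ _ 𝒪' f Λ Λ' Θ Θ' _ hΛ _ hΛ' _ h h' hpull j hj
    rw [h.eq_deDonderForm hΛ, h'.eq_deDonderForm hΛ']
    exact DeDonder.deDonderForm_pullback hΛ hΛ' hpull hj
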